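/- Let $\mathbb K\in\{\mathbb R,\mathbb C\}$, let $\mathbf R_1,\dots,\mathbf R_K\in\mathbb R^3$ be positions of nuclei with charges $Z_1,\dots,Z_K\in\mathbb N$, let $V_{\rm ext}(\mathbf r)=-\sum_{\eta=1}^K Z_\eta/|\mathbf r-\mathbf R_\eta|$ and $h=-\frac12\Delta+V_{\rm ext}$, and for $M\ge 0$ let $$H_M=-\tfrac12\sum_{\xi=1}^M\Delta_\xi+\sum_{\xi=1}^M V_{\rm ext}(\mathbf r_\xi)+\tfrac12\sum_{\xi=1}^M\sum_{\zeta\ne\xi}\frac1{|\mathbf r_\xi-\mathbf r_\zeta|}$$ be the electronic Hamiltonian of $M$ electrons with coordinates $(\mathbf r_\xi,s_\xi)\in\mathbb R^3\times\mathbb Z_2$. Inner products are conjugate linear in the first argument, and $\langle\Phi,H_M\Psi\rangle$, $\langle f,hg\rangle$ are understood in the weak sense, i.e. the kinetic parts are $\frac12\sum_\xi\langle\nabla_\xi\Phi,\nabla_\xi\Psi\rangle$ and $\frac12\langle\nabla f,\nabla g\rangle$. Let $\mathbb H^1_M$ be the space of antisymmetric functions in $L_2((\mathbb R^3\times\mathbb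 Z_2)^M,\mathbb K)$ whose first weak partial derivatives lie in $L_2$. Let $\varphi_1,\dots,\varphi_d\in H^1(\mathbb R^3\times\mathbb Z_2,\mathbb K)$ be $L_2$-orthonormal. For $1\le p_1<\dots<p_M\le d$ let $\Psi_{[p_1,\dots,p_M]}=\frac1{\sqrt{M!}}\det(\varphi_{p_\xi}(\mathbf r_\zeta,s_\zeta))_{\xi,\zeta=1}^M$, let $\mathcal V_M^d$ be the span of these Slater determinants in $L_2$, and let $\mathcal F^d=\bigoplus_{M=0}^d\mathcal V^d_M$ be the orthogonal direct sum. Let $\mathcal H^d=\bigotimes_{i=1}^d\mathbb K^2$ with its $\ell_2$ inner product and let $\mathbf e^0=(1,0)^T$, $\mathbf e^1=(0,1)^T$. Put $$A=\begin{pmatrix}0&1\\0&0\end{pmatrix},\quad S=\begin{pmatrix}1&0\\0&-1\end{pmatrix},\quad I=\begin{pmatrix}1&0\\0&1\end{pmatrix},\qquad \mathbf a_p=S\otimes\dots\otimes S\otimes A_{(p)}\otimes I\otimes\dots\otimes I,$$ with $A$ at position $p$, and let $\mathbf a_p^\dagger$ be the adjoint of $\mathbf a_p$. **Theorem.** (0)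 $\mathcal V_M^d\subseteq\mathbb H^1_M$ for all $M$, and all Coulomb integrals occurring in $\langle\Phi,H_M\Psi\rangle$ for $\Phi,\Psi\in\mathcal V_M^d$, and in $$h^q_p=\langle\varphi_q,h\varphi_p\rangle,\qquad g^{a,b}_{p,q}=\sum_{s,s'}\int\!\!\int\frac{\overline{\varphi_a(\mathbf r,s)}\,\overline{\varphi_b(\mathbf r',s')}\,\varphi_q(\mathbf r,s)\,\varphi_p(\mathbf r',s')}{|\mathbf r-\mathbf r'|}\,d\mathbf r\,d\mathbf r',$$ converge absolutely. (1) There is a surjective linear isometry $\iota:\mathcal F^d\to\mathcal H^d$ with $\iota\Psi_{[p_1,\dots,p_M]}=\mathbf e^{\nu_1}\otimes\dots\otimes\mathbf e^{\nu_d}$, where $\nu_i=1$ if $i\in\{p_1,\dots,p_M\}$ and $\nu_i=0$ otherwise. For $0\le M\le d$ there is a linear operator $\Pi^d_MH_M$ on $\mathcal V_M^d$ with $\langle\Phi,\Pi^d_MH_M\Psi\rangle=\langle\Phi,H_M\Psi\rangle$ for all $\Phi,\Psi\in\mathcal V_M^d$. (2) Let $\mathbf H=\iota\circ\big(\bigoplus_{M=0}^d\Pi^d_MH_M\big)\circ\iota^\dagger$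 and $\mathbf P=\iota\circ P\circ\iota^\dagger$, where $P$ is the number operator, $P\Psi=M\Psi$ for $\Psi\in\mathcal V^d_M$. Then $$\mathbf H=\sum_{p,q=1}^d h^q_p\,\mathbf a_q^\dagger\mathbf a_p+\frac12\sum_{a,b,p,q=1}^d g^{a,b}_{p,q}\,\mathbf a_a^\dagger\mathbf a_b^\dagger\mathbf a_p\mathbf a_q,\qquad \mathbf P=\sum_{p=1}^d\mathbf a_p^\dagger\mathbf a_p .$$ (3) Let $0\le N\le d$. Then $\{V\in\mathcal H^d:\mathbf PV=NV\}=\iota(\mathcal V_N^d)$, the functional $V\mapsto\langle\mathbf HV,V\rangle$ has a minimiser on $\{V\in\mathcal H^d:\langle V,V\rangle=1,\ \mathbf PV=NV\}$, and for $\Psi\in\mathcal V_N^d$ the following are equivalent: (a) $\langle\Psi,\Psi\rangle=1$ and $\Psi$ solves the discrete (Full CI) Schrödinger equation $\langle\Phi,H_N\Psi\rangle=E\langle\Phi,\Psi\rangle$ for all $\Phi\in\mathcal V^d_N$, with $E$ its lowest real eigenvalue; (b) $\Psi$ minimises $\langle\Phi,H_N\Phi\rangle$ over all $\Phi\in\mathcal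 V^d_N$ with $\langle\Phi,\Phi\rangle=1$; (c) $U=\iota\Psi$ minimises $\langle\mathbf HV,V\rangle$ over all $V\in\mathcal H^d$ with $\langle V,V\rangle=1$, $\mathbf PV=NV$. -/

import Mathlib

open MeasureTheory
open scoped ComplexConjugate InnerProductSpace ContDiff ENNReal

noncomputable section

namespace FullCI

/-! ### Configuration spaces and `L²` -/

/-- Physical space `ℝ³` with its Euclidean norm. -/
abbrev Space : Type := EuclideanSpace ℝ (Fin 3)

/-- The two values `± 1/2` of the spin variable. -/
abbrev Spin : Type := Fin 2

/-- The configuration space `ℝ³ × ℤ₂` of one electron: a position and a spin. -/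
abbrev Site : Type := Space × Spin

/-- The configuration space `(ℝ³ × ℤ₂)^N` of `N` electrons. -/
abbrev Config (N : ℕ) : Type := Fin N → Site

/-- Integration over `ℝ³` and summation over the spin. -/
def siteMeasure : Measure Site := (volume : Measure Space).prod Measure.count

instance : SigmaFinite siteMeasure := by unfold siteMeasure; infer_instance

/-- Integration over all positions and summation over all spins of `N` electrons. -/
def configMeasure (N : ℕ) : Measure (Config N) := Measure.pi fun _ => siteMeasure

instance (N : ℕ) : SigmaFinite (configMeasure N) := by unfold configMeasure; infer_instance

/-- `L₂(ℝ³ × ℤ₂, 𝕜)`. -/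
abbrev OneL2 (𝕜 : Type*) [RCLike 𝕜] : Type _ := Lp 𝕜 2 siteMeasure

/-- `L₂((ℝ³ × ℤ₂)^N, 𝕜)`. -/
abbrev L2 (𝕜 : Type*) [RCLike 𝕜] (N : ℕ) : Type _ := Lp 𝕜 2 (configMeasure N)

/-! ### Weak derivatives and energy spaces -/

/-- `g` is the weak derivative of `f` in the direction `v` (for locally integrable `f`, `g`):
`∫ (∂_v η) f = - ∫ η g` for every real test function `η ∈ C_c^∞(E)`. -/
def HasWeakLineDeriv {𝕜 E : Type*} [RCLike 𝕜] [NormedAddCommGroup E] [NormedSpace ℝ E]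
    [MeasureSpace E] (f g : E → 𝕜) (v : E) : Prop :=
  ∀ η : E → ℝ, ContDiff ℝ ∞ η → HasCompactSupport η →
    ∫ r, ((fderiv ℝ η r v : ℝ) : 𝕜) * f r = -∫ r, ((η r : ℝ) : 𝕜) * g r

/-- The `i`-th coordinate vector of `ℝ³`. -/
def coordVec (i : Fin 3) : Space := EuclideanSpace.single i 1

section OneElectron

variable {𝕜 : Type*} [RCLike 𝕜]

/-- `g ∈ L₂` is the weak partial derivative `∂f/∂r_i` of the one-electron function `f`,
for each value of the spin. -/
def OneHasWeakDeriv (i : Fin 3) (f g : OneL2 𝕜) : Prop :=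
  ∀ s : Spin, HasWeakLineDeriv (fun r : Space => f (r, s)) (fun r => g (r, s)) (coordVec i)

/-- `f ∈ H¹(ℝ³ × ℤ₂, 𝕜)`: all first weak partial derivatives exist in `L₂`. -/
def OneMemH1 (f : OneL2 𝕜) : Prop := ∀ i, ∃ g, OneHasWeakDeriv i f g

open Classical in
/-- The weak partial derivative `∂f/∂r_i ∈ L₂` (zero if there is none). -/
def oneWeakDeriv (i : Fin 3) (f : OneL2 𝕜) : OneL2 𝕜 :=
  if h : ∃ g, OneHasWeakDeriv i f g then h.choose else 0

end OneElectron

section ManyElectrons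

variable {𝕜 : Type*} [RCLike 𝕜] {N : ℕ}

/-- The configuration with positions `r` and spins `s`. -/
def mkConfig (r : Fin N → Space) (s : Fin N → Spin) : Config N := fun ξ => (r ξ, s ξ)

/-- `g ∈ L₂` is the weak partial derivative of `f` with respect to the `i`-th coordinate of the
position `r_ξ` of electron `ξ`, for each value of the spins. -/
def HasWeakDeriv (ξ : Fin N) (i : Fin 3) (f g : L2 𝕜 N) : Prop :=
  ∀ s : Fin N → Spin, HasWeakLineDeriv (fun r : Fin N → Space => f (mkConfig r s))
    (fun r => g (mkConfig r s)) (Pi.single ξ (coordVec i))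

open Classical in
/-- The weak partial derivative in `L₂` (zero if there is none). -/
def weakDeriv (ξ : Fin N) (i : Fin 3) (f : L2 𝕜 N) : L2 𝕜 N :=
  if h : ∃ g, HasWeakDeriv ξ i f g then h.choose else 0

variable (𝕜 N) in
/-- The space `ℍ¹_N` of wave functions: antisymmetric functions in `L₂((ℝ³ × ℤ₂)^N)` all of whose
first weak partial derivatives lie in `L₂`. -/
def energySpace : Set (L2 𝕜 N) :=
  {f | (∀ σ : Equiv.Perm (Fin N), (fun x : Config N => f (x ∘ σ)) =ᵐ[configMeasure N]
          fun x => ((Equiv.Perm.sign σ : ℤ) : 𝕜) * f x) ∧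
       ∀ ξ i, ∃ g, HasWeakDeriv ξ i f g}

end ManyElectrons

/-! ### The electronic Hamiltonian -/

section Hamiltonian

variable {𝕜 : Type*} [RCLike 𝕜] {K : ℕ}

/-- The exterior potential `V_ext(r) = - ∑_η Z_η / |r - R_η|`. -/
def extPotential (Z : Fin K → ℕ) (R : Fin K → Space) (r : Space) : ℝ :=
  -∑ η, (Z η : ℝ) / ‖r - R η‖

/-- The integrand of the potential energy of electron `ξ` in the field of the nuclei. -/
def nuclearIntegrand (Z : Fin K → ℕ) (R : Fin K → Space) {N : ℕ} (ξ : Fin N) (Φ Ψ : L2 𝕜 N)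
    (x : Config N) : 𝕜 :=
  conj (Φ x) * ((extPotential Z R (x ξ).1 : ℝ) : 𝕜) * Ψ x

/-- The integrand of the Coulomb repulsion of the electrons `ξ` and `ζ`. -/
def repulsionIntegrand {N : ℕ} (ξ ζ : Fin N) (Φ Ψ : L2 𝕜 N) (x : Config N) : 𝕜 :=
  conj (Φ x) * ((1 / ‖(x ξ).1 - (x ζ).1‖ : ℝ) : 𝕜) * Ψ x

/-- `⟨Φ, H Ψ⟩` in its weak form, where
`H = -1/2 ∑_ξ Δ_ξ - ∑_ξ ∑_η Z_η / |r_ξ - R_η| + 1/2 ∑_ξ ∑_{ζ ≠ ξ} 1 / |r_ξ - r_ζ|`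
is the electronic Hamiltonian of `N` electrons. -/
def energyForm (Z : Fin K → ℕ) (R : Fin K → Space) {N : ℕ} (Φ Ψ : L2 𝕜 N) : 𝕜 :=
  (1 / 2) * ∑ ξ : Fin N, ∑ i : Fin 3, ⟪weakDeriv ξ i Φ, weakDeriv ξ i Ψ⟫_𝕜
    + ∑ ξ : Fin N, ∫ x, nuclearIntegrand Z R ξ Φ Ψ x ∂configMeasure N
    + (1 / 2) * ∑ ξ : Fin N, ∑ ζ ∈ Finset.univ.erase ξ,
        ∫ x, repulsionIntegrand ξ ζ Φ Ψ x ∂configMeasure N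

/-- The integrand of the potential part of the one-electron integral. -/
def oneElectronIntegrand (Z : Fin K → ℕ) (R : Fin K → Space) (f g : OneL2 𝕜) (s : Spin)
    (r : Space) : 𝕜 :=
  conj (f (r, s)) * ((extPotential Z R r : ℝ) : 𝕜) * g (r, s)

/-- `⟨f, h g⟩` in its weak form, where `h = -1/2 Δ + V_ext`. -/
def oneElectronForm (Z : Fin K → ℕ) (R : Fin K → Space) (f g : OneL2 𝕜) : 𝕜 :=
  (1 / 2) * ∑ i : Fin 3, ⟪oneWeakDeriv i f, oneWeakDeriv i g⟫_𝕜
    + ∑ s : Spin, ∫ r, oneElectronIntegrand Z R f g s r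

variable {d : ℕ}

/-- The single-electron integral `h^q_p = ⟨φ_q, h φ_p⟩`. -/
def hCoeff (Z : Fin K → ℕ) (R : Fin K → Space) (φ : Fin d → OneL2 𝕜) (q p : Fin d) : 𝕜 :=
  oneElectronForm Z R (φ q) (φ p)

/-- The integrand of the two-electron integral `g^{a,b}_{p,q}`. -/
def twoElectronIntegrand (φ : Fin d → OneL2 𝕜) (a b p q : Fin d) (s s' : Spin)
    (r r' : Space) : 𝕜 :=
  conj (φ a (r, s)) * conj (φ b (r', s')) * φ q (r, s) * φ p (r', s') / ((‖r - r'‖ : ℝ) : 𝕜)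

/-- The two-electron integral `g^{a,b}_{p,q}`. -/
def gCoeff (φ : Fin d → OneL2 𝕜) (a b p q : Fin d) : 𝕜 :=
  ∑ s : Spin, ∑ s' : Spin, ∫ r, ∫ r', twoElectronIntegrand φ a b p q s s' r r'

end Hamiltonian

/-! ### Slater determinants, Full CI spaces and the discrete Fock space -/

section Slater

variable {𝕜 : Type*} [RCLike 𝕜] {d : ℕ}

/-- The function `(M!)^{-1/2} det (φ_{p_ξ}(x_ζ))_{ξ,ζ}`. -/
def slaterFun (φ : Fin d → OneL2 𝕜) {M : ℕ} (p : Fin M → Fin d) (x : Config M) : 𝕜 :=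
  ((1 / Real.sqrt (M.factorial : ℝ) : ℝ) : 𝕜) *
    Matrix.det (Matrix.of fun ξ ζ : Fin M => φ (p ξ) (x ζ))

theorem memLp_prod {M : ℕ} (f : Fin M → OneL2 𝕜) :
    MemLp (fun x : Config M => ∏ ζ, f ζ (x ζ)) 2 (configMeasure M) := by
  have hm : AEStronglyMeasurable (fun x : Config M => ∏ ζ, f ζ (x ζ)) (configMeasure M) := by
    refine Finset.aestronglyMeasurable_fun_prod _ fun ζ _ => ?_
    exact (Lp.aestronglyMeasurable (f ζ)).comp_quasiMeasurePreserving
      (Measure.quasiMeasurePreserving_eval (fun _ : Fin M => siteMeasure) ζ)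
  rw [memLp_two_iff_integrable_sq_norm hm]
  have h : ∀ ζ, Integrable (fun y => ‖f ζ y‖ ^ 2) siteMeasure := fun ζ =>
    (memLp_two_iff_integrable_sq_norm (Lp.aestronglyMeasurable (f ζ))).1 (Lp.memLp (f ζ))
  have := Integrable.fintype_prod (μ := fun _ : Fin M => siteMeasure)
    (f := fun ζ y => ‖f ζ y‖ ^ 2) h
  simpa [configMeasure, norm_prod, Finset.prod_pow] using this

theorem memLp_slaterFun (φ : Fin d → OneL2 𝕜) {M : ℕ} (p : Fin M → Fin d) :
    MemLp (slaterFun φ p) 2 (configMeasure M) := by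
  unfold slaterFun
  refine MemLp.const_mul ?_ _
  simp only [Matrix.det_apply', Matrix.of_apply]
  refine memLp_finsetSum _ fun σ _ => MemLp.const_mul ?_ _
  have h := memLp_prod fun ζ => φ (p (σ ζ))
  exact h

/-- The Slater determinant `Ψ_{[p_1, …, p_M]}`. -/
def slater (φ : Fin d → OneL2 𝕜) {M : ℕ} (p : Fin M → Fin d) : L2 𝕜 M :=
  (memLp_slaterFun φ p).toLp (slaterFun φ p)

/-- The Full CI space `𝒱^d_M`, spanned by all Slater determinants `Ψ_{[p_1, …, p_M]}` with
`p_1 < … < p_M`. -/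
def fciSpace (φ : Fin d → OneL2 𝕜) (M : ℕ) : Submodule 𝕜 (L2 𝕜 M) :=
  Submodule.span 𝕜 (Set.range fun p : Fin M ↪o Fin d => slater φ p)

/-- A Slater determinant as an element of the Full CI space. -/
def slaterFCI (φ : Fin d → OneL2 𝕜) {M : ℕ} (p : Fin M ↪o Fin d) : fciSpace φ M :=
  ⟨slater φ p, Submodule.subset_span ⟨p, rfl⟩⟩

/-- The discrete Fock space `ℱ^d = ⨁_{M=0}^d 𝒱^d_M`, an orthogonal direct sum. -/
abbrev Fock (φ : Fin d → OneL2 𝕜) : Type _ :=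
  PiLp 2 fun M : Fin (d + 1) => fciSpace φ (M : ℕ)

/-- The inclusion of `𝒱^d_M` in the Fock space. -/
def Fock.incl (φ : Fin d → OneL2 𝕜) (M : Fin (d + 1)) (Ψ : fciSpace φ (M : ℕ)) : Fock φ :=
  WithLp.toLp 2 (Pi.single M Ψ)

/-- The operator on the Fock space that acts on the summand `𝒱^d_M` as `T M`. -/
def Fock.blockDiag (φ : Fin d → OneL2 𝕜)
    (T : ∀ M : Fin (d + 1), fciSpace φ (M : ℕ) →ₗ[𝕜] fciSpace φ (M : ℕ)) :
    Fock φ →ₗ[𝕜] Fock φ where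
  toFun Ψ := WithLp.toLp 2 fun M => T M (Ψ M)
  map_add' Φ Ψ := by ext M; simp
  map_smul' c Ψ := by ext M; simp

/-- The particle number operator `P` of the Fock space: `P Ψ = M Ψ` for `Ψ ∈ 𝒱^d_M`. -/
def Fock.number (φ : Fin d → OneL2 𝕜) : Fock φ →ₗ[𝕜] Fock φ :=
  Fock.blockDiag φ fun M => ((M : ℕ) : 𝕜) • LinearMap.id

/-- `T` is the Galerkin projection `Π^d_M H` of the electronic Hamiltonian on `𝒱^d_M`:
`⟨Φ, T Ψ⟩ = ⟨Φ, H Ψ⟩` for all `Φ, Ψ ∈ 𝒱^d_M`. This determines `T` uniquely. -/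
def IsGalerkinHamiltonian {K : ℕ} (Z : Fin K → ℕ) (R : Fin K → Space) (φ : Fin d → OneL2 𝕜)
    (M : ℕ) (T : fciSpace φ M →ₗ[𝕜] fciSpace φ M) : Prop :=
  ∀ Φ Ψ : fciSpace φ M, ⟪Φ, T Ψ⟫_𝕜 = energyForm Z R (Φ : L2 𝕜 M) (Ψ : L2 𝕜 M)

end Slater

/-! ### The binary Fock space -/

section Binary

variable (𝕜 : Type*) [RCLike 𝕜] (d : ℕ)

/-- `ℋ^d = ⨂_{i=1}^d 𝕜²`, identified through its canonical basis with the space of all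
functions `U(μ_1, …, μ_d)`, `μ_i ∈ {0, 1}`, with the `ℓ₂` inner product. -/
abbrev Binary : Type _ := EuclideanSpace 𝕜 (Fin d → Fin 2)

variable {𝕜 d}

/-- The elementary tensor `v_1 ⊗ ⋯ ⊗ v_d`. -/
def tensorVec (v : Fin d → Fin 2 → 𝕜) : Binary 𝕜 d :=
  WithLp.toLp 2 fun μ => ∏ i, v i (μ i)

/-- The operator `B_1 ⊗ ⋯ ⊗ B_d` on `ℋ^d`. -/
def tensorOp (B : Fin d → Matrix (Fin 2) (Fin 2) 𝕜) : Binary 𝕜 d →ₗ[𝕜] Binary 𝕜 d :=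
  Matrix.toEuclideanLin (Matrix.of fun μ ν : Fin d → Fin 2 => ∏ i, B i (μ i) (ν i))

/-- `(B_1 ⊗ ⋯ ⊗ B_d) (v_1 ⊗ ⋯ ⊗ v_d) = B_1 v_1 ⊗ ⋯ ⊗ B_d v_d`. -/
theorem tensorOp_tensorVec (B : Fin d → Matrix (Fin 2) (Fin 2) 𝕜) (v : Fin d → Fin 2 → 𝕜) :
    tensorOp B (tensorVec v) = tensorVec fun i => (B i).mulVec (v i) := by
  ext μ
  simp only [tensorOp, tensorVec, Matrix.toLpLin_toLp]
  change ∑ x : Fin d → Fin 2, (∏ i, B i (μ i) (x i)) * ∏ i, v i (x i) =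
    ∏ i, ∑ j, B i (μ i) j * v i j
  simp only [Finset.prod_univ_sum, Finset.prod_mul_distrib, Fintype.piFinset_univ]

/-- The canonical basis vector `e^k` of `𝕜²`. -/
def e (k : Fin 2) : Fin 2 → 𝕜 := Pi.single k 1

/-- The occupation numbers of `{p_1, …, p_M}`: `ν_i = 1` if `i` is one of the `p_ξ`, else `0`. -/
def occupation {M : ℕ} (p : Fin M ↪o Fin d) (i : Fin d) : Fin 2 :=
  open Classical in if i ∈ Set.range p then 1 else 0

variable (𝕜)

/-- The matrix `A`. -/
def matA : Matrix (Fin 2) (Fin 2) 𝕜 := !![0, 1; 0, 0]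

/-- The matrix `S`. -/
def matS : Matrix (Fin 2) (Fin 2) 𝕜 := !![1, 0; 0, -1]

/-- The annihilation operator `𝐚_p = S ⊗ ⋯ ⊗ S ⊗ A ⊗ I ⊗ ⋯ ⊗ I` with `A` at position `p`. -/
def annihilate (p : Fin d) : Binary 𝕜 d →ₗ[𝕜] Binary 𝕜 d :=
  tensorOp fun i => if i < p then matS 𝕜 else if i = p then matA 𝕜 else 1

/-- The creation operator `𝐚_p†`. -/
def create (p : Fin d) : Binary 𝕜 d →ₗ[𝕜] Binary 𝕜 d := LinearMap.adjoint (annihilate 𝕜 p)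

variable {𝕜}

/-- `∑ h^q_p 𝐚_q† 𝐚_p + 1/2 ∑ g^{a,b}_{p,q} 𝐚_a† 𝐚_b† 𝐚_p 𝐚_q`. -/
def binaryHamiltonian {K : ℕ} (Z : Fin K → ℕ) (R : Fin K → Space) (φ : Fin d → OneL2 𝕜) :
    Binary 𝕜 d →ₗ[𝕜] Binary 𝕜 d :=
  ∑ p, ∑ q, hCoeff Z R φ q p • (create 𝕜 q ∘ₗ annihilate 𝕜 p)
    + (1 / 2 : 𝕜) • ∑ a, ∑ b, ∑ p, ∑ q, gCoeff φ a b p q •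
        (create 𝕜 a ∘ₗ create 𝕜 b ∘ₗ annihilate 𝕜 p ∘ₗ annihilate 𝕜 q)

variable (𝕜 d) in
/-- `∑_p 𝐚_p† 𝐚_p`. -/
def binaryNumber : Binary 𝕜 d →ₗ[𝕜] Binary 𝕜 d := ∑ p, create 𝕜 p ∘ₗ annihilate 𝕜 p

end Binary

/-! ### Ground states -/

section GroundStates

variable {𝕜 : Type*} [RCLike 𝕜] {d K : ℕ}

/-- `Ψ` minimises the energy `⟨Φ, H Φ⟩` over the unit sphere of `𝒱^d_N`. -/
def IsRitzGroundState (Z : Fin K → ℕ) (R : Fin K → Space) (φ : Fin d → OneL2 𝕜) (N : ℕ)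
    (Ψ : fciSpace φ N) : Prop :=
  ⟪Ψ, Ψ⟫_𝕜 = 1 ∧ ∀ Φ : fciSpace φ N, ⟪Φ, Φ⟫_𝕜 = 1 →
    RCLike.re (energyForm Z R (Ψ : L2 𝕜 N) (Ψ : L2 𝕜 N)) ≤
      RCLike.re (energyForm Z R (Φ : L2 𝕜 N) (Φ : L2 𝕜 N))

/-- `E` is an eigenvalue of the discrete Schrödinger equation with eigenfunction `Ψ ∈ 𝒱^d_N`:
`⟨Φ, H Ψ⟩ = E ⟨Φ, Ψ⟩` for all `Φ ∈ 𝒱^d_N`. -/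
def SolvesSchroedinger (Z : Fin K → ℕ) (R : Fin K → Space) (φ : Fin d → OneL2 𝕜) (N : ℕ)
    (E : ℝ) (Ψ : fciSpace φ N) : Prop :=
  Ψ ≠ 0 ∧ ∀ Φ : fciSpace φ N,
    energyForm Z R (Φ : L2 𝕜 N) (Ψ : L2 𝕜 N) = (E : 𝕜) * ⟪Φ, Ψ⟫_𝕜

/-- `Ψ ∈ 𝒱^d_N` is a normalised solution of the discrete (Full CI) Schrödinger equation for its
lowest eigenvalue. -/
def IsFCIGroundState (Z : Fin K → ℕ) (R : Fin K → Space) (φ : Fin d → OneL2 𝕜) (N : ℕ)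
    (Ψ : fciSpace φ N) : Prop :=
  ⟪Ψ, Ψ⟫_𝕜 = 1 ∧ ∃ E : ℝ, IsLeast {E' : ℝ | ∃ Φ, SolvesSchroedinger Z R φ N E' Φ} E ∧
    SolvesSchroedinger Z R φ N E Ψ

/-- `U` minimises `⟨𝐇 V, V⟩` over all `V ∈ ℋ^d` with `⟨V, V⟩ = 1` and `𝐏 V = N V`. -/
def IsBinaryGroundState (H P : Binary 𝕜 d →ₗ[𝕜] Binary 𝕜 d) (N : ℕ) (U : Binary 𝕜 d) : Prop :=
  (⟪U, U⟫_𝕜 = 1 ∧ P U = (N : 𝕜) • U) ∧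
    ∀ V : Binary 𝕜 d, ⟪V, V⟫_𝕜 = 1 → P V = (N : 𝕜) • V →
      RCLike.re ⟪H U, U⟫_𝕜 ≤ RCLike.re ⟪H V, V⟫_𝕜

end GroundStates

end FullCI

end

/-!
The convergence of all integrals rests on a Hardy type inequality,
`∫ |u|² / |x - R| ≤ ∑ i, (‖u‖² + ‖∂_i u‖²)`, for `u` with weak derivatives in `L²(ℝ³)`. For a
smooth function it follows by integration by parts against the bounded field
`(x - R) / √(|x - R|² + δ²)`, whose divergence is at least `1 / √(|x - R|² + δ²)`; mollification and
Fatou's lemma give the general case (`lintegral_sq_mul_inv_norm_sub_le`). The bound is uniform in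
`R`, so it also controls the interaction of two electrons, by Tonelli's theorem in the position of
the second one (`integrable_pairIntegrand`).

A Slater determinant is a sum of products of orbitals. On such a sum `∑ μ, c μ • φ_{μ 1} ⊗ ⋯ ⊗ φ_{μ M}`
the energy form is explicit by Fubini's theorem and orthonormality (`energyForm_orbitalSum`): a
one-electron term leaves all coordinates of `μ` but one unchanged, a two-electron term all but two.
The coefficients of a determinant are themselves determinants of Kronecker deltas. Their Laplace
expansion along a column says that fixing one coordinate of `μ` to be `a` amounts, up to a sign that
cancels in the end, to applying the annihilation operator `𝐚_a` to the occupation number vector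
(`coeffMap_insertNth`); the signs of the expansion are those produced by the matrices `S`. Summing
over the coordinates turns the energy into `⟪V, 𝐇 W⟫`, the Slater–Condon rules
(`sum_productEnergy`).

The Slater determinants are thus an orthonormal basis of the Fock space, indexed by the increasing
tuples of orbitals. Occupation numbers identify these tuples with binary strings, which gives the
isometry `ι` (`fockIso`). Since `𝐇` preserves the particle number it is the direct sum of its diagonal
blocks, and these are the Galerkin projections of the Hamiltonian. The statements on ground states
are the Rayleigh principle for a symmetric operator on a finite-dimensional space, carried over to
the binary Fock space by `ι`.
-/

noncomputable section

namespace FullCI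

/-! ### Hardy's inequality on `ℝ³` -/

section Hardy

variable {𝕜 : Type*} [RCLike 𝕜]

open scoped Convolution

open ContinuousLinearMap in
/-- Mollification does not increase the `L²` norm: the mollifier is a probability density, so the
Cauchy–Schwarz inequality bounds the square of the average by the average of the squares. -/
theorem lintegral_mollify_sq_le {u : Space → 𝕜} (hu : Measurable u)
    (ψ : ContDiffBump (0 : Space)) :
    ∫⁻ x, ‖(ψ.normed volume ⋆[lsmul ℝ ℝ, volume] u) x‖ₑ ^ 2 ≤ ∫⁻ x, ‖u x‖ₑ ^ 2 := by
  set w : Space → ℝ≥0∞ := fun t => ENNReal.ofReal (ψ.normed volume t) with hw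
  have hwm : Measurable w := (ψ.continuous_normed.measurable).ennreal_ofReal
  set ν : Measure Space := volume.withDensity w with hν
  have hνp : IsProbabilityMeasure ν := by
    constructor
    rw [hν, withDensity_apply _ MeasurableSet.univ, Measure.restrict_univ, hw,
      ← ofReal_integral_eq_lintegral_ofReal ψ.integrable_normed
        (Filter.Eventually.of_forall fun x => ψ.nonneg_normed x), ψ.integral_normed]
    simp
  have key : ∀ x, ‖(ψ.normed volume ⋆[lsmul ℝ ℝ, volume] u) x‖ₑ ^ 2 ≤
      ∫⁻ t, ‖u (x - t)‖ₑ ^ 2 ∂ν := by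
    intro x
    have h1 : ‖(ψ.normed volume ⋆[lsmul ℝ ℝ, volume] u) x‖ₑ ≤ ∫⁻ t, ‖u (x - t)‖ₑ ∂ν := by
      rw [hν, lintegral_withDensity_eq_lintegral_mul _ hwm (by fun_prop)]
      refine (enorm_integral_le_lintegral_enorm _).trans (lintegral_mono fun t => ?_)
      simp only [lsmul_apply, enorm_smul, Pi.mul_apply, hw,
        Real.enorm_of_nonneg (ψ.nonneg_normed t), le_refl]
    have h2 := ENNReal.lintegral_mul_le_Lp_mul_Lq ν (Real.HolderConjugate.two_two)
      (f := fun t => ‖u (x - t)‖ₑ) (g := 1) (by fun_prop) (by fun_prop)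
    simp only [Pi.mul_apply, Pi.one_apply, mul_one, ENNReal.one_rpow, lintegral_const,
      measure_univ] at h2
    calc _ ≤ (∫⁻ t, ‖u (x - t)‖ₑ ∂ν) ^ 2 := by gcongr
      _ ≤ ((∫⁻ t, ‖u (x - t)‖ₑ ^ (2 : ℝ) ∂ν) ^ (1 / 2 : ℝ)) ^ 2 := by gcongr
      _ = _ := by
        rw [← ENNReal.rpow_natCast, ← ENNReal.rpow_mul]
        norm_num
  calc _ ≤ ∫⁻ x, ∫⁻ t, ‖u (x - t)‖ₑ ^ 2 ∂ν := lintegral_mono key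
    _ = ∫⁻ t, (∫⁻ x, ‖u (x - t)‖ₑ ^ 2) ∂ν := by
      refine lintegral_lintegral_swap (Measurable.aemeasurable ?_)
      exact (hu.comp (measurable_fst.sub measurable_snd)).enorm.pow_const 2
    _ = ∫⁻ _, (∫⁻ x, ‖u x‖ₑ ^ 2) ∂ν := by
      refine lintegral_congr fun t => ?_
      exact lintegral_sub_right_eq_self (fun x => ‖u x‖ₑ ^ 2) t
    _ = _ := by simp

/-- A mollification of `u` is differentiable, and its derivative is the mollification of the
weak derivative of `u`. -/
theorem fderiv_mollify {u g : Space → 𝕜} (hu : LocallyIntegrable u volume) {v : Space}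
    (h : HasWeakLineDeriv u g v) (ψ : ContDiffBump (0 : Space)) (x : Space) :
    fderiv ℝ (ψ.normed volume ⋆[ContinuousLinearMap.lsmul ℝ ℝ, volume] u) x v =
      (ψ.normed volume ⋆[ContinuousLinearMap.lsmul ℝ ℝ, volume] g) x := by
  have hψ : ContDiff ℝ 1 (ψ.normed volume) := ψ.contDiff_normed
  have hd := (ψ.hasCompactSupport_normed (μ := volume)).hasFDerivAt_convolution_left
    (ContinuousLinearMap.lsmul ℝ ℝ : ℝ →L[ℝ] 𝕜 →L[ℝ] 𝕜) hψ hu x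
  rw [hd.fderiv]
  have hex : ConvolutionExistsAt (fderiv ℝ (ψ.normed volume)) u x
      ((ContinuousLinearMap.lsmul ℝ ℝ : ℝ →L[ℝ] 𝕜 →L[ℝ] 𝕜).precompL Space) volume :=
    (HasCompactSupport.convolutionExists_left _ (ψ.hasCompactSupport_normed.fderiv ℝ)
      (hψ.continuous_fderiv one_ne_zero) hu) x
  have h1 : ((fderiv ℝ (ψ.normed volume) ⋆[(ContinuousLinearMap.lsmul ℝ ℝ :
      ℝ →L[ℝ] 𝕜 →L[ℝ] 𝕜).precompL Space, volume] u) x) v =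
      ∫ t, (fderiv ℝ (ψ.normed volume) (x - t) v) • u t := by
    rw [convolution_eq_swap, ContinuousLinearMap.integral_apply hex.integrable_swap]
    rfl
  rw [h1, convolution_eq_swap]
  -- the weak derivative is tested with `t ↦ ψ (x - t)`
  set η : Space → ℝ := fun t => ψ.normed volume (x - t) with hη
  have hη1 : ContDiff ℝ ∞ η := ψ.contDiff_normed.comp (contDiff_const.sub contDiff_id)
  have hη2 : HasCompactSupport η :=
    ψ.hasCompactSupport_normed.comp_homeomorph (Homeomorph.subLeft x)
  have hη3 : ∀ t, fderiv ℝ η t v = -fderiv ℝ (ψ.normed volume) (x - t) v := by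
    intro t
    have a : HasFDerivAt (fun t : Space => x - t) (-ContinuousLinearMap.id ℝ Space) t := by
      exact (hasFDerivAt_id t).const_sub x
    have b := ((hψ.differentiable one_ne_zero).differentiableAt (x := x - t)).hasFDerivAt.comp t a
    have c := b.fderiv
    rw [show η = ψ.normed volume ∘ fun t => x - t from rfl, c]
    simp
  have := h η hη1 hη2
  simp only [hη3] at this
  simp only [ContinuousLinearMap.lsmul_apply, RCLike.real_smul_eq_coe_mul]
  simp only [RCLike.ofReal_neg, neg_mul, integral_neg, neg_inj] at this
  exact this

/-- The smoothed Coulomb potential `1 / √(|x - R|² + δ²)`. -/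
def softCoulomb (R : Space) (δ : ℝ) (x : Space) : ℝ := (√(‖x - R‖ ^ 2 + δ ^ 2))⁻¹

theorem softCoulomb_pos (R : Space) {δ : ℝ} (hδ : 0 < δ) (x : Space) : 0 < softCoulomb R δ x := by
  unfold softCoulomb; positivity

theorem softCoulomb_le (R : Space) {δ : ℝ} (hδ : 0 < δ) (x : Space) :
    softCoulomb R δ x ≤ δ⁻¹ := by
  unfold softCoulomb
  refine inv_anti₀ hδ (Real.le_sqrt_of_sq_le ?_)
  nlinarith [sq_nonneg ‖x - R‖]

theorem norm_sq_mul_softCoulomb_sq_le (R : Space) {δ : ℝ} (hδ : 0 < δ) (x : Space) :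
    ‖x - R‖ ^ 2 * softCoulomb R δ x ^ 2 ≤ 1 := by
  unfold softCoulomb
  rw [inv_pow, Real.sq_sqrt (by positivity), ← div_eq_mul_inv, div_le_one (by positivity)]
  nlinarith [sq_nonneg δ]

theorem continuous_softCoulomb (R : Space) {δ : ℝ} (hδ : 0 < δ) :
    Continuous (softCoulomb R δ) := by
  unfold softCoulomb
  refine Continuous.inv₀ (by fun_prop) fun x => ?_
  positivity

theorem hasFDerivAt_softCoulomb (R : Space) {δ : ℝ} (hδ : 0 < δ) (x : Space) :
    HasFDerivAt (softCoulomb R δ) (-(softCoulomb R δ x ^ 3) • innerSL ℝ (x - R)) x := by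
  have h1 : HasFDerivAt (fun x : Space => ‖x - R‖ ^ 2 + δ ^ 2) (2 • innerSL ℝ (x - R)) x := by
    have := ((hasFDerivAt_id x).sub_const R).norm_sq.add_const (δ ^ 2)
    simpa using this
  have hp : 0 < ‖x - R‖ ^ 2 + δ ^ 2 := by positivity
  have h2 := (h1.sqrt hp.ne')
  have h3 := (hasDerivAt_inv (Real.sqrt_pos.2 hp).ne').comp_hasFDerivAt x h2
  refine h3.congr_fderiv ?_
  ext v
  simp only [softCoulomb, _root_.smul_apply, smul_eq_mul, nsmul_eq_mul]
  have := (Real.sqrt_pos.2 hp).ne'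
  field_simp
  simp

theorem abs_coord_mul_softCoulomb_le (R : Space) {δ : ℝ} (hδ : 0 < δ) (x : Space) (i : Fin 3) :
    |(x - R) i * softCoulomb R δ x| ≤ 1 := by
  rw [abs_le_one_iff_mul_self_le_one]
  have h1 := norm_sq_mul_softCoulomb_sq_le R hδ x
  have h2 : (x - R) i ^ 2 ≤ ‖x - R‖ ^ 2 := by
    rw [EuclideanSpace.norm_sq_eq]
    have := Finset.single_le_sum (f := fun i => ‖(x - R) i‖ ^ 2)
      (fun j _ => by positivity) (Finset.mem_univ i)
    simpa using this
  nlinarith [mul_le_mul_of_nonneg_right h2 (sq_nonneg (softCoulomb R δ x))]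

/-- Integration by parts against the field `(x - R) / √(|x - R|² + δ²)`, whose divergence
dominates the smoothed Coulomb potential and whose coordinates are at most `1`. -/
theorem lintegral_sq_mul_softCoulomb_le {w : Space → 𝕜} (hw : ContDiff ℝ 1 w) (hw2 : MemLp w 2)
    (hd : ∀ i, MemLp (fun x => fderiv ℝ w x (coordVec i)) 2) (R : Space) {δ : ℝ} (hδ : 0 < δ) :
    ∫⁻ x, ‖w x‖ₑ ^ 2 * ENNReal.ofReal (softCoulomb R δ x) ≤
      ∑ i : Fin 3, ((∫⁻ x, ‖w x‖ₑ ^ 2) + ∫⁻ x, ‖fderiv ℝ w x (coordVec i)‖ₑ ^ 2) := by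
  set G := softCoulomb R δ with hG
  have hGc : Continuous G := continuous_softCoulomb R hδ
  have hwd : Differentiable ℝ w := hw.differentiable one_ne_zero
  have hwc : Continuous w := hw.continuous
  have hdc : ∀ i, Continuous fun x => fderiv ℝ w x (coordVec i) := fun i =>
    (hw.continuous_fderiv one_ne_zero).clm_apply continuous_const
  have iN : Integrable (fun x => ‖w x‖ ^ 2) :=
    (memLp_two_iff_integrable_sq_norm hw2.1).1 hw2
  have iD : ∀ i, Integrable (fun x => ‖fderiv ℝ w x (coordVec i)‖ ^ 2) := fun i =>
    (memLp_two_iff_integrable_sq_norm (hd i).1).1 (hd i)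
  have hNd : ∀ x v, fderiv ℝ (fun x => ‖w x‖ ^ 2) x v = 2 * ⟪w x, fderiv ℝ w x v⟫_ℝ := by
    intro x v
    rw [(hwd x).hasFDerivAt.norm_sq.fderiv]
    simp
  -- the coordinates of the field
  set F : Fin 3 → Space → ℝ := fun i x => (x - R) i * G x with hF
  have hFd : ∀ i x, HasFDerivAt (F i) ((x - R) i • (-(G x ^ 3) • innerSL ℝ (x - R)) +
      G x • (EuclideanSpace.proj i : Space →L[ℝ] ℝ)) x := by
    intro i x
    have h1 : HasFDerivAt (fun x : Space => (x - R) i) (EuclideanSpace.proj i : Space →L[ℝ] ℝ) x :=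
      (EuclideanSpace.proj i : Space →L[ℝ] ℝ).hasFDerivAt.comp x ((hasFDerivAt_id x).sub_const R)
    exact h1.mul (hasFDerivAt_softCoulomb R hδ x)
  have hFe : ∀ i x, fderiv ℝ (F i) x (coordVec i) = G x - (x - R) i ^ 2 * G x ^ 3 := by
    intro i x
    rw [(hFd i x).fderiv]
    simp [coordVec, EuclideanSpace.inner_single_right]
    ring
  have hF1 : ∀ i x, |F i x| ≤ 1 := fun i x => abs_coord_mul_softCoulomb_le R hδ x i
  have hFc : ∀ i, Continuous (F i) := fun i => by
    have : Continuous fun x : Space => (x - R) i := by fun_prop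
    exact this.mul hGc
  have hG0 : ∀ x, 0 < G x := softCoulomb_pos R hδ
  have hFe1 : ∀ i x, |G x - (x - R) i ^ 2 * G x ^ 3| ≤ δ⁻¹ := by
    intro i x
    have h1 := hF1 i x
    rw [abs_le_one_iff_mul_self_le_one] at h1
    have h2 := softCoulomb_le R hδ x
    have h3 := hG0 x
    have h4 : (x - R) i ^ 2 * G x ^ 3 = F i x * F i x * G x := by simp only [hF]; ring
    have h5 : 0 ≤ F i x * F i x := mul_self_nonneg _
    rw [h4, abs_le]
    constructor <;> nlinarith
  have hFec : ∀ i, Continuous fun x => G x - (x - R) i ^ 2 * G x ^ 3 := fun i => by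
    have : Continuous fun x : Space => (x - R) i := by fun_prop
    exact hGc.sub ((this.pow 2).mul (hGc.pow 3))
  have hbound : ∀ i x, |2 * ⟪w x, fderiv ℝ w x (coordVec i)⟫_ℝ| ≤
      ‖w x‖ ^ 2 + ‖fderiv ℝ w x (coordVec i)‖ ^ 2 := by
    intro i x
    have := abs_real_inner_le_norm (w x) (fderiv ℝ w x (coordVec i))
    rw [abs_mul, abs_two]
    nlinarith [sq_nonneg (‖w x‖ - ‖fderiv ℝ w x (coordVec i)‖)]
  have iNd : ∀ i, Integrable (fun x => 2 * ⟪w x, fderiv ℝ w x (coordVec i)⟫_ℝ) := fun i => by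
    refine (iN.add (iD i)).mono' ?_ (Filter.Eventually.of_forall fun x => hbound i x)
    exact ((hwc.inner (hdc i)).const_mul 2).aestronglyMeasurable
  have i1 : ∀ i, Integrable fun x => F i x * (2 * ⟪w x, fderiv ℝ w x (coordVec i)⟫_ℝ) := fun i =>
    (iNd i).bdd_mul (hFc i).aestronglyMeasurable (Filter.Eventually.of_forall (hF1 i))
  have i2 : ∀ i, Integrable fun x => (G x - (x - R) i ^ 2 * G x ^ 3) * ‖w x‖ ^ 2 := fun i =>
    iN.bdd_mul (hFec i).aestronglyMeasurable (Filter.Eventually.of_forall (hFe1 i))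
  have i3 : ∀ i, Integrable fun x => F i x * ‖w x‖ ^ 2 := fun i =>
    iN.bdd_mul (hFc i).aestronglyMeasurable (Filter.Eventually.of_forall (hF1 i))
  have parts : ∀ i, ∫ x, F i x * (2 * ⟪w x, fderiv ℝ w x (coordVec i)⟫_ℝ) =
      -∫ x, (G x - (x - R) i ^ 2 * G x ^ 3) * ‖w x‖ ^ 2 := by
    intro i
    have := integral_mul_fderiv_eq_neg_fderiv_mul_of_integrable (μ := volume) (f := F i)
      (g := fun x => ‖w x‖ ^ 2) (v := coordVec i) (by simpa only [hFe] using i2 i)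
      (by simpa only [hNd] using i1 i) (i3 i) (fun x _ => (hFd i x).differentiableAt)
      (fun x _ => ((hwd x).norm_sq ℝ))
    simpa only [hFe, hNd] using this
  have iG : Integrable fun x => ‖w x‖ ^ 2 * G x :=
    iN.mul_bdd hGc.aestronglyMeasurable (Filter.Eventually.of_forall fun x => by
      rw [Real.norm_of_nonneg (hG0 x).le]; exact softCoulomb_le R hδ x)
  have main : ∫ x, ‖w x‖ ^ 2 * G x ≤
      ∑ i : Fin 3, ((∫ x, ‖w x‖ ^ 2) + ∫ x, ‖fderiv ℝ w x (coordVec i)‖ ^ 2) := by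
    -- the divergence `3 G - |x - R|² G³` is at least `2 G`, hence at least `G`
    calc _ ≤ ∫ x, ∑ i : Fin 3, (G x - (x - R) i ^ 2 * G x ^ 3) * ‖w x‖ ^ 2 := by
          refine integral_mono iG (integrable_finsetSum _ fun i _ => i2 i) fun x => ?_
          simp only [← Finset.sum_mul, Finset.sum_sub_distrib]
          have h1 := norm_sq_mul_softCoulomb_sq_le R hδ x
          rw [EuclideanSpace.norm_sq_eq] at h1
          simp only [Real.norm_eq_abs, sq_abs] at h1
          rw [mul_comm]
          refine mul_le_mul_of_nonneg_right ?_ (by positivity)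
          simp only [Finset.sum_const, Finset.card_univ, Fintype.card_fin]
          change (∑ i, (x - R) i ^ 2) * G x ^ 2 ≤ 1 at h1
          have h3 := hG0 x
          have := mul_le_mul_of_nonneg_right h1 h3.le
          simp only [nsmul_eq_mul]
          push_cast
          nlinarith
      _ = ∑ i : Fin 3, -∫ x, F i x * (2 * ⟪w x, fderiv ℝ w x (coordVec i)⟫_ℝ) := by
          rw [integral_finsetSum _ fun i _ => i2 i]
          exact Finset.sum_congr rfl fun i _ => by rw [parts, neg_neg]
      _ ≤ _ := by
          refine Finset.sum_le_sum fun i _ => ?_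
          rw [← integral_neg, ← integral_add iN (iD i)]
          refine integral_mono (i1 i).neg (iN.add (iD i)) fun x => ?_
          refine (neg_le_abs _).trans ?_
          rw [abs_mul]
          refine (mul_le_of_le_one_left (abs_nonneg _) (hF1 i x)).trans (hbound i x)
  have e1 : ∀ {f : Space → 𝕜}, Integrable (fun x => ‖f x‖ ^ 2) →
      ENNReal.ofReal (∫ x, ‖f x‖ ^ 2) = ∫⁻ x, ‖f x‖ₑ ^ 2 := by
    intro f hf
    rw [ofReal_integral_eq_lintegral_ofReal hf (Filter.Eventually.of_forall fun x => by positivity)]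
    refine lintegral_congr fun x => ?_
    rw [ENNReal.ofReal_pow (norm_nonneg _), ofReal_norm]
  have := ENNReal.ofReal_le_ofReal main
  rw [ENNReal.ofReal_sum_of_nonneg fun i _ => by positivity] at this
  simp only [ENNReal.ofReal_add (integral_nonneg fun x => sq_nonneg (‖w x‖))
    (integral_nonneg fun x => sq_nonneg (‖fderiv ℝ w x (coordVec _)‖)), e1 iN, e1 (iD _)] at this
  refine le_trans (le_of_eq ?_) this
  rw [ofReal_integral_eq_lintegral_ofReal iG (Filter.Eventually.of_forall fun x => by
    have := hG0 x; positivity)]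
  refine lintegral_congr fun x => ?_
  rw [ENNReal.ofReal_mul (by positivity), ENNReal.ofReal_pow (norm_nonneg _), ofReal_norm]

/-- A form of Hardy's inequality, with `|x - R|⁻¹` in place of `|x - R|⁻²`, for functions with weak
derivatives in `L²`; the bound does not depend on the position `R` of the singularity. -/
theorem lintegral_sq_mul_inv_norm_sub_le {u : Space → 𝕜} {g : Fin 3 → Space → 𝕜}
    (hu : Measurable u) (hg : ∀ i, Measurable (g i)) (hu2 : MemLp u 2) (hg2 : ∀ i, MemLp (g i) 2)
    (h : ∀ i, HasWeakLineDeriv u (g i) (coordVec i)) (R : Space) :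
    ∫⁻ x, ‖u x‖ₑ ^ 2 * ENNReal.ofReal ‖x - R‖⁻¹ ≤
      ∑ i : Fin 3, ((∫⁻ x, ‖u x‖ₑ ^ 2) + ∫⁻ x, ‖g i x‖ₑ ^ 2) := by
  have huL : LocallyIntegrable u := hu2.locallyIntegrable (by norm_num)
  let ψ : ℕ → ContDiffBump (0 : Space) := fun n =>
    ⟨1 / ((n : ℝ) + 1), 2 * (1 / ((n : ℝ) + 1)), by positivity, by
      have : 0 < 1 / ((n : ℝ) + 1) := by positivity
      linarith⟩
  set w : ℕ → Space → 𝕜 := fun n =>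
    (ψ n).normed volume ⋆[ContinuousLinearMap.lsmul ℝ ℝ, volume] u with hw
  set δ : ℕ → ℝ := fun n => 1 / ((n : ℝ) + 1) with hδ
  have hδ0 : ∀ n, 0 < δ n := fun n => by simp only [hδ]; positivity
  have hδt : Filter.Tendsto δ Filter.atTop (nhds 0) := tendsto_one_div_add_atTop_nhds_zero_nat
  have hwt : ∀ᵐ x, Filter.Tendsto (fun n => w n x) Filter.atTop (nhds (u x)) := by
    refine ContDiffBump.ae_convolution_tendsto_right_of_locallyIntegrable (K := 2) ?_
      (Filter.Eventually.of_forall fun n => le_rfl) huL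
    simpa using hδt.const_mul 2
  have memLp_of_le : ∀ {f f' : Space → 𝕜}, Continuous f → MemLp f' 2 →
      ∫⁻ x, ‖f x‖ₑ ^ 2 ≤ ∫⁻ x, ‖f' x‖ₑ ^ 2 → MemLp f 2 := by
    intro f f' hf hf' hle
    refine ⟨hf.aestronglyMeasurable, lt_of_le_of_lt ?_ hf'.2⟩
    rw [eLpNorm_eq_lintegral_rpow_enorm_toReal (by simp) (by simp),
      eLpNorm_eq_lintegral_rpow_enorm_toReal (by simp) (by simp)]
    simp only [ENNReal.toReal_ofNat, ENNReal.rpow_ofNat]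
    gcongr
  have hwc : ∀ n, ContDiff ℝ 1 (w n) := fun n =>
    (ψ n).hasCompactSupport_normed.contDiff_convolution_left _ (ψ n).contDiff_normed huL
  have hwd : ∀ n i x, fderiv ℝ (w n) x (coordVec i) =
      ((ψ n).normed volume ⋆[ContinuousLinearMap.lsmul ℝ ℝ, volume] g i) x := fun n i x =>
    fderiv_mollify huL (h i) (ψ n) x
  have est : ∀ n, ∫⁻ x, ‖w n x‖ₑ ^ 2 * ENNReal.ofReal (softCoulomb R (δ n) x) ≤
      ∑ i : Fin 3, ((∫⁻ x, ‖u x‖ₑ ^ 2) + ∫⁻ x, ‖g i x‖ₑ ^ 2) := by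
    intro n
    have a1 := lintegral_mollify_sq_le hu (ψ n)
    have a2 : ∀ i, ∫⁻ x, ‖fderiv ℝ (w n) x (coordVec i)‖ₑ ^ 2 ≤ ∫⁻ x, ‖g i x‖ₑ ^ 2 := fun i => by
      simp only [hwd]
      exact lintegral_mollify_sq_le (hg i) (ψ n)
    refine (lintegral_sq_mul_softCoulomb_le (hwc n) (memLp_of_le (hwc n).continuous hu2 a1)
      (fun i => memLp_of_le (((hwc n).continuous_fderiv one_ne_zero).clm_apply continuous_const)
        (hg2 i) (a2 i)) R (hδ0 n)).trans ?_
    exact Finset.sum_le_sum fun i _ => add_le_add a1 (a2 i)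
  have hmeas : ∀ n, Measurable fun x => ‖w n x‖ₑ ^ 2 * ENNReal.ofReal (softCoulomb R (δ n) x) :=
    fun n => ((hwc n).continuous.measurable.enorm.pow_const 2).mul
      (continuous_softCoulomb R (hδ0 n)).measurable.ennreal_ofReal
  -- by Fatou's lemma the mollification and the smoothing of the potential are removed together
  calc _ ≤ ∫⁻ x, Filter.liminf (fun n => ‖w n x‖ₑ ^ 2 *
        ENNReal.ofReal (softCoulomb R (δ n) x)) Filter.atTop := by
        refine lintegral_mono_ae ?_
        have hne : ∀ᵐ x : Space, x ≠ R := by simp [ae_iff, measure_singleton]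
        filter_upwards [hwt, hne] with x hx hxR
        have hpos : 0 < ‖x - R‖ := norm_pos_iff.2 (sub_ne_zero.2 hxR)
        refine le_of_eq (Filter.Tendsto.liminf_eq ?_).symm
        refine ENNReal.Tendsto.mul (ENNReal.Tendsto.pow hx.enorm) (Or.inr ENNReal.ofReal_ne_top)
          (ENNReal.tendsto_ofReal ?_) (Or.inr (by simp))
        have : Filter.Tendsto (fun n => (√(‖x - R‖ ^ 2 + δ n ^ 2))⁻¹) Filter.atTop
            (nhds (√(‖x - R‖ ^ 2 + 0 ^ 2))⁻¹) := by
          refine Filter.Tendsto.inv₀ ?_ (by positivity)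
          exact ((hδt.pow 2).const_add _).sqrt
        simpa [softCoulomb] using this
    _ ≤ Filter.liminf (fun n => ∫⁻ x, ‖w n x‖ₑ ^ 2 *
        ENNReal.ofReal (softCoulomb R (δ n) x)) Filter.atTop := lintegral_liminf_le hmeas
    _ ≤ _ := Filter.liminf_le_of_le (by isBoundedDefault) fun b hb => by
        obtain ⟨n, hn⟩ := hb.exists
        exact hn.trans (est n)

end Hardy

/-! ### Slices of one-electron functions and weak derivatives -/

section Slices

theorem measurableEmbedding_site (s : Spin) :
    MeasurableEmbedding fun r : Space => ((r, s) : Site) :=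
  measurable_prodMk_right.measurableEmbedding fun _ _ h => (Prod.ext_iff.1 h).1

theorem measurableEmbedding_mkConfig {N : ℕ} (s : Fin N → Spin) :
    MeasurableEmbedding fun r : Fin N → Space => mkConfig r s := by
  refine Measurable.measurableEmbedding ?_ fun a b h => ?_
  · exact measurable_pi_lambda _ fun ξ => (measurable_pi_apply ξ).prodMk measurable_const
  · funext ξ
    exact (Prod.ext_iff.1 (congrFun h ξ)).1

theorem siteMeasure_eq_sum :
    siteMeasure = ∑ s : Spin, (volume : Measure Space).map fun r => ((r, s) : Site) := by
  ext t ht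
  rw [siteMeasure, Measure.prod_apply_symm ht, lintegral_count, tsum_fintype,
    Measure.finsetSum_apply]
  exact Finset.sum_congr rfl fun s _ => ((measurableEmbedding_site s).map_apply _ _).symm

theorem configMeasure_eq_sum (N : ℕ) :
    configMeasure N = ∑ s : Fin N → Spin,
      (volume : Measure (Fin N → Space)).map fun r => mkConfig r s := by
  refine Measure.pi_eq fun t ht => ?_
  rw [Measure.finsetSum_apply]
  simp only [siteMeasure_eq_sum, Measure.finsetSum_apply, Finset.prod_univ_sum,
    Fintype.piFinset_univ]
  refine Finset.sum_congr rfl fun s _ => ?_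
  simp only [(measurableEmbedding_mkConfig s).map_apply, (measurableEmbedding_site _).map_apply]
  rw [← volume_pi_pi]
  congr 1

variable {𝕜 : Type*} [RCLike 𝕜]

theorem lintegral_site {F : Site → ℝ≥0∞} :
    ∫⁻ x, F x ∂siteMeasure = ∑ s : Spin, ∫⁻ r, F (r, s) := by
  rw [siteMeasure_eq_sum, lintegral_finsetSum_measure]
  exact Finset.sum_congr rfl fun s _ => (measurableEmbedding_site s).lintegral_map _

theorem integrable_site_iff {F : Site → 𝕜} :
    Integrable F siteMeasure ↔ ∀ s : Spin, Integrable fun r : Space => F (r, s) := by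
  rw [siteMeasure_eq_sum, integrable_finsetSum_measure]
  simp only [Finset.mem_univ, true_implies, (measurableEmbedding_site _).integrable_map_iff,
    Function.comp_def]

theorem integral_site {F : Site → 𝕜} (hF : Integrable F siteMeasure) :
    ∫ x, F x ∂siteMeasure = ∑ s : Spin, ∫ r, F (r, s) := by
  rw [siteMeasure_eq_sum, integrable_finsetSum_measure] at hF
  rw [siteMeasure_eq_sum, integral_finsetSum_measure hF]
  exact Finset.sum_congr rfl fun s _ => (measurableEmbedding_site s).integral_map _

theorem ae_config_iff {N : ℕ} {p : Config N → Prop} :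
    (∀ᵐ x ∂configMeasure N, p x) ↔
      ∀ s : Fin N → Spin, ∀ᵐ r : Fin N → Space, p (mkConfig r s) := by
  rw [configMeasure_eq_sum, ae_finsetSum_measure_iff]
  simp [(measurableEmbedding_mkConfig _).ae_map_iff]

theorem memLp_two_slice_site (f : OneL2 𝕜) (s : Spin) :
    MemLp (fun r : Space => f (r, s)) 2 := by
  have h := Lp.memLp f
  have hle : (volume : Measure Space).map (fun r => ((r, s) : Site)) ≤ siteMeasure := by
    rw [siteMeasure_eq_sum]
    exact Finset.single_le_sum (f := fun s => (volume : Measure Space).map fun r => ((r, s) : Site))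
      (fun _ _ => Measure.zero_le _) (Finset.mem_univ s)
  exact (measurableEmbedding_site s).memLp_map_measure_iff.1 (h.mono_measure hle)

theorem memLp_two_slice_config {N : ℕ} (f : L2 𝕜 N) (s : Fin N → Spin) :
    MemLp (fun r : Fin N → Space => f (mkConfig r s)) 2 := by
  have h := Lp.memLp f
  have hle : (volume : Measure (Fin N → Space)).map (fun r => mkConfig r s) ≤ configMeasure N := by
    rw [configMeasure_eq_sum]
    exact Finset.single_le_sum
      (f := fun s => (volume : Measure (Fin N → Space)).map fun r => mkConfig r s)
      (fun _ _ => Measure.zero_le _) (Finset.mem_univ s)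
  exact (measurableEmbedding_mkConfig s).memLp_map_measure_iff.1 (h.mono_measure hle)

theorem measurable_slice_site (f : OneL2 𝕜) (s : Spin) : Measurable fun r : Space => f (r, s) :=
  (Lp.stronglyMeasurable f).measurable.comp (measurableEmbedding_site s).measurable

end Slices

section WeakDeriv

variable {𝕜 : Type*} [RCLike 𝕜]

theorem integrable_ofReal_mul {E : Type*} [NormedAddCommGroup E] [MeasureSpace E] [BorelSpace E]
    {f : E → 𝕜} (hf : LocallyIntegrable f volume) {η : E → ℝ}
    (h1 : Continuous η) (h2 : HasCompactSupport η) :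
    Integrable (fun x => ((η x : ℝ) : 𝕜) * f x) volume := by
  simpa only [RCLike.real_smul_eq_coe_mul] using
    hf.integrable_smul_left_of_hasCompactSupport h1 h2

theorem continuous_fderiv_apply {E : Type*} [NormedAddCommGroup E] [NormedSpace ℝ E]
    {η : E → ℝ} (h1 : ContDiff ℝ ∞ η) (v : E) :
    Continuous fun x => fderiv ℝ η x v :=
  (h1.continuous_fderiv (by simp)).clm_apply continuous_const

theorem HasWeakLineDeriv.const_mul {E : Type*} [NormedAddCommGroup E] [NormedSpace ℝ E]
    [MeasureSpace E] {f g : E → 𝕜} {v : E} (h : HasWeakLineDeriv f g v) (c : 𝕜) :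
    HasWeakLineDeriv (fun x => c * f x) (fun x => c * g x) v := by
  intro η h1 h2
  simp only [mul_left_comm _ c, integral_const_mul, h η h1 h2, mul_neg]

theorem HasWeakLineDeriv.congr_ae {E : Type*} [NormedAddCommGroup E] [NormedSpace ℝ E]
    [MeasureSpace E] {f f' g g' : E → 𝕜} {v : E} (h : HasWeakLineDeriv f g v)
    (hf : f =ᵐ[volume] f') (hg : g =ᵐ[volume] g') : HasWeakLineDeriv f' g' v := by
  intro η h1 h2
  have e1 : ∫ r, ((fderiv ℝ η r v : ℝ) : 𝕜) * f' r = ∫ r, ((fderiv ℝ η r v : ℝ) : 𝕜) * f r :=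
    integral_congr_ae (hf.mono fun x hx => by simp only [hx])
  have e2 : ∫ r, ((η r : ℝ) : 𝕜) * g' r = ∫ r, ((η r : ℝ) : 𝕜) * g r :=
    integral_congr_ae (hg.mono fun x hx => by simp only [hx])
  rw [e1, e2, h η h1 h2]

section General

variable {E : Type*} [NormedAddCommGroup E] [NormedSpace ℝ E] [MeasureSpace E] [BorelSpace E]

theorem HasWeakLineDeriv.add {f f' g g' : E → 𝕜} {v : E} (h : HasWeakLineDeriv f g v)
    (h' : HasWeakLineDeriv f' g' v) (hf : LocallyIntegrable f volume)
    (hf' : LocallyIntegrable f' volume) (hg : LocallyIntegrable g volume)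
    (hg' : LocallyIntegrable g' volume) :
    HasWeakLineDeriv (fun x => f x + f' x) (fun x => g x + g' x) v := by
  intro η h1 h2
  have c := continuous_fderiv_apply h1 v
  have k := h2.fderiv_apply (𝕜 := ℝ) v
  simp only [mul_add]
  rw [integral_add (integrable_ofReal_mul hf c k) (integrable_ofReal_mul hf' c k),
    integral_add (integrable_ofReal_mul hg h1.continuous h2)
      (integrable_ofReal_mul hg' h1.continuous h2), h η h1 h2, h' η h1 h2, neg_add]

theorem HasWeakLineDeriv.unique [FiniteDimensional ℝ E] {f g g' : E → 𝕜} {v : E}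
    (h : HasWeakLineDeriv f g v) (h' : HasWeakLineDeriv f g' v)
    (hg : LocallyIntegrable g volume) (hg' : LocallyIntegrable g' volume) :
    g =ᵐ[volume] g' := by
  refine ae_eq_of_integral_contDiff_smul_eq hg hg' fun η h1 h2 => ?_
  simp only [RCLike.real_smul_eq_coe_mul]
  have := (h η h1 h2).symm.trans (h' η h1 h2)
  exact neg_injective this

end General

theorem locallyIntegrable_slice {N : ℕ} (f : L2 𝕜 N) (s : Fin N → Spin) :
    LocallyIntegrable fun r : Fin N → Space => f (mkConfig r s) :=
  (memLp_two_slice_config f s).locallyIntegrable (by norm_num)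

variable {N : ℕ} {ξ : Fin N} {i : Fin 3}

theorem HasWeakDeriv.add {f f' g g' : L2 𝕜 N} (h : HasWeakDeriv ξ i f g)
    (h' : HasWeakDeriv ξ i f' g') : HasWeakDeriv ξ i (f + f') (g + g') := by
  intro s
  refine ((h s).add (h' s) (locallyIntegrable_slice f s) (locallyIntegrable_slice f' s)
    (locallyIntegrable_slice g s) (locallyIntegrable_slice g' s)).congr_ae ?_ ?_
  · exact (ae_config_iff.1 (Lp.coeFn_add f f') s).mono fun r hr => hr.symm
  · exact (ae_config_iff.1 (Lp.coeFn_add g g') s).mono fun r hr => hr.symm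

theorem HasWeakDeriv.smul {f g : L2 𝕜 N} (h : HasWeakDeriv ξ i f g) (c : 𝕜) :
    HasWeakDeriv ξ i (c • f) (c • g) := by
  intro s
  refine ((h s).const_mul c).congr_ae ?_ ?_
  · exact (ae_config_iff.1 (Lp.coeFn_smul c f) s).mono fun r hr => hr.symm
  · exact (ae_config_iff.1 (Lp.coeFn_smul c g) s).mono fun r hr => hr.symm

theorem HasWeakDeriv.zero : HasWeakDeriv ξ i (0 : L2 𝕜 N) 0 := by
  intro s η _ _
  have h0 := ae_config_iff.1 (Lp.coeFn_zero 𝕜 2 (configMeasure N)) s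
  rw [integral_eq_zero_of_ae (h0.mono fun _ hr => mul_eq_zero_of_right _ hr),
    integral_eq_zero_of_ae (h0.mono fun _ hr => mul_eq_zero_of_right _ hr), neg_zero]

theorem HasWeakDeriv.sum {ι : Type*} {t : Finset ι} {f g : ι → L2 𝕜 N} {c : ι → 𝕜}
    (h : ∀ k ∈ t, HasWeakDeriv ξ i (f k) (g k)) :
    HasWeakDeriv ξ i (∑ k ∈ t, c k • f k) (∑ k ∈ t, c k • g k) := by
  classical
  induction t using Finset.induction_on with
  | empty => simpa using HasWeakDeriv.zero
  | insert a t ha ih =>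
    rw [Finset.sum_insert ha, Finset.sum_insert ha]
    exact ((h a (Finset.mem_insert_self _ _)).smul _).add
      (ih fun k hk => h k (Finset.mem_insert_of_mem hk))

theorem HasWeakDeriv.unique {f g g' : L2 𝕜 N} (h : HasWeakDeriv ξ i f g)
    (h' : HasWeakDeriv ξ i f g') : g = g' :=
  Lp.ext (ae_config_iff.2 fun s => (h s).unique (h' s) (locallyIntegrable_slice g s)
    (locallyIntegrable_slice g' s))

theorem HasWeakDeriv.weakDeriv_eq {f g : L2 𝕜 N} (h : HasWeakDeriv ξ i f g) :
    weakDeriv ξ i f = g := by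
  have h' : ∃ g, HasWeakDeriv ξ i f g := ⟨g, h⟩
  rw [weakDeriv, dif_pos h']
  exact h'.choose_spec.unique h

theorem OneMemH1.hasWeakDeriv {f : OneL2 𝕜} (h : OneMemH1 f) (i : Fin 3) :
    OneHasWeakDeriv i f (oneWeakDeriv i f) := by
  rw [oneWeakDeriv, dif_pos (h i)]
  exact (h i).choose_spec

end WeakDeriv

/-! ### Products of orbitals -/

section Products

variable {𝕜 : Type*} [RCLike 𝕜]

theorem memLp_two_prod_space {N : ℕ} {u : Fin N → Space → 𝕜} (hu : ∀ ζ, MemLp (u ζ) 2) :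
    MemLp (fun r : Fin N → Space => ∏ ζ, u ζ (r ζ)) 2 := by
  have hm : AEStronglyMeasurable (fun r : Fin N → Space => ∏ ζ, u ζ (r ζ)) volume :=
    Finset.aestronglyMeasurable_fun_prod _ fun ζ _ => (hu ζ).1.comp_quasiMeasurePreserving
      (Measure.quasiMeasurePreserving_eval (fun _ : Fin N => (volume : Measure Space)) ζ)
  rw [memLp_two_iff_integrable_sq_norm hm]
  have := Integrable.fintype_prod (μ := fun _ : Fin N => (volume : Measure Space))
    (f := fun ζ y => ‖u ζ y‖ ^ 2) fun ζ => (memLp_two_iff_integrable_sq_norm (hu ζ).1).1 (hu ζ)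
  simpa [norm_prod, Finset.prod_pow, volume_pi] using this

/-- A weak derivative of one factor gives the weak derivative of a product of functions of
separate variables, by Fubini's theorem. -/
theorem HasWeakLineDeriv.prod {N : ℕ} {u : Fin N → Space → 𝕜} {g : Space → 𝕜} {v : Space}
    (ξ : Fin N) (hu : ∀ ζ, MemLp (u ζ) 2) (hg : MemLp g 2) (h : HasWeakLineDeriv (u ξ) g v) :
    HasWeakLineDeriv (fun r : Fin N → Space => ∏ ζ, u ζ (r ζ))
      (fun r => ∏ ζ, Function.update u ξ g ζ (r ζ)) (Pi.single ξ v) := by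
  obtain _ | n := N
  · exact ξ.elim0
  have hu' : ∀ ζ, MemLp (Function.update u ξ g ζ) 2 := fun ζ => by
    obtain rfl | hζ := eq_or_ne ζ ξ
    · simpa using hg
    · simpa [hζ] using hu ζ
  intro η h1 h2
  have L1 := (memLp_two_prod_space hu).locallyIntegrable (by norm_num)
  have L2 := (memLp_two_prod_space hu').locallyIntegrable (by norm_num)
  have I1 := integrable_ofReal_mul L1 (continuous_fderiv_apply h1 (Pi.single ξ v))
    (h2.fderiv_apply (𝕜 := ℝ) (Pi.single ξ v))
  have I2 := integrable_ofReal_mul L2 h1.continuous h2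
  have mp := (volume_preserving_piFinSuccAbove (fun _ : Fin (n + 1) => Space) ξ).symm
  have e := (MeasurableEquiv.piFinSuccAbove (fun _ : Fin (n + 1) => Space) ξ).symm.measurableEmbedding
  rw [← mp.integral_comp', ← mp.integral_comp']
  have I1' := (mp.integrable_comp_emb e).2 I1
  have I2' := (mp.integrable_comp_emb e).2 I2
  rw [Measure.volume_eq_prod] at I1' I2' ⊢
  simp only [Function.comp_def] at I1' I2' ⊢
  rw [integral_prod_symm _ I1', integral_prod_symm _ I2', ← integral_neg]
  refine integral_congr_ae (Filter.Eventually.of_forall fun y => ?_)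
  -- the section of the test function through `y` is the test function for the factor `u ξ`
  set r0 : Fin (n + 1) → Space := ξ.insertNth 0 y with hr0
  set j : Space → Fin (n + 1) → Space := fun x =>
    r0 + ContinuousLinearMap.single ℝ (fun _ : Fin (n + 1) => Space) ξ x with hj
  have hjeq : ∀ x, (MeasurableEquiv.piFinSuccAbove (fun _ : Fin (n + 1) => Space) ξ).symm (x, y) =
      j x := by
    intro x
    funext ζ
    refine Fin.succAboveCases ξ ?_ (fun k => ?_) ζ
    · simp [hj, hr0, MeasurableEquiv.piFinSuccAbove, Fin.insertNthEquiv]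
    · simp [hj, hr0, MeasurableEquiv.piFinSuccAbove, Fin.insertNthEquiv]
  have hj1 : ∀ x, j x ξ = x := fun x => by simp [hj, hr0]
  have hj2 : ∀ x k, j x (ξ.succAbove k) = y k := fun x k => by simp [hj, hr0]
  have hjd : ContDiff ℝ ∞ j := contDiff_const.add (ContinuousLinearMap.contDiff _)
  have hjf : ∀ x, HasFDerivAt j
      (ContinuousLinearMap.single ℝ (fun _ : Fin (n + 1) => Space) ξ) x := fun x =>
    (ContinuousLinearMap.hasFDerivAt _).const_add r0
  have hjc : Topology.IsClosedEmbedding j :=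
    Function.LeftInverse.isClosedEmbedding (f := fun r : Fin (n + 1) → Space => r ξ) hj1
      (continuous_apply ξ) hjd.continuous
  have hd : ∀ x, fderiv ℝ (η ∘ j) x v = fderiv ℝ η (j x) (Pi.single ξ v) := by
    intro x
    rw [(((h1.differentiable (by simp)) (j x)).hasFDerivAt.comp x (hjf x)).fderiv]
    simp
  have key := h (η ∘ j) (h1.comp hjd) (h2.comp_isClosedEmbedding hjc)
  simp only [hjeq, Fin.prod_univ_succAbove _ ξ, hj1, hj2, Function.update_self,
    Function.update_of_ne (Fin.succAbove_ne ξ _), ← mul_assoc]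
  rw [integral_mul_const, integral_mul_const, ← neg_mul]
  simp only [hd] at key
  rw [key]
  rfl

/-- The product `f_1 ⊗ ⋯ ⊗ f_M` of one-electron functions, as an element of `L₂`. -/
def prodL2 {M : ℕ} (f : Fin M → OneL2 𝕜) : L2 𝕜 M := (memLp_prod f).toLp _

theorem coeFn_prodL2 {M : ℕ} (f : Fin M → OneL2 𝕜) :
    prodL2 f =ᵐ[configMeasure M] fun x => ∏ ζ, f ζ (x ζ) := MemLp.coeFn_toLp _

theorem inner_prodL2 {M : ℕ} (f g : Fin M → OneL2 𝕜) :
    ⟪prodL2 f, prodL2 g⟫_𝕜 = ∏ ζ, ⟪f ζ, g ζ⟫_𝕜 := by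
  simp only [L2.inner_def]
  rw [← integral_fintype_prod_eq_prod]
  refine integral_congr_ae ?_
  filter_upwards [coeFn_prodL2 f, coeFn_prodL2 g] with x hf hg
  simp [hf, hg, RCLike.inner_apply, Finset.prod_mul_distrib]

theorem hasWeakDeriv_prodL2 {M : ℕ} {f : Fin M → OneL2 𝕜} {ξ : Fin M} {i : Fin 3} {g : OneL2 𝕜}
    (h : OneHasWeakDeriv i (f ξ) g) :
    HasWeakDeriv ξ i (prodL2 f) (prodL2 (Function.update f ξ g)) := by
  intro s
  have key := HasWeakLineDeriv.prod (u := fun ζ r => f ζ (r, s ζ)) (g := fun r => g (r, s ξ))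
    (v := coordVec i) ξ (fun ζ => memLp_two_slice_site (f ζ) (s ζ))
    (memLp_two_slice_site g (s ξ)) (h (s ξ))
  refine key.congr_ae ?_ ?_
  · exact (ae_config_iff.1 (coeFn_prodL2 f) s).mono fun r hr => hr.symm
  · refine (ae_config_iff.1 (coeFn_prodL2 (Function.update f ξ g)) s).mono fun r hr => ?_
    refine Eq.trans (Finset.prod_congr rfl fun ζ _ => ?_) hr.symm
    obtain rfl | hζ := eq_or_ne ζ ξ
    · simp [mkConfig]
    · simp [mkConfig, hζ]

end Products

/-! ### One- and two-electron Coulomb integrals -/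

section Coulomb

variable {𝕜 : Type*} [RCLike 𝕜]

/-- The Coulomb potential energy of the product of two one-electron functions of class `H¹` is
bounded uniformly in the position of the charge. -/
theorem OneMemH1.exists_coulomb_bound {f g : OneL2 𝕜} (hf : OneMemH1 f) (hg : OneMemH1 g) :
    ∃ C : ℝ≥0∞, C ≠ ⊤ ∧ ∀ R : Space,
      ∫⁻ x, ‖f x‖ₑ * ‖g x‖ₑ * ENNReal.ofReal ‖x.1 - R‖⁻¹ ∂siteMeasure ≤ C := by
  have one : ∀ {f : OneL2 𝕜}, OneMemH1 f → ∃ C : ℝ≥0∞, C ≠ ⊤ ∧ ∀ R : Space,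
      ∫⁻ x, ‖f x‖ₑ ^ 2 * ENNReal.ofReal ‖x.1 - R‖⁻¹ ∂siteMeasure ≤ C := by
    intro f hf
    have fin : ∀ (u : OneL2 𝕜) (s : Spin), ∫⁻ r, ‖u (r, s)‖ₑ ^ 2 ≠ ⊤ := fun u s => by
      have := (memLp_two_slice_site u s).2
      rw [eLpNorm_lt_top_iff_lintegral_rpow_enorm_lt_top (by simp) (by simp)] at this
      simpa using this.ne
    refine ⟨∑ s : Spin, ∑ i : Fin 3, ((∫⁻ r, ‖f (r, s)‖ₑ ^ 2) +
      ∫⁻ r, ‖oneWeakDeriv i f (r, s)‖ₑ ^ 2), ?_, fun R => ?_⟩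
    · refine ENNReal.sum_ne_top.2 fun s _ => ENNReal.sum_ne_top.2 fun i _ => ?_
      exact ENNReal.add_ne_top.2 ⟨fin f s, fin _ s⟩
    · rw [lintegral_site]
      exact Finset.sum_le_sum fun s _ => lintegral_sq_mul_inv_norm_sub_le
        (measurable_slice_site f s) (fun i => measurable_slice_site _ s)
        (memLp_two_slice_site f s) (fun i => memLp_two_slice_site _ s)
        (fun i => hf.hasWeakDeriv i s) R
  -- the mixed term is reduced to squares by `|f| |g| ≤ |f|² + |g|²`
  obtain ⟨C, hC, h1⟩ := one hf
  obtain ⟨D, hD, h2⟩ := one hg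
  refine ⟨C + D, ENNReal.add_ne_top.2 ⟨hC, hD⟩, fun R => ?_⟩
  refine le_trans ?_ (add_le_add (h1 R) (h2 R))
  have m : Measurable fun x : Site => ‖f x‖ₑ ^ 2 * ENNReal.ofReal ‖x.1 - R‖⁻¹ := by
    have := (Lp.stronglyMeasurable f).measurable
    fun_prop
  rw [← lintegral_add_left m]
  refine lintegral_mono fun x => ?_
  simp only [← add_mul]
  gcongr
  rcases le_total ‖f x‖ₑ ‖g x‖ₑ with h | h
  · exact le_add_left ((mul_le_mul_left h _).trans_eq (sq _).symm)
  · exact le_add_right ((mul_le_mul_right h _).trans_eq (sq _).symm)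

theorem integrable_conj_mul (f g : OneL2 𝕜) :
    Integrable (fun x => conj (f x) * g x) siteMeasure := by
  simpa only [RCLike.inner_apply, mul_comm] using L2.integrable_inner (𝕜 := 𝕜) f g

theorem integral_conj_mul (f g : OneL2 𝕜) :
    ∫ x, conj (f x) * g x ∂siteMeasure = ⟪f, g⟫_𝕜 := by
  simp only [L2.inner_def, RCLike.inner_apply, mul_comm]

theorem integrable_extPotential {K : ℕ} (Z : Fin K → ℕ) (R : Fin K → Space) {f g : OneL2 𝕜}
    (hf : OneMemH1 f) (hg : OneMemH1 g) :
    Integrable (fun x : Site => conj (f x) * ((extPotential Z R x.1 : ℝ) : 𝕜) * g x)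
      siteMeasure := by
  have mf := (Lp.stronglyMeasurable f).measurable
  have mg := (Lp.stronglyMeasurable g).measurable
  have h1 : ∀ η, Integrable (fun x : Site => conj (f x) * ((‖x.1 - R η‖⁻¹ : ℝ) : 𝕜) * g x)
      siteMeasure := by
    intro η
    obtain ⟨C, hC, h⟩ := hf.exists_coulomb_bound hg
    refine ⟨Measurable.aestronglyMeasurable ?_, lt_of_le_of_lt (le_trans (le_of_eq ?_) (h (R η)))
      hC.lt_top⟩
    · have : Measurable fun x : Site => ((‖x.1 - R η‖⁻¹ : ℝ) : 𝕜) :=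
        RCLike.measurable_ofReal.comp (by fun_prop)
      exact ((RCLike.continuous_conj.measurable.comp mf).mul this).mul mg
    · refine lintegral_congr fun x => ?_
      rw [enorm_mul, enorm_mul, ← ofReal_norm (conj (f x)), RCLike.norm_conj, ofReal_norm,
        ← ofReal_norm ((_ : ℝ) : 𝕜), RCLike.norm_of_nonneg (by positivity)]
      ring
  have h2 : (fun x : Site => conj (f x) * ((extPotential Z R x.1 : ℝ) : 𝕜) * g x) =
      fun x => ∑ η, (-(Z η : 𝕜)) * (conj (f x) * ((‖x.1 - R η‖⁻¹ : ℝ) : 𝕜) * g x) := by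
    funext x
    simp only [extPotential, RCLike.ofReal_neg, RCLike.ofReal_sum, RCLike.ofReal_mul,
      RCLike.ofReal_natCast, RCLike.ofReal_inv, div_eq_mul_inv, mul_neg, neg_mul, Finset.mul_sum,
      Finset.sum_mul, Finset.sum_neg_distrib, neg_inj]
    exact Finset.sum_congr rfl fun η _ => by ring
  rw [h2]
  exact integrable_finsetSum _ fun η _ => (h1 η).const_mul _

theorem integrable_oneElectronIntegrand {K : ℕ} (Z : Fin K → ℕ) (R : Fin K → Space)
    {f g : OneL2 𝕜} (hf : OneMemH1 f) (hg : OneMemH1 g) (s : Spin) :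
    Integrable (oneElectronIntegrand Z R f g s) :=
  integrable_site_iff.1 (integrable_extPotential Z R hf hg) s

/-- The integrand of the two-electron integral as a function on pairs of sites. -/
def pairIntegrand {d : ℕ} (φ : Fin d → OneL2 𝕜) (a b p q : Fin d) (z : Site × Site) : 𝕜 :=
  twoElectronIntegrand φ a b p q z.1.2 z.2.2 z.1.1 z.2.1

/-- Integration over the first electron gives a bound that is uniform in the position of the
second one, and leaves the integral of `|φ_b φ_p|`. -/
theorem integrable_pairIntegrand {d : ℕ} {φ : Fin d → OneL2 𝕜} (hφ : ∀ p, OneMemH1 (φ p))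
    (a b p q : Fin d) :
    Integrable (pairIntegrand φ a b p q) (siteMeasure.prod siteMeasure) := by
  have m : ∀ a, Measurable (φ a) := fun a => (Lp.stronglyMeasurable (φ a)).measurable
  obtain ⟨C, hC, h⟩ := (hφ a).exists_coulomb_bound (hφ q)
  have hm : Measurable (pairIntegrand φ a b p q) := by
    have h1 : Measurable fun z : Site × Site => ((‖z.1.1 - z.2.1‖ : ℝ) : 𝕜) :=
      RCLike.measurable_ofReal.comp (by fun_prop)
    have h2 : ∀ a, Measurable fun z : Site × Site => φ a (z.1.1, z.1.2) := fun a =>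
      (m a).comp measurable_fst
    have h3 : ∀ a, Measurable fun z : Site × Site => φ a (z.2.1, z.2.2) := fun a =>
      (m a).comp measurable_snd
    have hc := RCLike.continuous_conj (K := 𝕜) |>.measurable
    exact ((((hc.comp (h2 a)).mul (hc.comp (h3 b))).mul (h2 q)).mul (h3 p)).div h1
  refine ⟨hm.aestronglyMeasurable, ?_⟩
  have e1 : ∀ z : Site × Site, ‖pairIntegrand φ a b p q z‖ₑ =
      (‖φ a z.1‖ₑ * ‖φ q z.1‖ₑ * ENNReal.ofReal ‖z.1.1 - z.2.1‖⁻¹) *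
        (‖φ b z.2‖ₑ * ‖φ p z.2‖ₑ) := by
    intro z
    have ec : ∀ w : 𝕜, ‖conj w‖ₑ = ‖w‖ₑ := fun w => by
      rw [← ofReal_norm, RCLike.norm_conj, ofReal_norm]
    have er : ‖(((‖z.1.1 - z.2.1‖ : ℝ) : 𝕜))⁻¹‖ₑ = ENNReal.ofReal ‖z.1.1 - z.2.1‖⁻¹ := by
      rw [← ofReal_norm, norm_inv, RCLike.norm_of_nonneg (norm_nonneg _)]
    simp only [pairIntegrand, twoElectronIntegrand, div_eq_mul_inv, enorm_mul, ec, er]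
    ring
  have hfin : ∫⁻ y, ‖φ b y‖ₑ * ‖φ p y‖ₑ ∂siteMeasure < ⊤ := by
    have := (integrable_conj_mul (φ b) (φ p)).2
    refine lt_of_le_of_lt (lintegral_mono fun y => le_of_eq ?_) this
    rw [enorm_mul, ← ofReal_norm (conj _), RCLike.norm_conj, ofReal_norm]
  have hm2 : Measurable fun z : Site × Site => ‖pairIntegrand φ a b p q z‖ₑ := hm.enorm
  rw [HasFiniteIntegral, lintegral_prod_symm _ hm2.aemeasurable]
  calc _ ≤ ∫⁻ y, C * (‖φ b y‖ₑ * ‖φ p y‖ₑ) ∂siteMeasure := by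
        refine lintegral_mono fun y => ?_
        simp only [e1]
        rw [lintegral_mul_const']
        · gcongr
          exact h y.1
        · exact ENNReal.mul_ne_top enorm_ne_top enorm_ne_top
    _ = C * ∫⁻ y, ‖φ b y‖ₑ * ‖φ p y‖ₑ ∂siteMeasure := lintegral_const_mul' _ _ hC
    _ < ⊤ := ENNReal.mul_lt_top hC.lt_top hfin

theorem siteMeasure_prod_eq_sum :
    siteMeasure.prod siteMeasure = ∑ s : Spin × Spin, (volume : Measure (Space × Space)).map
      fun r => (((r.1, s.1), (r.2, s.2)) : Site × Site) := by
  have hm : ∀ s : Spin × Spin, Measurable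
      fun r : Space × Space => (((r.1, s.1), (r.2, s.2)) : Site × Site) := fun s => by fun_prop
  refine Measure.prod_eq fun A B hA hB => ?_
  simp only [siteMeasure_eq_sum, Measure.finsetSum_apply, Finset.sum_mul_sum,
    ← Finset.univ_product_univ, Finset.sum_product]
  refine Finset.sum_congr rfl fun s _ => Finset.sum_congr rfl fun s' _ => ?_
  rw [Measure.map_apply (hm (s, s')) (hA.prod hB), (measurableEmbedding_site _).map_apply,
    (measurableEmbedding_site _).map_apply, ← Measure.prod_prod]
  rfl

theorem measurableEmbedding_site_prod (s : Spin × Spin) : MeasurableEmbedding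
    fun r : Space × Space => (((r.1, s.1), (r.2, s.2)) : Site × Site) :=
  (measurableEmbedding_site s.1).prodMap (measurableEmbedding_site s.2)

theorem integrable_twoElectronIntegrand {d : ℕ} {φ : Fin d → OneL2 𝕜} (hφ : ∀ p, OneMemH1 (φ p))
    (a b p q : Fin d) (s s' : Spin) :
    Integrable fun r : Space × Space => twoElectronIntegrand φ a b p q s s' r.1 r.2 := by
  have := integrable_pairIntegrand hφ a b p q
  rw [siteMeasure_prod_eq_sum, integrable_finsetSum_measure] at this
  exact (measurableEmbedding_site_prod (s, s')).integrable_map_iff.1 (this (s, s') (Finset.mem_univ _))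

theorem integral_pairIntegrand {d : ℕ} {φ : Fin d → OneL2 𝕜} (hφ : ∀ p, OneMemH1 (φ p))
    (a b p q : Fin d) :
    ∫ z, pairIntegrand φ a b p q z ∂siteMeasure.prod siteMeasure = gCoeff φ a b p q := by
  have := integrable_pairIntegrand hφ a b p q
  rw [siteMeasure_prod_eq_sum, integrable_finsetSum_measure] at this
  rw [siteMeasure_prod_eq_sum, integral_finsetSum_measure this, ← Finset.univ_product_univ,
    Finset.sum_product, gCoeff]
  refine Finset.sum_congr rfl fun s _ => Finset.sum_congr rfl fun s' _ => ?_
  rw [(measurableEmbedding_site_prod (s, s')).integral_map]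
  exact integral_prod _ (integrable_twoElectronIntegrand hφ a b p q s s')

end Coulomb

/-! ### The energy of sums of products of orbitals -/

section PairIntegrals

variable {𝕜 : Type*} [RCLike 𝕜]

theorem univ_erase_erase_succAbove {n : ℕ} (ξ : Fin (n + 2)) (j : Fin (n + 1)) :
    (Finset.univ.erase ξ).erase (ξ.succAbove j) =
      Finset.univ.map (j.succAboveEmb.trans ξ.succAboveEmb) := by
  ext k
  simp only [Finset.mem_erase, Finset.mem_univ, and_true, Finset.mem_map,
    Function.Embedding.trans_apply, Fin.coe_succAboveEmb, true_and]
  constructor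
  · rintro ⟨h1, h2⟩
    obtain ⟨l, rfl⟩ := Fin.exists_succAbove_eq h2
    obtain ⟨m, rfl⟩ := Fin.exists_succAbove_eq (fun h : l = j => h1 (h ▸ rfl))
    exact ⟨m, rfl⟩
  · rintro ⟨m, rfl⟩
    exact ⟨fun h => Fin.succAbove_ne j m (Fin.succAbove_right_injective h), Fin.succAbove_ne ξ _⟩

/-- Fubini's theorem for a function of two of the electrons times functions of each of the other
electrons. -/
theorem integrable_and_integral_pair_mul_prod {M : ℕ} {ξ ζ : Fin M} (hne : ζ ≠ ξ)
    {F : Site × Site → 𝕜} (hF : Integrable F (siteMeasure.prod siteMeasure))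
    {k : Fin M → Site → 𝕜} (hk : ∀ ν, Integrable (k ν) siteMeasure) :
    Integrable (fun x : Config M => F (x ξ, x ζ) * ∏ ν ∈ (Finset.univ.erase ξ).erase ζ, k ν (x ν))
      (configMeasure M) ∧
    ∫ x : Config M, F (x ξ, x ζ) * ∏ ν ∈ (Finset.univ.erase ξ).erase ζ, k ν (x ν)
        ∂configMeasure M =
      (∫ z, F z ∂siteMeasure.prod siteMeasure) *
        ∏ ν ∈ (Finset.univ.erase ξ).erase ζ, ∫ y, k ν y ∂siteMeasure := by
  obtain _ | _ | n := M
  · exact ξ.elim0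
  · exact absurd ((Fin.eq_zero ζ).trans (Fin.eq_zero ξ).symm) hne
  obtain ⟨j, rfl⟩ := Fin.exists_succAbove_eq hne
  have hrest : ∀ G : Fin (n + 2) → 𝕜, ∏ ν ∈ (Finset.univ.erase ξ).erase (ξ.succAbove j), G ν =
      ∏ i : Fin n, G (ξ.succAbove (j.succAbove i)) := fun G => by
    rw [univ_erase_erase_succAbove, Finset.prod_map]; rfl
  simp only [hrest]
  -- split off the two coordinates
  have m1 := measurePreserving_piFinSuccAbove (fun _ : Fin (n + 2) => siteMeasure) ξ
  have m2 := measurePreserving_piFinSuccAbove (fun _ : Fin (n + 1) => siteMeasure) j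
  have m3 := (measurePreserving_prodAssoc siteMeasure siteMeasure
    (Measure.pi fun _ : Fin n => siteMeasure)).symm
  have mp := m3.comp (((MeasurePreserving.id siteMeasure).prod m2).comp m1)
  have em := (MeasurableEquiv.prodAssoc.symm.measurableEmbedding).comp
    (((MeasurableEmbedding.id).prodMap
      (MeasurableEquiv.piFinSuccAbove (fun _ : Fin (n + 1) => Site) j).measurableEmbedding).comp
      (MeasurableEquiv.piFinSuccAbove (fun _ : Fin (n + 2) => Site) ξ).measurableEmbedding)
  have hprod := Integrable.fintype_prod (μ := fun _ : Fin n => siteMeasure)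
    (f := fun i => k (ξ.succAbove (j.succAbove i))) fun i => hk _
  have hint := hF.mul_prod hprod
  constructor
  · exact (mp.integrable_comp_emb em).2 hint
  · have e := mp.integral_comp em
      (fun w => F w.1 * ∏ i : Fin n, k (ξ.succAbove (j.succAbove i)) (w.2 i))
    refine e.trans ?_
    rw [integral_prod_mul F (fun w : Fin n → Site =>
      ∏ i : Fin n, k (ξ.succAbove (j.succAbove i)) (w i)), integral_fintype_prod_eq_prod]

end PairIntegrals

section OrbitalExpansions

variable {𝕜 : Type*} [RCLike 𝕜] {d M : ℕ}

/-- The wave function `∑_μ c_μ φ_{μ_1} ⊗ ⋯ ⊗ φ_{μ_M}` with coefficients `c`. -/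
def orbitalSum (φ : Fin d → OneL2 𝕜) (c : (Fin M → Fin d) → 𝕜) : L2 𝕜 M :=
  ∑ μ, c μ • prodL2 fun ζ => φ (μ ζ)

/-- The value of the energy form at the products `φ_{μ_1} ⊗ ⋯ ⊗ φ_{μ_M}` and
`φ_{ν_1} ⊗ ⋯ ⊗ φ_{ν_M}` of orthonormal orbitals, in terms of one- and two-electron integrals. -/
def productEnergy {K : ℕ} (Z : Fin K → ℕ) (R : Fin K → Space) (φ : Fin d → OneL2 𝕜)
    (μ ν : Fin M → Fin d) : 𝕜 :=
  ∑ ξ, hCoeff Z R φ (μ ξ) (ν ξ) * ∏ ζ ∈ Finset.univ.erase ξ, (if μ ζ = ν ζ then 1 else 0)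
    + (1 / 2) * ∑ ξ, ∑ ζ ∈ Finset.univ.erase ξ, gCoeff φ (μ ξ) (μ ζ) (ν ζ) (ν ξ) *
        ∏ k ∈ (Finset.univ.erase ξ).erase ζ, (if μ k = ν k then 1 else 0)

theorem inner_orbitals {φ : Fin d → OneL2 𝕜} (hφ : Orthonormal 𝕜 φ) (a b : Fin d) :
    ⟪φ a, φ b⟫_𝕜 = if a = b then 1 else 0 := by
  classical
  exact orthonormal_iff_ite.1 hφ a b

theorem inner_orbitalSum {φ : Fin d → OneL2 𝕜} (hφ : Orthonormal 𝕜 φ)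
    (c c' : (Fin M → Fin d) → 𝕜) :
    ⟪orbitalSum φ c, orbitalSum φ c'⟫_𝕜 = ∑ μ, conj (c μ) * c' μ := by
  have h : ∀ μ ν : Fin M → Fin d, ⟪prodL2 fun ζ => φ (μ ζ), prodL2 fun ζ => φ (ν ζ)⟫_𝕜 =
      if μ = ν then 1 else 0 := by
    intro μ ν
    simp only [inner_prodL2, inner_orbitals hφ, Finset.prod_ite_zero, Finset.prod_const_one,
      Finset.mem_univ, true_implies, funext_iff]
  simp only [orbitalSum, sum_inner, inner_sum, inner_smul_left, inner_smul_right, h]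
  simp [mul_comm]

theorem coeFn_sum_smul {ι : Type*} [Fintype ι] (f : ι → L2 𝕜 M) (c : ι → 𝕜) :
    (∑ k, c k • f k : L2 𝕜 M) =ᵐ[configMeasure M] fun x => ∑ k, c k * f k x := by
  have h1 := Lp.coeFn_finsetSum Finset.univ fun k => c k • f k
  have h2 : ∀ᵐ x ∂configMeasure M, ∀ k, (c k • f k : L2 𝕜 M) x = c k * f k x :=
    ae_all_iff.2 fun k => Lp.coeFn_smul (c k) (f k)
  filter_upwards [h1, h2] with x h1 h2
  rw [h1, Finset.sum_apply]
  exact Finset.sum_congr rfl fun k _ => h2 k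

/-- A sesquilinear integral with weight `w` is expanded in a system of wave functions. -/
theorem integrable_and_integral_weighted_sum {ι : Type*} [Fintype ι] {w : Config M → 𝕜}
    {f : ι → L2 𝕜 M} (h : ∀ k l, Integrable (fun x => conj (f k x) * w x * f l x) (configMeasure M))
    (c c' : ι → 𝕜) :
    Integrable (fun x => conj ((∑ k, c k • f k : L2 𝕜 M) x) * w x * (∑ k, c' k • f k : L2 𝕜 M) x)
      (configMeasure M) ∧
    ∫ x, conj ((∑ k, c k • f k : L2 𝕜 M) x) * w x * (∑ k, c' k • f k : L2 𝕜 M) x ∂configMeasure M =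
      ∑ k, ∑ l, conj (c k) * c' l * ∫ x, conj (f k x) * w x * f l x ∂configMeasure M := by
  have he : (fun x => conj ((∑ k, c k • f k : L2 𝕜 M) x) * w x * (∑ k, c' k • f k : L2 𝕜 M) x)
      =ᵐ[configMeasure M] fun x => ∑ k, ∑ l, conj (c k) * c' l * (conj (f k x) * w x * f l x) := by
    filter_upwards [coeFn_sum_smul f c, coeFn_sum_smul f c'] with x h1 h2
    rw [h1, h2, map_sum, Finset.sum_mul, Finset.sum_mul_sum]
    refine Finset.sum_congr rfl fun k _ => Finset.sum_congr rfl fun l _ => ?_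
    rw [map_mul]; ring
  have hi : ∀ k l, Integrable (fun x => conj (c k) * c' l * (conj (f k x) * w x * f l x))
      (configMeasure M) := fun k l => (h k l).const_mul _
  refine ⟨(integrable_finsetSum _ fun k _ => integrable_finsetSum _ fun l _ => hi k l).congr he.symm,
    ?_⟩
  rw [integral_congr_ae he, integral_finsetSum _ fun k _ => integrable_finsetSum _ fun l _ => hi k l]
  refine Finset.sum_congr rfl fun k _ => ?_
  rw [integral_finsetSum _ fun l _ => hi k l]
  simp only [integral_const_mul]

theorem nuclear_prodL2 {K : ℕ} (Z : Fin K → ℕ) (R : Fin K → Space) {φ : Fin d → OneL2 𝕜}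
    (hφ : Orthonormal 𝕜 φ) (hH1 : ∀ p, OneMemH1 (φ p)) (μ ν : Fin M → Fin d) (ξ : Fin M) :
    Integrable (nuclearIntegrand Z R ξ (prodL2 fun ζ => φ (μ ζ)) (prodL2 fun ζ => φ (ν ζ)))
      (configMeasure M) ∧
    ∫ x, nuclearIntegrand Z R ξ (prodL2 fun ζ => φ (μ ζ)) (prodL2 fun ζ => φ (ν ζ)) x
        ∂configMeasure M =
      (∑ s : Spin, ∫ r, oneElectronIntegrand Z R (φ (μ ξ)) (φ (ν ξ)) s r) *
        ∏ ζ ∈ Finset.univ.erase ξ, (if μ ζ = ν ζ then 1 else 0) := by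
  -- the potential is absorbed in the factor of electron `ξ`
  set k : Fin M → Site → 𝕜 := fun ζ x => if ζ = ξ then
      conj (φ (μ ζ) x) * ((extPotential Z R x.1 : ℝ) : 𝕜) * φ (ν ζ) x
    else conj (φ (μ ζ) x) * φ (ν ζ) x with hk
  have hki : ∀ ζ, Integrable (k ζ) siteMeasure := by
    intro ζ
    obtain h | h := eq_or_ne ζ ξ
    · simpa only [hk, h, if_true] using integrable_extPotential Z R (hH1 (μ ξ)) (hH1 (ν ξ))
    · simpa only [hk, if_neg h] using integrable_conj_mul _ _
  have he : nuclearIntegrand Z R ξ (prodL2 fun ζ => φ (μ ζ)) (prodL2 fun ζ => φ (ν ζ))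
      =ᵐ[configMeasure M] fun x => ∏ ζ, k ζ (x ζ) := by
    filter_upwards [coeFn_prodL2 fun ζ => φ (μ ζ), coeFn_prodL2 fun ζ => φ (ν ζ)] with x h1 h2
    have h3 : ∀ ζ ∈ Finset.univ.erase ξ, k ζ (x ζ) = conj (φ (μ ζ) (x ζ)) * φ (ν ζ) (x ζ) :=
      fun ζ hζ => if_neg (Finset.ne_of_mem_erase hζ)
    rw [nuclearIntegrand, h1, h2, ← Finset.mul_prod_erase _ _ (Finset.mem_univ ξ),
      ← Finset.mul_prod_erase _ (fun ζ => φ (ν ζ) (x ζ)) (Finset.mem_univ ξ),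
      ← Finset.mul_prod_erase _ (fun ζ => k ζ (x ζ)) (Finset.mem_univ ξ), Finset.prod_congr rfl h3,
      Finset.prod_mul_distrib]
    simp only [hk, if_true, map_mul, map_prod]
    ring
  refine ⟨(Integrable.fintype_prod (μ := fun _ => siteMeasure) hki).congr he.symm, ?_⟩
  rw [integral_congr_ae he, configMeasure, integral_fintype_prod_eq_prod,
    ← Finset.mul_prod_erase _ _ (Finset.mem_univ ξ)]
  congr 1
  · simp only [hk, if_true]
    exact integral_site (integrable_extPotential Z R (hH1 (μ ξ)) (hH1 (ν ξ)))
  · refine Finset.prod_congr rfl fun ζ hζ => ?_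
    simp only [hk, if_neg (Finset.ne_of_mem_erase hζ), integral_conj_mul, inner_orbitals hφ]

theorem repulsion_prodL2 {φ : Fin d → OneL2 𝕜} (hφ : Orthonormal 𝕜 φ)
    (hH1 : ∀ p, OneMemH1 (φ p)) (μ ν : Fin M → Fin d) {ξ ζ : Fin M} (hne : ζ ≠ ξ) :
    Integrable (repulsionIntegrand ξ ζ (prodL2 fun ζ => φ (μ ζ)) (prodL2 fun ζ => φ (ν ζ)))
      (configMeasure M) ∧
    ∫ x, repulsionIntegrand ξ ζ (prodL2 fun ζ => φ (μ ζ)) (prodL2 fun ζ => φ (ν ζ)) x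
        ∂configMeasure M =
      gCoeff φ (μ ξ) (μ ζ) (ν ζ) (ν ξ) *
        ∏ k ∈ (Finset.univ.erase ξ).erase ζ, (if μ k = ν k then 1 else 0) := by
  have hmem : ζ ∈ Finset.univ.erase ξ := Finset.mem_erase.2 ⟨hne, Finset.mem_univ _⟩
  obtain ⟨h1, h2⟩ := integrable_and_integral_pair_mul_prod hne
    (integrable_pairIntegrand hH1 (μ ξ) (μ ζ) (ν ζ) (ν ξ))
    (k := fun k x => conj (φ (μ k) x) * φ (ν k) x) fun k => integrable_conj_mul _ _
  have he : repulsionIntegrand ξ ζ (prodL2 fun ζ => φ (μ ζ)) (prodL2 fun ζ => φ (ν ζ))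
      =ᵐ[configMeasure M] fun x => pairIntegrand φ (μ ξ) (μ ζ) (ν ζ) (ν ξ) (x ξ, x ζ) *
        ∏ k ∈ (Finset.univ.erase ξ).erase ζ, (conj (φ (μ k) (x k)) * φ (ν k) (x k)) := by
    filter_upwards [coeFn_prodL2 fun ζ => φ (μ ζ), coeFn_prodL2 fun ζ => φ (ν ζ)] with x h1 h2
    rw [repulsionIntegrand, h1, h2, ← Finset.mul_prod_erase _ _ (Finset.mem_univ ξ),
      ← Finset.mul_prod_erase _ (fun ζ => φ (ν ζ) (x ζ)) (Finset.mem_univ ξ),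
      ← Finset.mul_prod_erase _ _ hmem, ← Finset.mul_prod_erase _ (fun ζ => φ (ν ζ) (x ζ)) hmem,
      Finset.prod_mul_distrib]
    simp only [pairIntegrand, twoElectronIntegrand, map_mul, map_prod, RCLike.ofReal_inv,
      one_mul, div_eq_mul_inv]
    ring
  refine ⟨h1.congr he.symm, ?_⟩
  rw [integral_congr_ae he, h2, integral_pairIntegrand hH1]
  simp only [integral_conj_mul, inner_orbitals hφ]

theorem hasWeakDeriv_orbitalSum {φ : Fin d → OneL2 𝕜} (hH1 : ∀ p, OneMemH1 (φ p))
    (c : (Fin M → Fin d) → 𝕜) (ξ : Fin M) (i : Fin 3) :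
    HasWeakDeriv ξ i (orbitalSum φ c) (∑ μ, c μ •
      prodL2 (Function.update (fun ζ => φ (μ ζ)) ξ (oneWeakDeriv i (φ (μ ξ))))) :=
  HasWeakDeriv.sum fun μ _ => hasWeakDeriv_prodL2 ((hH1 (μ ξ)).hasWeakDeriv i)

theorem inner_weakDeriv_orbitalSum {φ : Fin d → OneL2 𝕜} (hφ : Orthonormal 𝕜 φ)
    (hH1 : ∀ p, OneMemH1 (φ p)) (c c' : (Fin M → Fin d) → 𝕜) (ξ : Fin M) (i : Fin 3) :
    ⟪weakDeriv ξ i (orbitalSum φ c), weakDeriv ξ i (orbitalSum φ c')⟫_𝕜 =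
      ∑ μ, ∑ ν, conj (c μ) * c' ν * (⟪oneWeakDeriv i (φ (μ ξ)), oneWeakDeriv i (φ (ν ξ))⟫_𝕜 *
        ∏ ζ ∈ Finset.univ.erase ξ, (if μ ζ = ν ζ then 1 else 0)) := by
  rw [(hasWeakDeriv_orbitalSum hH1 c ξ i).weakDeriv_eq,
    (hasWeakDeriv_orbitalSum hH1 c' ξ i).weakDeriv_eq]
  simp only [sum_inner, inner_sum, inner_smul_left, inner_smul_right, inner_prodL2,
    Finset.mul_sum]
  rw [Finset.sum_comm]
  refine Finset.sum_congr rfl fun μ _ => Finset.sum_congr rfl fun ν _ => ?_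
  rw [← Finset.mul_prod_erase _ _ (Finset.mem_univ ξ), Function.update_self, Function.update_self]
  rw [Finset.prod_congr (g := fun ζ => if μ ζ = ν ζ then (1 : 𝕜) else 0) rfl fun ζ hζ => by
    rw [Function.update_of_ne (Finset.ne_of_mem_erase hζ),
      Function.update_of_ne (Finset.ne_of_mem_erase hζ), inner_orbitals hφ]]
  ring

theorem nuclear_orbitalSum {K : ℕ} (Z : Fin K → ℕ) (R : Fin K → Space) {φ : Fin d → OneL2 𝕜}
    (hφ : Orthonormal 𝕜 φ) (hH1 : ∀ p, OneMemH1 (φ p)) (c c' : (Fin M → Fin d) → 𝕜) (ξ : Fin M) :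
    Integrable (nuclearIntegrand Z R ξ (orbitalSum φ c) (orbitalSum φ c')) (configMeasure M) ∧
    ∫ x, nuclearIntegrand Z R ξ (orbitalSum φ c) (orbitalSum φ c') x ∂configMeasure M =
      ∑ μ, ∑ ν, conj (c μ) * c' ν *
        ((∑ s : Spin, ∫ r, oneElectronIntegrand Z R (φ (μ ξ)) (φ (ν ξ)) s r) *
          ∏ ζ ∈ Finset.univ.erase ξ, (if μ ζ = ν ζ then 1 else 0)) := by
  have h := integrable_and_integral_weighted_sum
    (w := fun x => ((extPotential Z R (x ξ).1 : ℝ) : 𝕜))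
    (fun μ ν => (nuclear_prodL2 Z R hφ hH1 μ ν ξ).1) c c'
  refine ⟨h.1, h.2.trans ?_⟩
  refine Finset.sum_congr rfl fun μ _ => Finset.sum_congr rfl fun ν _ => ?_
  rw [← (nuclear_prodL2 Z R hφ hH1 μ ν ξ).2]
  rfl

theorem repulsion_orbitalSum {φ : Fin d → OneL2 𝕜} (hφ : Orthonormal 𝕜 φ)
    (hH1 : ∀ p, OneMemH1 (φ p)) (c c' : (Fin M → Fin d) → 𝕜) {ξ ζ : Fin M} (hne : ζ ≠ ξ) :
    Integrable (repulsionIntegrand ξ ζ (orbitalSum φ c) (orbitalSum φ c')) (configMeasure M) ∧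
    ∫ x, repulsionIntegrand ξ ζ (orbitalSum φ c) (orbitalSum φ c') x ∂configMeasure M =
      ∑ μ, ∑ ν, conj (c μ) * c' ν * (gCoeff φ (μ ξ) (μ ζ) (ν ζ) (ν ξ) *
        ∏ k ∈ (Finset.univ.erase ξ).erase ζ, (if μ k = ν k then 1 else 0)) := by
  have h := integrable_and_integral_weighted_sum
    (w := fun x => ((1 / ‖(x ξ).1 - (x ζ).1‖ : ℝ) : 𝕜))
    (fun μ ν => (repulsion_prodL2 hφ hH1 μ ν hne).1) c c'
  refine ⟨h.1, h.2.trans ?_⟩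
  refine Finset.sum_congr rfl fun μ _ => Finset.sum_congr rfl fun ν _ => ?_
  rw [← (repulsion_prodL2 hφ hH1 μ ν hne).2]
  rfl

/-- The energy form in terms of coefficients, by sesquilinearity: each of its terms is evaluated on
products of orbitals by Fubini's theorem and orthonormality. -/
theorem energyForm_orbitalSum {K : ℕ} (Z : Fin K → ℕ) (R : Fin K → Space) {φ : Fin d → OneL2 𝕜}
    (hφ : Orthonormal 𝕜 φ) (hH1 : ∀ p, OneMemH1 (φ p)) (c c' : (Fin M → Fin d) → 𝕜) :
    energyForm Z R (orbitalSum φ c) (orbitalSum φ c') =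
      ∑ μ, ∑ ν, conj (c μ) * c' ν * productEnergy Z R φ μ ν := by
  have e3 : ∀ ξ : Fin M, ∑ ζ ∈ Finset.univ.erase ξ,
      ∫ x, repulsionIntegrand ξ ζ (orbitalSum φ c) (orbitalSum φ c') x ∂configMeasure M =
      ∑ ζ ∈ Finset.univ.erase ξ, ∑ μ, ∑ ν, conj (c μ) * c' ν *
        (gCoeff φ (μ ξ) (μ ζ) (ν ζ) (ν ξ) *
          ∏ k ∈ (Finset.univ.erase ξ).erase ζ, (if μ k = ν k then 1 else 0)) := fun ξ =>
    Finset.sum_congr rfl fun ζ hζ =>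
      (repulsion_orbitalSum hφ hH1 c c' (Finset.ne_of_mem_erase hζ)).2
  have hS : ∀ {n : ℕ} (t : Finset (Fin n)) (G : Fin n → (Fin M → Fin d) → (Fin M → Fin d) → 𝕜),
      ∑ k ∈ t, ∑ μ, ∑ ν, conj (c μ) * c' ν * G k μ ν =
        ∑ μ, ∑ ν, conj (c μ) * c' ν * ∑ k ∈ t, G k μ ν := by
    intro n t G
    rw [Finset.sum_comm]
    refine Finset.sum_congr rfl fun μ _ => ?_
    rw [Finset.sum_comm]
    exact Finset.sum_congr rfl fun ν _ => (Finset.mul_sum _ _ _).symm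
  have hC : ∀ (k : 𝕜) (G : (Fin M → Fin d) → (Fin M → Fin d) → 𝕜),
      k * ∑ μ, ∑ ν, conj (c μ) * c' ν * G μ ν = ∑ μ, ∑ ν, conj (c μ) * c' ν * (k * G μ ν) := by
    intro k G
    simp only [Finset.mul_sum, mul_left_comm]
  simp only [energyForm, inner_weakDeriv_orbitalSum hφ hH1, (nuclear_orbitalSum Z R hφ hH1 c c' _).2,
    e3, hS, hC, ← Finset.sum_add_distrib, ← mul_add]
  refine Finset.sum_congr rfl fun μ _ => Finset.sum_congr rfl fun ν _ => ?_
  congr 1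
  simp only [productEnergy, hCoeff, oneElectronForm, add_mul, Finset.sum_add_distrib, mul_assoc,
    Finset.mul_sum, Finset.sum_mul]

end OrbitalExpansions

/-! ### Occupation number vectors and annihilation operators -/

section Occupation

variable {𝕜 : Type*} [RCLike 𝕜] {d : ℕ}

variable (𝕜) in
/-- The basis vector `𝐞^{ν_1} ⊗ ⋯ ⊗ 𝐞^{ν_d}` of the binary Fock space that has the occupation
numbers of `{p_1, …, p_M}`. -/
def occVec {M : ℕ} (p : Fin M ↪o Fin d) : Binary 𝕜 d := tensorVec fun i => e (occupation p i)

theorem tensorVec_e (ν : Fin d → Fin 2) :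
    tensorVec (fun i => e (ν i)) = EuclideanSpace.single ν (1 : 𝕜) := by
  ext μ
  simp only [tensorVec, e, Pi.single_apply, Finset.prod_ite_zero, Finset.prod_const_one,
    Finset.mem_univ, true_implies, PiLp.single_apply, funext_iff]

theorem occVec_eq_single {M : ℕ} (p : Fin M ↪o Fin d) :
    occVec 𝕜 p = EuclideanSpace.single (occupation p) 1 := tensorVec_e _

theorem occupation_eq_one_iff {M : ℕ} {p : Fin M ↪o Fin d} {i : Fin d} :
    occupation p i = 1 ↔ i ∈ Set.range p := by
  unfold occupation; split_ifs with h <;> simp [h]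

theorem occupation_eq_zero_iff {M : ℕ} {p : Fin M ↪o Fin d} {i : Fin d} :
    occupation p i = 0 ↔ i ∉ Set.range p := by
  unfold occupation; split_ifs with h <;> simp [h]

theorem occupation_eq_iff {M M' : ℕ} {p : Fin M ↪o Fin d} {q : Fin M' ↪o Fin d} :
    occupation p = occupation q ↔ Set.range p = Set.range q := by
  constructor
  · intro h
    ext i
    rw [← occupation_eq_one_iff, h, occupation_eq_one_iff]
  · intro h
    funext i
    simp only [occupation, h]

theorem card_eq_of_occupation_eq {M M' : ℕ} {p : Fin M ↪o Fin d} {q : Fin M' ↪o Fin d}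
    (h : occupation p = occupation q) : M = M' := by
  have := congrArg Set.ncard (occupation_eq_iff.1 h)
  simpa [Set.ncard_range_of_injective p.injective, Set.ncard_range_of_injective q.injective]
    using this

theorem eq_of_occupation_eq {M : ℕ} {p q : Fin M ↪o Fin d}
    (h : occupation p = occupation q) : p = q := by
  have h1 := occupation_eq_iff.1 h
  exact DFunLike.coe_injective ((p.strictMono.range_inj q.strictMono).1 h1)

theorem inner_occVec {M : ℕ} (p q : Fin M ↪o Fin d) :
    ⟪occVec 𝕜 p, occVec 𝕜 q⟫_𝕜 = if p = q then 1 else 0 := by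
  classical
  rw [occVec_eq_single, occVec_eq_single, EuclideanSpace.inner_single_left]
  simp only [map_one, one_mul, PiLp.single_apply]
  by_cases h : p = q
  · simp [h]
  · rw [if_neg h, if_neg fun h' => h (eq_of_occupation_eq h')]

theorem inner_occVec_of_ne {M M' : ℕ} (h : M ≠ M') (p : Fin M ↪o Fin d) (q : Fin M' ↪o Fin d) :
    ⟪occVec 𝕜 p, occVec 𝕜 q⟫_𝕜 = 0 := by
  rw [occVec_eq_single, occVec_eq_single, EuclideanSpace.inner_single_left]
  simp only [map_one, one_mul, PiLp.single_apply]
  rw [if_neg fun h' => h (card_eq_of_occupation_eq h')]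

theorem tensorVec_smul (c : Fin d → 𝕜) (v : Fin d → Fin 2 → 𝕜) :
    tensorVec (fun i => c i • v i) = (∏ i, c i) • tensorVec v := by
  ext μ
  simp [tensorVec, Finset.prod_mul_distrib]

theorem tensorVec_eq_zero {v : Fin d → Fin 2 → 𝕜} (i : Fin d) (h : v i = 0) : tensorVec v = 0 := by
  ext μ
  simp only [tensorVec, PiLp.zero_apply]
  exact Finset.prod_eq_zero (Finset.mem_univ i) (by simp [h])

theorem annihilate_occVec_of_notMem {M : ℕ} {p : Fin M ↪o Fin d} {a : Fin d}
    (h : a ∉ Set.range p) : annihilate 𝕜 a (occVec 𝕜 p) = 0 := by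
  rw [annihilate, occVec, tensorOp_tensorVec]
  refine tensorVec_eq_zero a ?_
  rw [occupation_eq_zero_iff.2 h]
  ext k
  fin_cases k <;> simp [matA, e]

/-- Annihilating the `j`-th of the occupied orbitals `p_0 < p_1 < ⋯` gives the sign `(-1)^j`,
because the matrices `S` act on the `j` occupied positions below it. -/
theorem annihilate_occVec_apply {m : ℕ} (p : Fin (m + 1) ↪o Fin d) (j : Fin (m + 1)) :
    annihilate 𝕜 (p j) (occVec 𝕜 p) =
      (-1 : 𝕜) ^ (j : ℕ) • occVec 𝕜 ((Fin.succAboveOrderEmb j).trans p) := by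
  classical
  have hrange : ∀ i, i ∈ Set.range ((Fin.succAboveOrderEmb j).trans p) ↔
      i ∈ Set.range p ∧ i ≠ p j := by
    intro i
    constructor
    · rintro ⟨k, rfl⟩
      exact ⟨⟨_, rfl⟩, fun h => Fin.succAbove_ne j k (p.injective h)⟩
    · rintro ⟨⟨k, rfl⟩, hk⟩
      obtain ⟨l, rfl⟩ := Fin.exists_succAbove_eq (fun h : k = j => hk (h ▸ rfl))
      exact ⟨l, rfl⟩
  set c : Fin d → 𝕜 := fun i => if i ∈ (Finset.Iio j).map p.toEmbedding then -1 else 1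
    with hc
  have hprod : ∏ i, c i = (-1 : 𝕜) ^ (j : ℕ) := by
    rw [hc, Finset.prod_ite_mem, Finset.univ_inter, Finset.prod_const, Finset.card_map,
      Fin.card_Iio]
  have hmem : ∀ i, i ∈ (Finset.Iio j).map p.toEmbedding ↔
      i ∈ Set.range p ∧ i < p j := by
    intro i
    simp only [Finset.mem_map, Finset.mem_Iio, Set.mem_range]
    constructor
    · rintro ⟨k, hk, rfl⟩
      exact ⟨⟨k, rfl⟩, p.lt_iff_lt.2 hk⟩
    · rintro ⟨⟨k, rfl⟩, hk⟩
      exact ⟨k, p.lt_iff_lt.1 hk, rfl⟩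
  rw [annihilate, occVec, occVec, tensorOp_tensorVec, ← hprod, ← tensorVec_smul]
  congr 1
  funext i
  simp only [hc, hmem]
  rcases lt_trichotomy i (p j) with h | h | h
  · by_cases hi : i ∈ Set.range p
    · rw [occupation_eq_one_iff.2 hi, occupation_eq_one_iff.2 ((hrange i).2 ⟨hi, h.ne⟩)]
      ext k
      fin_cases k <;> simp [h, hi, matS, e]
    · rw [occupation_eq_zero_iff.2 hi, occupation_eq_zero_iff.2 fun h' => hi ((hrange i).1 h').1]
      ext k
      fin_cases k <;> simp [h, hi, matS, e]
  · rw [occupation_eq_one_iff.2 ⟨j, h.symm⟩,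
      occupation_eq_zero_iff.2 fun h' => ((hrange i).1 h').2 h]
    ext k
    fin_cases k <;> simp [h, matA, e]
  · have : occupation ((Fin.succAboveOrderEmb j).trans p) i = occupation p i := by
      by_cases hi : i ∈ Set.range p
      · rw [occupation_eq_one_iff.2 hi, occupation_eq_one_iff.2 ((hrange i).2 ⟨hi, h.ne'⟩)]
      · rw [occupation_eq_zero_iff.2 hi, occupation_eq_zero_iff.2 fun h' => hi ((hrange i).1 h').1]
    rw [this]
    simp [h.not_gt, h.ne']

theorem annihilate_occVec_zero (p : Fin 0 ↪o Fin d) (a : Fin d) :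
    annihilate 𝕜 a (occVec 𝕜 p) = 0 :=
  annihilate_occVec_of_notMem fun ⟨k, _⟩ => k.elim0

theorem annihilate_occVec_succ {m : ℕ} (p : Fin (m + 1) ↪o Fin d) (a : Fin d) :
    annihilate 𝕜 a (occVec 𝕜 p) = ∑ j : Fin (m + 1), ((-1 : 𝕜) ^ (j : ℕ) * if p j = a then 1 else 0) •
      occVec 𝕜 ((Fin.succAboveOrderEmb j).trans p) := by
  by_cases h : a ∈ Set.range p
  · obtain ⟨j, rfl⟩ := h
    rw [annihilate_occVec_apply, Finset.sum_eq_single j]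
    · simp
    · intro k _ hk
      rw [if_neg fun h' => hk (p.injective h')]
      simp
    · simp
  · rw [annihilate_occVec_of_notMem h]
    refine (Finset.sum_eq_zero fun j _ => ?_).symm
    rw [if_neg fun h' => h ⟨j, h'⟩]
    simp

variable (𝕜 d) in
/-- The subspace of the binary Fock space with particle number `M`. -/
def gradedSubspace (M : ℕ) : Submodule 𝕜 (Binary 𝕜 d) :=
  Submodule.span 𝕜 (Set.range fun p : Fin M ↪o Fin d => occVec 𝕜 p)

theorem occVec_mem {M : ℕ} (p : Fin M ↪o Fin d) : occVec 𝕜 p ∈ gradedSubspace 𝕜 d M :=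
  Submodule.subset_span ⟨p, rfl⟩

theorem annihilate_eq_zero_of_mem {V : Binary 𝕜 d} (hV : V ∈ gradedSubspace 𝕜 d 0) (a : Fin d) :
    annihilate 𝕜 a V = 0 := by
  induction hV using Submodule.span_induction with
  | mem x hx => obtain ⟨p, rfl⟩ := hx; exact annihilate_occVec_zero p a
  | zero => simp
  | add x y _ _ hx hy => simp [hx, hy]
  | smul c x _ hx => simp [hx]

theorem annihilate_mem {m : ℕ} {V : Binary 𝕜 d} (hV : V ∈ gradedSubspace 𝕜 d (m + 1))
    (a : Fin d) : annihilate 𝕜 a V ∈ gradedSubspace 𝕜 d m := by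
  induction hV using Submodule.span_induction with
  | mem x hx =>
    obtain ⟨p, rfl⟩ := hx
    simp only [annihilate_occVec_succ]
    exact Submodule.sum_mem _ fun j _ => Submodule.smul_mem _ _ (occVec_mem _)
  | zero => simp
  | add x y _ _ hx hy => rw [map_add]; exact Submodule.add_mem _ hx hy
  | smul c x _ hx => rw [map_smul]; exact Submodule.smul_mem _ _ hx

theorem inner_eq_zero_of_mem_of_ne {M M' : ℕ} (h : M ≠ M') {V W : Binary 𝕜 d}
    (hV : V ∈ gradedSubspace 𝕜 d M) (hW : W ∈ gradedSubspace 𝕜 d M') : ⟪V, W⟫_𝕜 = 0 := by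
  have : gradedSubspace 𝕜 d M ⟂ gradedSubspace 𝕜 d M' := by
    rw [gradedSubspace, gradedSubspace, Submodule.isOrtho_span]
    rintro _ ⟨p, rfl⟩ _ ⟨q, rfl⟩
    exact inner_occVec_of_ne h p q
  exact (Submodule.isOrtho_iff_inner_eq.1 this) V hV W hW

end Occupation

/-! ### Antisymmetric coefficients and second quantisation -/

section Coefficients

variable {𝕜 : Type*} [RCLike 𝕜] {d : ℕ}

variable (𝕜) in
/-- The coefficient of `φ_{μ_1} ⊗ ⋯ ⊗ φ_{μ_M}` in the determinant of the functions
`φ_{p_1}, …, φ_{p_M}`. -/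
def detCoeff {M : ℕ} (p μ : Fin M → Fin d) : 𝕜 :=
  Matrix.det (Matrix.of fun i j : Fin M => if p i = μ j then (1 : 𝕜) else 0)

theorem detCoeff_eq_sum {M : ℕ} (p μ : Fin M → Fin d) :
    detCoeff 𝕜 p μ = ∑ σ : Equiv.Perm (Fin M),
      ((Equiv.Perm.sign σ : ℤ) : 𝕜) * if p ∘ σ = μ then 1 else 0 := by
  rw [detCoeff, Matrix.det_apply']
  refine Finset.sum_congr rfl fun σ _ => ?_
  simp only [Matrix.of_apply, Finset.prod_ite_zero, Finset.prod_const_one, Finset.mem_univ,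
    true_implies, funext_iff, Function.comp_apply]

/-- Summation against the coefficients of a determinant is the Leibniz formula. -/
theorem sum_detCoeff_mul {M : ℕ} (p : Fin M → Fin d) {E : Type*} [AddCommGroup E] [Module 𝕜 E]
    (F : (Fin M → Fin d) → E) :
    ∑ μ, detCoeff 𝕜 p μ • F μ =
      ∑ σ : Equiv.Perm (Fin M), ((Equiv.Perm.sign σ : ℤ) : 𝕜) • F (p ∘ σ) := by
  simp only [detCoeff_eq_sum, Finset.sum_smul]
  rw [Finset.sum_comm]
  refine Finset.sum_congr rfl fun σ _ => ?_
  rw [Finset.sum_eq_single (p ∘ σ)]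
  · simp
  · intro μ _ h
    simp [h.symm]
  · simp

theorem conj_detCoeff {M : ℕ} (p μ : Fin M → Fin d) :
    conj (detCoeff 𝕜 p μ) = detCoeff 𝕜 p μ := by
  simp [detCoeff_eq_sum, apply_ite]

theorem detCoeff_comp_perm {M : ℕ} (p μ : Fin M → Fin d) (σ : Equiv.Perm (Fin M)) :
    detCoeff 𝕜 p (μ ∘ σ) = ((Equiv.Perm.sign σ : ℤ) : 𝕜) * detCoeff 𝕜 p μ :=
  Matrix.det_permute' σ (Matrix.of fun i j : Fin M => if p i = μ j then (1 : 𝕜) else 0)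

/-- Laplace expansion along the column of the `ξ`-th coordinate. -/
theorem detCoeff_insertNth {m : ℕ} (p : Fin (m + 1) → Fin d) (ξ : Fin (m + 1)) (a : Fin d)
    (μ : Fin m → Fin d) :
    detCoeff 𝕜 p (ξ.insertNth a μ) = (-1) ^ (ξ : ℕ) * ∑ j : Fin (m + 1),
      ((-1 : 𝕜) ^ (j : ℕ) * if p j = a then 1 else 0) * detCoeff 𝕜 (p ∘ j.succAbove) μ := by
  rw [detCoeff, Matrix.det_succ_column _ ξ, Finset.mul_sum]
  refine Finset.sum_congr rfl fun j _ => ?_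
  have : (Matrix.of fun i k : Fin (m + 1) => if p i = ξ.insertNth (α := fun _ => Fin d) a μ k
      then (1 : 𝕜) else 0).submatrix j.succAbove ξ.succAbove =
      Matrix.of fun i k : Fin m => if (p ∘ j.succAbove) i = μ k then 1 else 0 := by
    ext i k
    simp
  rw [this, ← detCoeff]
  simp only [Matrix.of_apply, Fin.insertNth_apply_same, pow_add]
  ring

theorem detCoeff_orderEmb {M : ℕ} (p q : Fin M ↪o Fin d) :
    detCoeff 𝕜 q p = if p = q then 1 else 0 := by
  split_ifs with h
  · subst h
    rw [detCoeff, ← Matrix.det_one (n := Fin M) (R := 𝕜)]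
    congr 1
    ext i j
    simp [Matrix.one_apply, p.injective.eq_iff]
  · have hne : ∃ i, q i ∉ Set.range p := by
      by_contra! hcon
      apply h
      have hsub : Set.range q ⊆ Set.range p := by
        rintro _ ⟨i, rfl⟩
        exact hcon i
      refine DFunLike.coe_injective ((p.strictMono.range_inj q.strictMono).1 ?_)
      refine (Set.eq_of_subset_of_ncard_le hsub ?_).symm
      rw [Set.ncard_range_of_injective p.injective, Set.ncard_range_of_injective q.injective]
    obtain ⟨i, hi⟩ := hne
    refine Matrix.det_eq_zero_of_row_eq_zero i fun j => ?_
    rw [Matrix.of_apply, if_neg fun h' => hi ⟨j, h'.symm⟩]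

theorem sum_detCoeff_mul_detCoeff {M : ℕ} (p q : Fin M ↪o Fin d) :
    ∑ μ, detCoeff 𝕜 p μ * detCoeff 𝕜 q μ = (M.factorial : 𝕜) * if p = q then 1 else 0 := by
  have h := sum_detCoeff_mul (𝕜 := 𝕜) p (fun μ => detCoeff 𝕜 q μ)
  simp only [smul_eq_mul, detCoeff_comp_perm, detCoeff_orderEmb, ← mul_assoc] at h
  rw [h]
  have : ∀ σ : Equiv.Perm (Fin M), ((Equiv.Perm.sign σ : ℤ) : 𝕜) * ((Equiv.Perm.sign σ : ℤ) : 𝕜) = 1 := by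
    intro σ
    rw [← Int.cast_mul, ← Units.val_mul, Int.units_mul_self]
    simp
  simp only [this, Finset.sum_const, Finset.card_univ, Fintype.card_perm, Fintype.card_fin,
    nsmul_eq_mul, one_mul]

variable (𝕜 d) in
/-- The linear map that sends the basis vector of `p_1 < ⋯ < p_M` to the coefficients of the
determinant of `φ_{p_1}, …, φ_{p_M}`, and all basis vectors with another particle number to zero. -/
def coeffMap (M : ℕ) : Binary 𝕜 d →ₗ[𝕜] (Fin M → Fin d) → 𝕜 :=
  ∑ p : Fin M ↪o Fin d, (innerₛₗ 𝕜 (occVec 𝕜 p)).smulRight (detCoeff 𝕜 p)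

theorem coeffMap_occVec {M : ℕ} (p : Fin M ↪o Fin d) :
    coeffMap 𝕜 d M (occVec 𝕜 p) = detCoeff 𝕜 p := by
  simp [coeffMap, LinearMap.sum_apply, inner_occVec]

/-- On coefficients, annihilating the orbital `a` means fixing one of the coordinates to be `a`. -/
theorem coeffMap_insertNth {m : ℕ} {V : Binary 𝕜 d} (hV : V ∈ gradedSubspace 𝕜 d (m + 1))
    (ξ : Fin (m + 1)) (a : Fin d) (μ : Fin m → Fin d) :
    coeffMap 𝕜 d (m + 1) V (ξ.insertNth a μ) =
      (-1) ^ (ξ : ℕ) * coeffMap 𝕜 d m (annihilate 𝕜 a V) μ := by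
  induction hV using Submodule.span_induction with
  | mem x hx =>
    obtain ⟨p, rfl⟩ := hx
    simp only [coeffMap_occVec, annihilate_occVec_succ, map_sum, map_smul, detCoeff_insertNth,
      Finset.sum_apply, Pi.smul_apply, smul_eq_mul]
    rfl
  | zero => simp
  | add x y _ _ hx hy => simp only [map_add, Pi.add_apply, hx, hy, mul_add]
  | smul c x _ hx => simp only [map_smul, Pi.smul_apply, smul_eq_mul, hx]; ring

theorem sum_conj_coeffMap_mul {M : ℕ} {V W : Binary 𝕜 d} (hV : V ∈ gradedSubspace 𝕜 d M)
    (hW : W ∈ gradedSubspace 𝕜 d M) :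
    ∑ μ, conj (coeffMap 𝕜 d M V μ) * coeffMap 𝕜 d M W μ = (M.factorial : 𝕜) * ⟪V, W⟫_𝕜 := by
  induction hV using Submodule.span_induction with
  | mem x hx =>
    obtain ⟨p, rfl⟩ := hx
    induction hW using Submodule.span_induction with
    | mem y hy =>
      obtain ⟨q, rfl⟩ := hy
      simp only [coeffMap_occVec, conj_detCoeff, sum_detCoeff_mul_detCoeff, inner_occVec]
    | zero => simp
    | add y z _ _ hy hz =>
      simp only [map_add, Pi.add_apply, mul_add, Finset.sum_add_distrib, hy, hz, inner_add_right]
    | smul c y _ hy =>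
      simp only [map_smul, Pi.smul_apply, smul_eq_mul, mul_left_comm _ c, ← Finset.mul_sum, hy,
        inner_smul_right]
  | zero => simp
  | add y z _ _ hy hz =>
    simp only [map_add, Pi.add_apply, add_mul, mul_add, Finset.sum_add_distrib, hy, hz,
      inner_add_left]
  | smul c y _ hy =>
    simp only [map_smul, Pi.smul_apply, smul_eq_mul, map_mul, mul_assoc, ← Finset.mul_sum, hy,
      inner_smul_left, mul_left_comm _ (conj c)]

end Coefficients

section Contraction

variable {𝕜 : Type*} [RCLike 𝕜] {d : ℕ}

theorem sum_eq_sum_insertNth {m : ℕ} (ξ : Fin (m + 1)) {E : Type*} [AddCommMonoid E]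
    (F : (Fin (m + 1) → Fin d) → E) :
    ∑ μ, F μ = ∑ a, ∑ l : Fin m → Fin d, F (ξ.insertNth a l) := by
  rw [← Fintype.sum_prod_type']
  exact (Equiv.sum_comp (Fin.insertNthEquiv (fun _ : Fin (m + 1) => Fin d) ξ) F).symm

theorem prod_erase_eq_ite {m : ℕ} (ξ : Fin (m + 1)) (a b : Fin d) (l l' : Fin m → Fin d) :
    ∏ ζ ∈ Finset.univ.erase ξ, (if ξ.insertNth (α := fun _ => Fin d) a l ζ =
      ξ.insertNth (α := fun _ => Fin d) b l' ζ then (1 : 𝕜) else 0) = if l = l' then 1 else 0 := by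
  have : Finset.univ.erase ξ = Finset.univ.map ξ.succAboveEmb := by
    ext k
    simp only [Finset.mem_erase, Finset.mem_univ, and_true, Finset.mem_map, true_and,
      Fin.coe_succAboveEmb]
    exact ⟨fun h => Fin.exists_succAbove_eq h, fun ⟨j, hj⟩ => hj ▸ Fin.succAbove_ne ξ j⟩
  rw [this, Finset.prod_map]
  simp only [Fin.coe_succAboveEmb, Fin.insertNth_apply_succAbove, Finset.prod_ite_zero,
    Finset.prod_const_one, Finset.mem_univ, true_implies, funext_iff]

/-- The Kronecker deltas of a one-body term identify all coordinates of `μ` and `ν` but the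
`ξ`-th. -/
theorem one_body_contraction {m : ℕ} (c c' : (Fin (m + 1) → Fin d) → 𝕜) (ξ : Fin (m + 1))
    (h : Fin d → Fin d → 𝕜) :
    ∑ μ, ∑ ν, conj (c μ) * c' ν * (h (μ ξ) (ν ξ) *
        ∏ ζ ∈ Finset.univ.erase ξ, (if μ ζ = ν ζ then 1 else 0)) =
      ∑ a, ∑ b, h a b * ∑ l : Fin m → Fin d,
        conj (c (ξ.insertNth a l)) * c' (ξ.insertNth b l) := by
  simp only [sum_eq_sum_insertNth ξ, Fin.insertNth_apply_same, prod_erase_eq_ite]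
  refine Finset.sum_congr rfl fun a _ => ?_
  rw [Finset.sum_comm]
  refine Finset.sum_congr rfl fun b _ => ?_
  rw [Finset.mul_sum]
  refine Finset.sum_congr rfl fun l _ => ?_
  simp only [mul_ite, mul_one, mul_zero, Finset.sum_ite_eq, Finset.mem_univ, if_true]
  ring

/-- The Kronecker deltas of a two-body term identify all coordinates of `μ` and `ν` but two. -/
theorem two_body_contraction {m : ℕ} (c c' : (Fin (m + 2) → Fin d) → 𝕜) (ξ : Fin (m + 2))
    (j : Fin (m + 1)) (g : Fin d → Fin d → Fin d → Fin d → 𝕜) :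
    ∑ μ, ∑ ν, conj (c μ) * c' ν *
        (g (μ ξ) (μ (ξ.succAbove j)) (ν (ξ.succAbove j)) (ν ξ) *
          ∏ k ∈ (Finset.univ.erase ξ).erase (ξ.succAbove j), (if μ k = ν k then 1 else 0)) =
      ∑ a, ∑ b, ∑ p, ∑ q, g a b p q * ∑ l : Fin m → Fin d,
        conj (c (ξ.insertNth a (j.insertNth b l))) * c' (ξ.insertNth q (j.insertNth p l)) := by
  have hprod : ∀ (a b p q : Fin d) (l l' : Fin m → Fin d),
      ∏ k ∈ (Finset.univ.erase ξ).erase (ξ.succAbove j),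
        (if ξ.insertNth (α := fun _ => Fin d) a (j.insertNth (α := fun _ => Fin d) b l) k =
          ξ.insertNth (α := fun _ => Fin d) q (j.insertNth (α := fun _ => Fin d) p l') k
          then (1 : 𝕜) else 0) = if l = l' then 1 else 0 := by
    intro a b p q l l'
    rw [univ_erase_erase_succAbove, Finset.prod_map]
    simp only [Function.Embedding.trans_apply, Fin.coe_succAboveEmb,
      Fin.insertNth_apply_succAbove, Finset.prod_ite_zero, Finset.prod_const_one, Finset.mem_univ,
      true_implies, funext_iff]
  simp only [sum_eq_sum_insertNth ξ, sum_eq_sum_insertNth j, Fin.insertNth_apply_same,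
    Fin.insertNth_apply_succAbove, hprod]
  refine Finset.sum_congr rfl fun a _ => Finset.sum_congr rfl fun b _ => ?_
  simp only [mul_ite, mul_one, mul_zero, Finset.sum_ite_eq, Finset.mem_univ, if_true,
    Finset.mul_sum]
  rw [Finset.sum_comm_cycle]
  refine Finset.sum_congr rfl fun p _ => ?_
  rw [Finset.sum_comm]
  refine Finset.sum_congr rfl fun q _ => Finset.sum_congr rfl fun l _ => ?_
  ring

theorem neg_one_pow_mul_conj_mul (n : ℕ) (x y : 𝕜) :
    conj ((-1) ^ n * x) * ((-1) ^ n * y) = conj x * y := by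
  have : (-1 : 𝕜) ^ n * (-1) ^ n = 1 := by rw [← mul_pow]; simp
  rw [map_mul, map_pow, map_neg, map_one]
  linear_combination (conj x * y) * this

/-- The signs `(-1)^ξ` of the two Laplace expansions cancel, so each of the `M` coordinates `ξ`
contributes `(M - 1)!` times the same sum. -/
theorem sum_one_body {M : ℕ} {V W : Binary 𝕜 d} (hV : V ∈ gradedSubspace 𝕜 d M)
    (hW : W ∈ gradedSubspace 𝕜 d M) (h : Fin d → Fin d → 𝕜) :
    ∑ ξ, ∑ μ, ∑ ν, conj (coeffMap 𝕜 d M V μ) * coeffMap 𝕜 d M W ν * (h (μ ξ) (ν ξ) *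
        ∏ ζ ∈ Finset.univ.erase ξ, (if μ ζ = ν ζ then 1 else 0)) =
      (M.factorial : 𝕜) * ∑ a, ∑ b, h a b * ⟪annihilate 𝕜 a V, annihilate 𝕜 b W⟫_𝕜 := by
  obtain _ | m := M
  · simp [annihilate_eq_zero_of_mem hV]
  have key : ∀ ξ : Fin (m + 1), ∑ μ, ∑ ν, conj (coeffMap 𝕜 d (m + 1) V μ) *
      coeffMap 𝕜 d (m + 1) W ν * (h (μ ξ) (ν ξ) *
        ∏ ζ ∈ Finset.univ.erase ξ, (if μ ζ = ν ζ then 1 else 0)) =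
      (m.factorial : 𝕜) * ∑ a, ∑ b, h a b * ⟪annihilate 𝕜 a V, annihilate 𝕜 b W⟫_𝕜 := by
    intro ξ
    rw [one_body_contraction]
    simp only [coeffMap_insertNth hV, coeffMap_insertNth hW, neg_one_pow_mul_conj_mul,
      sum_conj_coeffMap_mul (annihilate_mem hV _) (annihilate_mem hW _)]
    simp only [Finset.mul_sum, mul_left_comm]
  rw [Finset.sum_congr rfl fun ξ _ => key ξ, Finset.sum_const, Finset.card_univ, Fintype.card_fin,
    nsmul_eq_mul, Nat.factorial_succ, Nat.cast_mul, mul_assoc]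

/-- The coordinate `ξ` is fixed first and `ζ` second, so `𝐚_a` and `𝐚_q` act before `𝐚_b` and `𝐚_p`:
this is the order `𝐚_a† 𝐚_b† 𝐚_p 𝐚_q` of the second quantised Hamiltonian. -/
theorem sum_two_body {M : ℕ} {V W : Binary 𝕜 d} (hV : V ∈ gradedSubspace 𝕜 d M)
    (hW : W ∈ gradedSubspace 𝕜 d M) (g : Fin d → Fin d → Fin d → Fin d → 𝕜) :
    ∑ ξ, ∑ ζ ∈ Finset.univ.erase ξ, ∑ μ, ∑ ν,
        conj (coeffMap 𝕜 d M V μ) * coeffMap 𝕜 d M W ν * (g (μ ξ) (μ ζ) (ν ζ) (ν ξ) *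
          ∏ k ∈ (Finset.univ.erase ξ).erase ζ, (if μ k = ν k then 1 else 0)) =
      (M.factorial : 𝕜) * ∑ a, ∑ b, ∑ p, ∑ q, g a b p q *
        ⟪annihilate 𝕜 b (annihilate 𝕜 a V), annihilate 𝕜 p (annihilate 𝕜 q W)⟫_𝕜 := by
  obtain _ | _ | m := M
  · simp [annihilate_eq_zero_of_mem hV]
  · simp [annihilate_eq_zero_of_mem (annihilate_mem hV _)]
  have key : ∀ (ξ : Fin (m + 2)) (j : Fin (m + 1)), ∑ μ, ∑ ν, conj (coeffMap 𝕜 d (m + 2) V μ) *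
      coeffMap 𝕜 d (m + 2) W ν *
        (g (μ ξ) (μ (ξ.succAbove j)) (ν (ξ.succAbove j)) (ν ξ) *
          ∏ k ∈ (Finset.univ.erase ξ).erase (ξ.succAbove j), (if μ k = ν k then 1 else 0)) =
      (m.factorial : 𝕜) * ∑ a, ∑ b, ∑ p, ∑ q, g a b p q *
        ⟪annihilate 𝕜 b (annihilate 𝕜 a V), annihilate 𝕜 p (annihilate 𝕜 q W)⟫_𝕜 := by
    intro ξ j
    rw [two_body_contraction]
    simp only [coeffMap_insertNth hV, coeffMap_insertNth hW,
      coeffMap_insertNth (annihilate_mem hV _), coeffMap_insertNth (annihilate_mem hW _),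
      neg_one_pow_mul_conj_mul, sum_conj_coeffMap_mul (annihilate_mem (annihilate_mem hV _) _)
        (annihilate_mem (annihilate_mem hW _) _)]
    simp only [Finset.mul_sum, mul_left_comm]
  have herase : ∀ (ξ : Fin (m + 2)) (F : Fin (m + 2) → 𝕜),
      ∑ ζ ∈ Finset.univ.erase ξ, F ζ = ∑ j, F (ξ.succAbove j) := fun ξ F => by
    have := Fin.sum_univ_succAbove F ξ
    rw [← Finset.add_sum_erase _ F (Finset.mem_univ ξ)] at this
    exact add_left_cancel this
  simp only [herase, key, Finset.sum_const, Finset.card_univ, Fintype.card_fin, nsmul_eq_mul]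
  simp only [Nat.factorial_succ, Nat.cast_mul, mul_assoc]

theorem inner_binaryHamiltonian {K : ℕ} (Z : Fin K → ℕ) (R : Fin K → Space) (φ : Fin d → OneL2 𝕜)
    (V W : Binary 𝕜 d) :
    ⟪V, binaryHamiltonian Z R φ W⟫_𝕜 =
      ∑ p, ∑ q, hCoeff Z R φ q p * ⟪annihilate 𝕜 q V, annihilate 𝕜 p W⟫_𝕜 +
      (1 / 2) * ∑ a, ∑ b, ∑ p, ∑ q, gCoeff φ a b p q *
        ⟪annihilate 𝕜 b (annihilate 𝕜 a V), annihilate 𝕜 p (annihilate 𝕜 q W)⟫_𝕜 := by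
  simp only [binaryHamiltonian, create, LinearMap.add_apply, LinearMap.smul_apply,
    LinearMap.sum_apply, LinearMap.comp_apply, inner_add_right, inner_smul_right, inner_sum,
    LinearMap.adjoint_inner_right]

/-- The Slater–Condon rules: on determinants the energy form is given by the second quantised
Hamiltonian. -/
theorem sum_productEnergy {M K : ℕ} (Z : Fin K → ℕ) (R : Fin K → Space) (φ : Fin d → OneL2 𝕜)
    {V W : Binary 𝕜 d} (hV : V ∈ gradedSubspace 𝕜 d M) (hW : W ∈ gradedSubspace 𝕜 d M) :
    ∑ μ, ∑ ν, conj (coeffMap 𝕜 d M V μ) * coeffMap 𝕜 d M W ν * productEnergy Z R φ μ ν =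
      (M.factorial : 𝕜) * ⟪V, binaryHamiltonian Z R φ W⟫_𝕜 := by
  have h1 := sum_one_body hV hW (hCoeff Z R φ)
  have h2 := sum_two_body hV hW (gCoeff φ)
  have hS : ∀ (t : Finset (Fin M)) (G : Fin M → (Fin M → Fin d) → (Fin M → Fin d) → 𝕜),
      ∑ μ, ∑ ν, conj (coeffMap 𝕜 d M V μ) * coeffMap 𝕜 d M W ν * ∑ k ∈ t, G k μ ν =
      ∑ k ∈ t, ∑ μ, ∑ ν, conj (coeffMap 𝕜 d M V μ) * coeffMap 𝕜 d M W ν * G k μ ν := by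
    intro t G
    simp only [Finset.mul_sum]
    rw [Finset.sum_comm (s := t)]
    refine Finset.sum_congr rfl fun μ _ => ?_
    rw [Finset.sum_comm]
  simp only [productEnergy, mul_add, Finset.sum_add_distrib, mul_left_comm _ (1 / 2 : 𝕜),
    ← Finset.mul_sum, hS, h1, h2]
  rw [inner_binaryHamiltonian, mul_add, Finset.sum_comm, mul_left_comm]

end Contraction

/-! ### The Full CI spaces as images of the binary Fock space -/

section SlaterMap

variable {𝕜 : Type*} [RCLike 𝕜] {d M : ℕ}

theorem orbitalSum_add (φ : Fin d → OneL2 𝕜) (c c' : (Fin M → Fin d) → 𝕜) :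
    orbitalSum φ (c + c') = orbitalSum φ c + orbitalSum φ c' := by
  simp only [orbitalSum, Pi.add_apply, add_smul, Finset.sum_add_distrib]

theorem orbitalSum_smul (φ : Fin d → OneL2 𝕜) (k : 𝕜) (c : (Fin M → Fin d) → 𝕜) :
    orbitalSum φ (k • c) = k • orbitalSum φ c := by
  simp only [orbitalSum, Pi.smul_apply, smul_eq_mul, mul_smul, Finset.smul_sum]

/-- The linear map that sends the basis vectors of the binary Fock space with particle number `M`
to the Slater determinants of the occupied orbitals, and all other basis vectors to zero. -/
def slaterMap (φ : Fin d → OneL2 𝕜) (M : ℕ) : Binary 𝕜 d →ₗ[𝕜] L2 𝕜 M where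
  toFun V := orbitalSum φ (((1 / √(M.factorial : ℝ) : ℝ) : 𝕜) • coeffMap 𝕜 d M V)
  map_add' V W := by rw [map_add, smul_add, orbitalSum_add]
  map_smul' k V := by rw [map_smul, smul_comm, orbitalSum_smul, RingHom.id_apply]

theorem slaterMap_apply (φ : Fin d → OneL2 𝕜) (V : Binary 𝕜 d) :
    slaterMap φ M V =
      orbitalSum φ (((1 / √(M.factorial : ℝ) : ℝ) : 𝕜) • coeffMap 𝕜 d M V) := rfl

theorem slaterMap_occVec (φ : Fin d → OneL2 𝕜) (p : Fin M ↪o Fin d) :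
    slaterMap φ M (occVec 𝕜 p) = slater φ p := by
  rw [slaterMap_apply, coeffMap_occVec, orbitalSum_smul, orbitalSum, sum_detCoeff_mul]
  refine Lp.ext ?_
  have h3 : ∀ᵐ x ∂configMeasure M, ∀ σ : Equiv.Perm (Fin M),
      prodL2 (fun ζ => φ ((p ∘ σ) ζ)) x = ∏ ζ, φ ((p ∘ σ) ζ) (x ζ) :=
    ae_all_iff.2 fun σ => coeFn_prodL2 _
  filter_upwards [Lp.coeFn_smul (((1 / √(M.factorial : ℝ) : ℝ) : 𝕜))
      (∑ σ : Equiv.Perm (Fin M), ((Equiv.Perm.sign σ : ℤ) : 𝕜) • prodL2 fun ζ => φ ((p ∘ σ) ζ)),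
    coeFn_sum_smul (fun σ : Equiv.Perm (Fin M) => prodL2 fun ζ => φ ((p ∘ σ) ζ))
      (fun σ => ((Equiv.Perm.sign σ : ℤ) : 𝕜)), h3,
    MemLp.coeFn_toLp (memLp_slaterFun φ p)] with x h1 h2 h3 h4
  rw [h1, Pi.smul_apply, h2, slater, h4, slaterFun, Matrix.det_apply', smul_eq_mul]
  simp only [h3]
  rfl

theorem one_div_sqrt_factorial_sq_mul (M : ℕ) :
    (((1 / √(M.factorial : ℝ) : ℝ) : 𝕜)) * ((1 / √(M.factorial : ℝ) : ℝ) : 𝕜) *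
      (M.factorial : 𝕜) = 1 := by
  have h : (1 / √(M.factorial : ℝ)) * (1 / √(M.factorial : ℝ)) * (M.factorial : ℝ) = 1 := by
    have h1 := Real.mul_self_sqrt (Nat.cast_nonneg (α := ℝ) M.factorial)
    have h2 : √(M.factorial : ℝ) ≠ 0 :=
      Real.sqrt_ne_zero'.2 (Nat.cast_pos.2 M.factorial_pos)
    field_simp
    linarith
  exact_mod_cast congrArg (fun t : ℝ => (t : 𝕜)) h

theorem inner_slaterMap {φ : Fin d → OneL2 𝕜} (hφ : Orthonormal 𝕜 φ) {V W : Binary 𝕜 d}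
    (hV : V ∈ gradedSubspace 𝕜 d M) (hW : W ∈ gradedSubspace 𝕜 d M) :
    ⟪slaterMap φ M V, slaterMap φ M W⟫_𝕜 = ⟪V, W⟫_𝕜 := by
  simp only [slaterMap_apply, orbitalSum_smul, inner_smul_left, inner_smul_right,
    inner_orbitalSum hφ, sum_conj_coeffMap_mul hV hW, RCLike.conj_ofReal]
  linear_combination ⟪V, W⟫_𝕜 * one_div_sqrt_factorial_sq_mul (𝕜 := 𝕜) M

/-- The energy of a combination of Slater determinants is the energy of its occupation numbers.
The two normalising factors `(M!)^{-1/2}` cancel the factor `M!` of the Slater–Condon rules. -/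
theorem energyForm_slaterMap {K : ℕ} (Z : Fin K → ℕ) (R : Fin K → Space) {φ : Fin d → OneL2 𝕜}
    (hφ : Orthonormal 𝕜 φ) (hH1 : ∀ p, OneMemH1 (φ p)) {V W : Binary 𝕜 d}
    (hV : V ∈ gradedSubspace 𝕜 d M) (hW : W ∈ gradedSubspace 𝕜 d M) :
    energyForm Z R (slaterMap φ M V) (slaterMap φ M W) = ⟪V, binaryHamiltonian Z R φ W⟫_𝕜 := by
  rw [slaterMap_apply, slaterMap_apply, energyForm_orbitalSum Z R hφ hH1]
  set k := ((1 / √(M.factorial : ℝ) : ℝ) : 𝕜) with hk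
  have : ∀ μ ν : Fin M → Fin d, conj ((k • coeffMap 𝕜 d M V) μ) * (k • coeffMap 𝕜 d M W) ν *
      productEnergy Z R φ μ ν = k * k * (conj (coeffMap 𝕜 d M V μ) * coeffMap 𝕜 d M W ν *
        productEnergy Z R φ μ ν) := by
    intro μ ν
    simp only [Pi.smul_apply, smul_eq_mul, map_mul, hk, RCLike.conj_ofReal]
    ring
  simp only [this, ← Finset.mul_sum, sum_productEnergy Z R φ hV hW]
  linear_combination ⟪V, binaryHamiltonian Z R φ W⟫_𝕜 * one_div_sqrt_factorial_sq_mul (𝕜 := 𝕜) M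

theorem fciSpace_eq_map (φ : Fin d → OneL2 𝕜) (M : ℕ) :
    fciSpace φ M = (gradedSubspace 𝕜 d M).map (slaterMap φ M) := by
  rw [gradedSubspace, Submodule.map_span, ← Set.range_comp, fciSpace]
  congr 2
  funext p
  exact (slaterMap_occVec φ p).symm

theorem exists_orbitalSum_eq {φ : Fin d → OneL2 𝕜} {Φ : L2 𝕜 M} (hΦ : Φ ∈ fciSpace φ M) :
    ∃ c, orbitalSum φ c = Φ := by
  rw [fciSpace_eq_map] at hΦ
  obtain ⟨V, _, rfl⟩ := hΦ
  exact ⟨_, rfl⟩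

theorem measurePreserving_comp_perm (σ : Equiv.Perm (Fin M)) :
    MeasurePreserving (fun x : Config M => x ∘ σ) (configMeasure M) (configMeasure M) := by
  have h := measurePreserving_piCongrLeft (fun _ : Fin M => siteMeasure) σ.symm
  have e : (fun x : Config M => x ∘ σ) =
      MeasurableEquiv.piCongrLeft (fun _ : Fin M => Site) σ.symm := by
    funext x i
    rw [MeasurableEquiv.coe_piCongrLeft]
    conv_rhs => rw [← σ.symm_apply_apply i]
    rw [Equiv.piCongrLeft_apply_apply]
    rfl
  rw [e]
  exact h

theorem antisymmetric_of_mem_fciSpace {φ : Fin d → OneL2 𝕜} {Φ : L2 𝕜 M}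
    (hΦ : Φ ∈ fciSpace φ M) (σ : Equiv.Perm (Fin M)) :
    (fun x : Config M => Φ (x ∘ σ)) =ᵐ[configMeasure M]
      fun x => ((Equiv.Perm.sign σ : ℤ) : 𝕜) * Φ x := by
  have hq := (measurePreserving_comp_perm σ).quasiMeasurePreserving
  induction hΦ using Submodule.span_induction with
  | mem x hx =>
    obtain ⟨p, rfl⟩ := hx
    have h := MemLp.coeFn_toLp (memLp_slaterFun φ p)
    filter_upwards [h, hq.ae_eq_comp h] with x h1 h2
    simp only [Function.comp_apply] at h2
    simp only [slater, h1, h2, slaterFun]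
    have := Matrix.det_permute' σ (Matrix.of fun ξ ζ : Fin M => φ (p ξ) (x ζ))
    rw [mul_left_comm, ← this]
    rfl
  | zero =>
    filter_upwards [Lp.coeFn_zero 𝕜 2 (configMeasure M),
      hq.ae_eq_comp (Lp.coeFn_zero 𝕜 2 (configMeasure M))] with x h1 h2
    simp only [Function.comp_apply] at h2
    rw [h1, h2]
    simp
  | add f g _ _ hf hg =>
    filter_upwards [Lp.coeFn_add f g, hq.ae_eq_comp (Lp.coeFn_add f g), hf, hg] with x h1 h2 h3 h4
    simp only [Function.comp_apply] at h2
    rw [h1, h2, Pi.add_apply, Pi.add_apply, h3, h4, mul_add]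
  | smul c f _ hf =>
    filter_upwards [Lp.coeFn_smul c f, hq.ae_eq_comp (Lp.coeFn_smul c f), hf] with x h1 h2 h3
    simp only [Function.comp_apply] at h2
    rw [h1, h2, Pi.smul_apply, Pi.smul_apply, h3, smul_eq_mul, smul_eq_mul, mul_left_comm]

theorem fciSpace_subset_energySpace {φ : Fin d → OneL2 𝕜} (hH1 : ∀ p, OneMemH1 (φ p)) (M : ℕ) :
    (fciSpace φ M : Set (L2 𝕜 M)) ⊆ energySpace 𝕜 M := by
  intro Φ hΦ
  refine ⟨antisymmetric_of_mem_fciSpace hΦ, fun ξ i => ?_⟩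
  obtain ⟨c, rfl⟩ := exists_orbitalSum_eq hΦ
  exact ⟨_, hasWeakDeriv_orbitalSum hH1 c ξ i⟩

theorem energyForm_conj_symm {K : ℕ} (Z : Fin K → ℕ) (R : Fin K → Space) (Φ Ψ : L2 𝕜 M) :
    conj (energyForm Z R Φ Ψ) = energyForm Z R Ψ Φ := by
  have h1 : ∀ ξ, conj (∫ x, nuclearIntegrand Z R ξ Φ Ψ x ∂configMeasure M) =
      ∫ x, nuclearIntegrand Z R ξ Ψ Φ x ∂configMeasure M := fun ξ => by
    rw [← integral_conj]
    congr 1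
    funext x
    simp only [nuclearIntegrand, map_mul, RCLike.conj_conj, RCLike.conj_ofReal]
    ring
  have h2 : ∀ ξ ζ, conj (∫ x, repulsionIntegrand ξ ζ Φ Ψ x ∂configMeasure M) =
      ∫ x, repulsionIntegrand ξ ζ Ψ Φ x ∂configMeasure M := fun ξ ζ => by
    rw [← integral_conj]
    congr 1
    funext x
    simp only [repulsionIntegrand, map_mul, RCLike.conj_conj, RCLike.conj_ofReal]
    ring
  have h3 : conj (1 / 2 : 𝕜) = 1 / 2 := by
    rw [map_div₀, map_one, RCLike.conj_ofNat]
  simp only [energyForm, map_add, map_mul, map_sum, h1, h2, h3, inner_conj_symm]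

end SlaterMap

section Operators

variable {𝕜 : Type*} [RCLike 𝕜] {d : ℕ}

theorem inner_annihilate_eq_zero {M M' : ℕ} (h : M ≠ M') {V W : Binary 𝕜 d}
    (hV : V ∈ gradedSubspace 𝕜 d M) (hW : W ∈ gradedSubspace 𝕜 d M') (a b : Fin d) :
    ⟪annihilate 𝕜 a V, annihilate 𝕜 b W⟫_𝕜 = 0 := by
  obtain _ | m := M
  · rw [annihilate_eq_zero_of_mem hV, inner_zero_left]
  obtain _ | m' := M'
  · rw [annihilate_eq_zero_of_mem hW, inner_zero_right]
  exact inner_eq_zero_of_mem_of_ne (fun h' => h (congrArg Nat.succ h')) (annihilate_mem hV a)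
    (annihilate_mem hW b)

theorem inner_binaryHamiltonian_eq_zero {K : ℕ} (Z : Fin K → ℕ) (R : Fin K → Space)
    (φ : Fin d → OneL2 𝕜) {M M' : ℕ} (h : M ≠ M') {V W : Binary 𝕜 d}
    (hV : V ∈ gradedSubspace 𝕜 d M) (hW : W ∈ gradedSubspace 𝕜 d M') :
    ⟪V, binaryHamiltonian Z R φ W⟫_𝕜 = 0 := by
  have h2 : ∀ a b p q : Fin d,
      ⟪annihilate 𝕜 b (annihilate 𝕜 a V), annihilate 𝕜 p (annihilate 𝕜 q W)⟫_𝕜 = 0 := by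
    intro a b p q
    obtain _ | m := M
    · rw [annihilate_eq_zero_of_mem hV, map_zero, inner_zero_left]
    obtain _ | m' := M'
    · rw [annihilate_eq_zero_of_mem hW, map_zero, inner_zero_right]
    exact inner_annihilate_eq_zero (fun h' => h (congrArg Nat.succ h')) (annihilate_mem hV a)
      (annihilate_mem hW q) b p
  simp [inner_binaryHamiltonian, inner_annihilate_eq_zero h hV hW, h2]

theorem adjoint_tensorOp (B : Fin d → Matrix (Fin 2) (Fin 2) 𝕜) :
    LinearMap.adjoint (tensorOp B) = tensorOp fun i => (B i).conjTranspose := by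
  rw [tensorOp, ← Matrix.toEuclideanLin_conjTranspose_eq_adjoint, tensorOp]
  congr 1
  ext μ ν
  simp [Matrix.conjTranspose_apply]

/-- `𝐚_a† 𝐚_a` is diagonal and reads off the occupation number of the orbital `a`. -/
theorem create_annihilate_occVec {M : ℕ} (p : Fin M ↪o Fin d) (a : Fin d) :
    create 𝕜 a (annihilate 𝕜 a (occVec 𝕜 p)) =
      (if occupation p a = 1 then (1 : 𝕜) else 0) • occVec 𝕜 p := by
  have hprod : ∏ i, (if i = a then (if occupation p i = 1 then (1 : 𝕜) else 0) else 1) =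
      if occupation p a = 1 then (1 : 𝕜) else 0 := by
    rw [Finset.prod_ite_eq' Finset.univ a, if_pos (Finset.mem_univ a)]
  rw [create, annihilate, adjoint_tensorOp, occVec, tensorOp_tensorVec, tensorOp_tensorVec,
    ← hprod, ← tensorVec_smul]
  congr 1
  funext i
  generalize occupation p i = k
  rcases lt_trichotomy i a with h | h | h
  · ext l
    fin_cases k <;> fin_cases l <;> simp [h, h.ne, matS, e, Matrix.mulVec, dotProduct]
  · ext l
    fin_cases k <;> fin_cases l <;> simp [h, matA, e, Matrix.mulVec, dotProduct]
  · simp [h.not_gt, h.ne']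

theorem binaryNumber_apply_of_mem {M : ℕ} {V : Binary 𝕜 d} (hV : V ∈ gradedSubspace 𝕜 d M) :
    binaryNumber 𝕜 d V = (M : 𝕜) • V := by
  induction hV using Submodule.span_induction with
  | mem x hx =>
    obtain ⟨p, rfl⟩ := hx
    have hcard : Finset.univ.filter (fun a => occupation p a = 1) =
        Finset.univ.map p.toEmbedding := by
      ext a
      simp [occupation_eq_one_iff]
    simp only [binaryNumber, LinearMap.sum_apply, LinearMap.comp_apply, create_annihilate_occVec,
      ← Finset.sum_smul, Finset.sum_boole, hcard, Finset.card_map, Finset.card_univ,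
      Fintype.card_fin]
  | zero => simp
  | add x y _ _ hx hy => rw [map_add, hx, hy, smul_add]
  | smul c x _ hx => rw [map_smul, hx, smul_comm]

end Operators

/-! ### The isometry of the Fock space -/

section Isometry

variable {𝕜 : Type*} [RCLike 𝕜] {d : ℕ}

/-- Occupation numbers identify the increasing tuples of orbitals of all lengths with the
configurations of `d` binary digits. -/
def occupationEquiv (d : ℕ) : (Σ M : Fin (d + 1), Fin (M : ℕ) ↪o Fin d) ≃ (Fin d → Fin 2) :=
  Equiv.ofBijective (fun x => occupation x.2) <| by
    constructor
    · rintro ⟨M, p⟩ ⟨M', q⟩ h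
      obtain rfl : M = M' := Fin.ext (card_eq_of_occupation_eq h)
      change occupation p = occupation q at h
      obtain rfl : p = q := eq_of_occupation_eq h
      rfl
    · intro ν
      -- the tuple lists the occupied orbitals in increasing order
      set S : Finset (Fin d) := Finset.univ.filter fun i => ν i = 1 with hS
      have hcard : S.card < d + 1 :=
        Nat.lt_succ_of_le ((Finset.card_le_univ S).trans_eq (Fintype.card_fin d))
      refine ⟨⟨⟨S.card, hcard⟩, S.orderEmbOfFin rfl⟩, ?_⟩
      funext i
      have hr : i ∈ Set.range (S.orderEmbOfFin rfl) ↔ ν i = 1 := by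
        rw [Finset.range_orderEmbOfFin]
        simp [hS]
      by_cases hi : ν i = 1
      · exact (occupation_eq_one_iff.2 (hr.2 hi)).trans hi.symm
      · refine (occupation_eq_zero_iff.2 fun h => hi (hr.1 h)).trans ?_
        omega

variable (φ : Fin d → OneL2 𝕜)

/-- The inclusion of `𝒱^d_M` in the Fock space as a linear map. -/
def Fock.inclₗ (M : Fin (d + 1)) : fciSpace φ (M : ℕ) →ₗ[𝕜] Fock φ where
  toFun := Fock.incl φ M
  map_add' Φ Ψ := by simp only [Fock.incl, Pi.single_add]; rfl
  map_smul' c Φ := by simp only [Fock.incl, Pi.single_smul]; rfl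

theorem Fock.inclₗ_apply (M : Fin (d + 1)) (Φ : fciSpace φ (M : ℕ)) :
    Fock.inclₗ φ M Φ = Fock.incl φ M Φ := rfl

theorem Fock.incl_apply (M M' : Fin (d + 1)) (Φ : fciSpace φ (M : ℕ)) :
    Fock.incl φ M Φ M' = Pi.single (M := fun M : Fin (d + 1) => fciSpace φ (M : ℕ)) M Φ M' := rfl

theorem Fock.incl_apply_self (M : Fin (d + 1)) (Φ : fciSpace φ (M : ℕ)) :
    Fock.incl φ M Φ M = Φ := by
  rw [Fock.incl_apply, Pi.single_eq_same]

theorem Fock.incl_apply_of_ne {M M' : Fin (d + 1)} (h : M' ≠ M) (Φ : fciSpace φ (M : ℕ)) :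
    Fock.incl φ M Φ M' = 0 := by
  rw [Fock.incl_apply, Pi.single_eq_of_ne h]

theorem Fock.inner_incl_left (M : Fin (d + 1)) (Φ : fciSpace φ (M : ℕ)) (X : Fock φ) :
    ⟪Fock.incl φ M Φ, X⟫_𝕜 = ⟪Φ, X M⟫_𝕜 := by
  rw [PiLp.inner_apply, Finset.sum_eq_single M]
  · rw [Fock.incl_apply_self]
  · intro M' _ h
    rw [Fock.incl_apply_of_ne φ h, inner_zero_left]
  · simp

theorem Fock.sum_incl (X : Fock φ) : ∑ M, Fock.incl φ M (X M) = X := by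
  ext1 M
  rw [WithLp.ofLp_sum, Finset.sum_apply, Finset.sum_eq_single M]
  · exact Fock.incl_apply_self φ M _
  · intro M' _ h
    exact Fock.incl_apply_of_ne φ h.symm _
  · simp

theorem Fock.hom_ext {F : Type*} [AddCommGroup F] [Module 𝕜 F] {f g : Fock φ →ₗ[𝕜] F}
    (h : ∀ M Φ, f (Fock.incl φ M Φ) = g (Fock.incl φ M Φ)) : f = g := by
  ext1 X
  rw [← Fock.sum_incl φ X, map_sum, map_sum]
  exact Finset.sum_congr rfl fun M _ => h M _

theorem Fock.blockDiag_incl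
    (T : ∀ M : Fin (d + 1), fciSpace φ (M : ℕ) →ₗ[𝕜] fciSpace φ (M : ℕ)) (M : Fin (d + 1))
    (Φ : fciSpace φ (M : ℕ)) :
    Fock.blockDiag φ T (Fock.incl φ M Φ) = Fock.incl φ M (T M Φ) := by
  ext1 M'
  change T M' (Fock.incl φ M Φ M') = Fock.incl φ M (T M Φ) M'
  obtain rfl | h := eq_or_ne M' M
  · rw [Fock.incl_apply_self, Fock.incl_apply_self]
  · rw [Fock.incl_apply_of_ne φ h, Fock.incl_apply_of_ne φ h, map_zero]

theorem Fock.number_incl (M : Fin (d + 1)) (Φ : fciSpace φ (M : ℕ)) :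
    Fock.number φ (Fock.incl φ M Φ) = ((M : ℕ) : 𝕜) • Fock.incl φ M Φ := by
  rw [Fock.number, Fock.blockDiag_incl, ← Fock.inclₗ_apply, ← Fock.inclₗ_apply, ← map_smul]
  rfl

theorem span_slaterFCI (M : ℕ) :
    Submodule.span 𝕜 (Set.range fun p : Fin M ↪o Fin d => slaterFCI φ p) = ⊤ := by
  have h := Submodule.span_span_coe_preimage (R := 𝕜)
    (s := Set.range fun p : Fin M ↪o Fin d => slater φ p)
  have h' : (Subtype.val : Submodule.span 𝕜 (Set.range fun p : Fin M ↪o Fin d => slater φ p) → _) ⁻¹'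
      (Set.range fun p : Fin M ↪o Fin d => slater φ p) =
        Set.range fun p : Fin M ↪o Fin d => slaterFCI φ p := by
    ext x
    constructor
    · rintro ⟨p, hp⟩
      exact ⟨p, Subtype.ext hp⟩
    · rintro ⟨p, rfl⟩
      exact ⟨p, rfl⟩
  rw [h'] at h
  exact h

variable {φ}

theorem inner_slaterFCI (hφ : Orthonormal 𝕜 φ) {M : ℕ} (p q : Fin M ↪o Fin d) :
    ⟪slaterFCI φ p, slaterFCI φ q⟫_𝕜 = if p = q then 1 else 0 := by
  change ⟪slater φ p, slater φ q⟫_𝕜 = _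
  rw [← slaterMap_occVec, ← slaterMap_occVec,
    inner_slaterMap hφ (occVec_mem p) (occVec_mem q), inner_occVec]

/-- The Slater determinants form an orthonormal basis of the Fock space. -/
def Fock.basis (hφ : Orthonormal 𝕜 φ) :
    OrthonormalBasis (Σ M : Fin (d + 1), Fin (M : ℕ) ↪o Fin d) 𝕜 (Fock φ) :=
  OrthonormalBasis.mk (v := fun x => Fock.incl φ x.1 (slaterFCI φ x.2))
    (by
      classical
      rw [orthonormal_iff_ite]
      rintro ⟨M, p⟩ ⟨M', q⟩
      rw [Fock.inner_incl_left]
      obtain rfl | h := eq_or_ne M M'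
      · rw [Fock.incl_apply_self, inner_slaterFCI hφ]
        simp
      · rw [Fock.incl_apply_of_ne φ h, inner_zero_right, if_neg fun h' => h (congrArg Sigma.fst h')])
    (by
      intro X _
      rw [← Fock.sum_incl φ X]
      refine Submodule.sum_mem _ fun M _ => ?_
      have h : X M ∈ Submodule.span 𝕜 (Set.range fun p : Fin (M : ℕ) ↪o Fin d => slaterFCI φ p) := by
        rw [span_slaterFCI]; trivial
      have h' := Submodule.mem_map_of_mem (f := Fock.inclₗ φ M) h
      rw [Submodule.map_span, ← Set.range_comp] at h'
      refine Submodule.span_mono ?_ h'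
      rintro _ ⟨p, rfl⟩
      exact ⟨⟨M, p⟩, rfl⟩)

/-- The isometry `ι` of the Fock space onto the binary Fock space: it maps the basis of Slater
determinants to the canonical basis according to the occupation numbers. -/
def fockIso (hφ : Orthonormal 𝕜 φ) : Fock φ ≃ₗᵢ[𝕜] Binary 𝕜 d :=
  (Fock.basis hφ).equiv (EuclideanSpace.basisFun _ 𝕜) (occupationEquiv d)

theorem fockIso_incl_slaterFCI (hφ : Orthonormal 𝕜 φ) (M : Fin (d + 1))
    (p : Fin (M : ℕ) ↪o Fin d) : fockIso hφ (Fock.incl φ M (slaterFCI φ p)) = occVec 𝕜 p := by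
  have h : Fock.incl φ M (slaterFCI φ p) = Fock.basis hφ ⟨M, p⟩ := by
    rw [Fock.basis, OrthonormalBasis.coe_mk]
  rw [h, fockIso, OrthonormalBasis.equiv_apply_basis, EuclideanSpace.basisFun_apply,
    occVec_eq_single]
  rfl

theorem fockIso_incl_mem_and (hφ : Orthonormal 𝕜 φ) (M : Fin (d + 1)) (Φ : fciSpace φ (M : ℕ)) :
    fockIso hφ (Fock.incl φ M Φ) ∈ gradedSubspace 𝕜 d M ∧
      slaterMap φ M (fockIso hφ (Fock.incl φ M Φ)) = Φ := by
  have hΦ : Φ ∈ Submodule.span 𝕜 (Set.range fun p : Fin (M : ℕ) ↪o Fin d => slaterFCI φ p) := by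
    rw [span_slaterFCI]; trivial
  rw [← Fock.inclₗ_apply]
  induction hΦ using Submodule.span_induction with
  | mem x hx =>
    obtain ⟨p, rfl⟩ := hx
    rw [Fock.inclₗ_apply, fockIso_incl_slaterFCI, slaterMap_occVec]
    exact ⟨occVec_mem p, rfl⟩
  | zero => simp
  | add x y _ _ hx hy =>
    simp only [map_add, hx.2, hy.2]
    exact ⟨Submodule.add_mem _ hx.1 hy.1, rfl⟩
  | smul c x _ hx =>
    simp only [map_smul, hx.2]
    exact ⟨Submodule.smul_mem _ _ hx.1, rfl⟩

theorem fockIso_incl_mem (hφ : Orthonormal 𝕜 φ) (M : Fin (d + 1)) (Φ : fciSpace φ (M : ℕ)) :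
    fockIso hφ (Fock.incl φ M Φ) ∈ gradedSubspace 𝕜 d M := (fockIso_incl_mem_and hφ M Φ).1

/-- On `𝒱^d_M` the isometry `ι` is inverted by `slaterMap`. -/
theorem slaterMap_fockIso_incl (hφ : Orthonormal 𝕜 φ) (M : Fin (d + 1))
    (Φ : fciSpace φ (M : ℕ)) : slaterMap φ M (fockIso hφ (Fock.incl φ M Φ)) = Φ :=
  (fockIso_incl_mem_and hφ M Φ).2

theorem energyForm_eq_inner_fockIso {K : ℕ} (Z : Fin K → ℕ) (R : Fin K → Space)
    (hφ : Orthonormal 𝕜 φ) (hH1 : ∀ p, OneMemH1 (φ p)) (M : Fin (d + 1))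
    (Φ Ψ : fciSpace φ (M : ℕ)) :
    energyForm Z R (Φ : L2 𝕜 M) (Ψ : L2 𝕜 M) =
      ⟪fockIso hφ (Fock.incl φ M Φ), binaryHamiltonian Z R φ (fockIso hφ (Fock.incl φ M Ψ))⟫_𝕜 := by
  conv_lhs => rw [← slaterMap_fockIso_incl hφ M Φ, ← slaterMap_fockIso_incl hφ M Ψ]
  exact energyForm_slaterMap Z R hφ hH1 (fockIso_incl_mem hφ M Φ) (fockIso_incl_mem hφ M Ψ)

/-- The Galerkin projection of the electronic Hamiltonian on `𝒱^d_M`: the diagonal block of the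
second quantised Hamiltonian. -/
def galerkin {K : ℕ} (Z : Fin K → ℕ) (R : Fin K → Space) (hφ : Orthonormal 𝕜 φ)
    (M : Fin (d + 1)) : fciSpace φ (M : ℕ) →ₗ[𝕜] fciSpace φ (M : ℕ) where
  toFun Ψ := (fockIso hφ).symm (binaryHamiltonian Z R φ (fockIso hφ (Fock.inclₗ φ M Ψ))) M
  map_add' Φ Ψ := by simp only [map_add]; rfl
  map_smul' c Φ := by simp only [map_smul]; rfl

theorem galerkin_apply {K : ℕ} (Z : Fin K → ℕ) (R : Fin K → Space) (hφ : Orthonormal 𝕜 φ)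
    (M : Fin (d + 1)) (Ψ : fciSpace φ (M : ℕ)) : galerkin Z R hφ M Ψ =
      (fockIso hφ).symm (binaryHamiltonian Z R φ (fockIso hφ (Fock.incl φ M Ψ))) M := rfl

theorem inner_fockIso_symm_apply (hφ : Orthonormal 𝕜 φ) (M : Fin (d + 1))
    (Φ : fciSpace φ (M : ℕ)) (V : Binary 𝕜 d) :
    ⟪Φ, (fockIso hφ).symm V M⟫_𝕜 = ⟪fockIso hφ (Fock.incl φ M Φ), V⟫_𝕜 := by
  rw [← Fock.inner_incl_left, ← (fockIso hφ).inner_map_map, (fockIso hφ).apply_symm_apply]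

theorem isGalerkinHamiltonian_galerkin {K : ℕ} (Z : Fin K → ℕ) (R : Fin K → Space)
    (hφ : Orthonormal 𝕜 φ) (hH1 : ∀ p, OneMemH1 (φ p)) (M : Fin (d + 1)) :
    IsGalerkinHamiltonian Z R φ (M : ℕ) (galerkin Z R hφ M) := by
  intro Φ Ψ
  rw [galerkin_apply, inner_fockIso_symm_apply, energyForm_eq_inner_fockIso Z R hφ hH1]

/-- The second quantised Hamiltonian preserves the particle number, so it is the direct sum of its
diagonal blocks. -/
theorem blockDiag_galerkin_incl {K : ℕ} (Z : Fin K → ℕ) (R : Fin K → Space)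
    (hφ : Orthonormal 𝕜 φ) (M : Fin (d + 1)) (Ψ : fciSpace φ (M : ℕ)) :
    fockIso hφ (Fock.blockDiag φ (galerkin Z R hφ) (Fock.incl φ M Ψ)) =
      binaryHamiltonian Z R φ (fockIso hφ (Fock.incl φ M Ψ)) := by
  rw [← (fockIso hφ).symm.injective.eq_iff, (fockIso hφ).symm_apply_apply, Fock.blockDiag_incl]
  ext1 M'
  obtain rfl | h := eq_or_ne M' M
  · exact Fock.incl_apply_self φ M' _
  · refine (Fock.incl_apply_of_ne φ h _).trans (ext_inner_left 𝕜 fun Φ => ?_)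
    refine (inner_zero_right Φ).trans (Eq.trans ?_ (inner_fockIso_symm_apply hφ M' Φ _).symm)
    exact (inner_binaryHamiltonian_eq_zero Z R φ (fun h' => h (Fin.ext h'))
      (fockIso_incl_mem hφ M' Φ) (fockIso_incl_mem hφ M Ψ)).symm

/-- An identity of conjugated operators may be checked on each summand `𝒱^d_M`. -/
theorem fockIso_conj_eq (hφ : Orthonormal 𝕜 φ) {A : Fock φ →ₗ[𝕜] Fock φ}
    {B : Binary 𝕜 d →ₗ[𝕜] Binary 𝕜 d}
    (h : ∀ M Ψ, fockIso hφ (A (Fock.incl φ M Ψ)) = B (fockIso hφ (Fock.incl φ M Ψ))) :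
    (fockIso hφ).toLinearMap ∘ₗ A ∘ₗ (fockIso hφ).symm.toLinearMap = B := by
  have h' : (fockIso hφ).toLinearMap ∘ₗ A = B ∘ₗ (fockIso hφ).toLinearMap :=
    Fock.hom_ext φ h
  ext1 V
  have := LinearMap.congr_fun h' ((fockIso hφ).symm V)
  simpa using this

theorem fockIso_conj_number (hφ : Orthonormal 𝕜 φ) :
    (fockIso hφ).toLinearMap ∘ₗ Fock.number φ ∘ₗ (fockIso hφ).symm.toLinearMap =
      binaryNumber 𝕜 d :=
  fockIso_conj_eq hφ fun M Ψ => by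
    rw [Fock.number_incl, map_smul, binaryNumber_apply_of_mem (fockIso_incl_mem hφ M Ψ)]

theorem binaryNumber_eq_smul_iff (hφ : Orthonormal 𝕜 φ) (N : Fin (d + 1)) (V : Binary 𝕜 d) :
    binaryNumber 𝕜 d V = ((N : ℕ) : 𝕜) • V ↔
      ∃ Ψ : fciSpace φ (N : ℕ), fockIso hφ (Fock.incl φ N Ψ) = V := by
  constructor
  · intro h
    set X := (fockIso hφ).symm V with hX
    have hV : fockIso hφ X = V := by rw [hX, (fockIso hφ).apply_symm_apply]
    have h1 : Fock.number φ X = ((N : ℕ) : 𝕜) • X := by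
      apply (fockIso hφ).injective
      rw [map_smul, hV, ← h, ← fockIso_conj_number hφ]
      rfl
    have h2 : ∀ M : Fin (d + 1), M ≠ N → X M = 0 := by
      intro M hM
      have h3 : ((M : ℕ) : 𝕜) • X M = ((N : ℕ) : 𝕜) • X M := congrArg (fun Y : Fock φ => Y M) h1
      rw [← sub_eq_zero, ← sub_smul] at h3
      refine (smul_eq_zero.1 h3).resolve_left fun h' => hM (Fin.ext ?_)
      exact_mod_cast sub_eq_zero.1 h'
    refine ⟨X N, ?_⟩
    rw [← hV]
    congr 1
    ext1 M
    obtain rfl | hM := eq_or_ne M N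
    · exact Fock.incl_apply_self φ M _
    · exact (Fock.incl_apply_of_ne φ hM _).trans (h2 M hM).symm
  · rintro ⟨Ψ, rfl⟩
    exact binaryNumber_apply_of_mem (fockIso_incl_mem hφ N Ψ)

end Isometry

/-! ### Ground states -/

section Rayleigh

variable {𝕜 E : Type*} [RCLike 𝕜] [NormedAddCommGroup E] [InnerProductSpace 𝕜 E]
  [FiniteDimensional 𝕜 E]

theorem inner_self_eq_one_iff_norm {F : Type*} [NormedAddCommGroup F] [InnerProductSpace 𝕜 F]
    {x : F} : ⟪x, x⟫_𝕜 = 1 ↔ ‖x‖ = 1 := by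
  rw [inner_self_eq_norm_sq_to_K]
  norm_cast
  exact pow_eq_one_iff_of_nonneg (norm_nonneg x) two_ne_zero

theorem exists_unit_minimizer (T : E →ₗ[𝕜] E) {x₀ : E} (hx₀ : ⟪x₀, x₀⟫_𝕜 = 1) :
    ∃ x : E, ⟪x, x⟫_𝕜 = 1 ∧
      ∀ y, ⟪y, y⟫_𝕜 = 1 → RCLike.re ⟪x, T x⟫_𝕜 ≤ RCLike.re ⟪y, T y⟫_𝕜 := by
  have := FiniteDimensional.proper_rclike 𝕜 E
  have hT : Continuous T := T.continuous_of_finiteDimensional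
  obtain ⟨x, hx, hmin⟩ := (isCompact_sphere (0 : E) 1).exists_isMinOn
    (f := fun x => RCLike.re ⟪x, T x⟫_𝕜) ⟨x₀, by simpa using inner_self_eq_one_iff_norm.1 hx₀⟩
    (RCLike.continuous_re.comp (continuous_id.inner hT)).continuousOn
  refine ⟨x, inner_self_eq_one_iff_norm.2 (by simpa using hx), fun y hy => hmin ?_⟩
  simpa using inner_self_eq_one_iff_norm.1 hy

/-- A minimiser of a symmetric quadratic form on the unit sphere is an eigenvector. -/
theorem exists_eigenvalue_of_unit_minimizer {T : E →ₗ[𝕜] E} (hT : T.IsSymmetric) {x : E}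
    (hx : ⟪x, x⟫_𝕜 = 1)
    (hmin : ∀ y, ⟪y, y⟫_𝕜 = 1 → RCLike.re ⟪x, T x⟫_𝕜 ≤ RCLike.re ⟪y, T y⟫_𝕜) :
    ∃ m : ℝ, T x = (m : 𝕜) • x := by
  have := FiniteDimensional.complete 𝕜 E
  have hx1 := inner_self_eq_one_iff_norm.1 hx
  have h : IsMinOn hT.toSelfAdjoint.val.reApplyInnerSelf (Metric.sphere (0 : E) ‖x‖) x := by
    intro y hy
    rw [hx1, mem_sphere_zero_iff_norm] at hy
    have := hmin y (inner_self_eq_one_iff_norm.2 hy)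
    rw [inner_re_symm, inner_re_symm y] at this
    exact this
  have h0 : x ≠ 0 := by
    rintro rfl
    simp at hx1
  exact ⟨_, (hT.toSelfAdjoint.prop.hasEigenvector_of_isMinOn h0 h).apply_eq_smul⟩

end Rayleigh

section GroundState

variable {𝕜 : Type*} [RCLike 𝕜] {d K : ℕ} (Z : Fin K → ℕ) (R : Fin K → Space)
  {φ : Fin d → OneL2 𝕜}

instance finiteDimensional_fciSpace (φ : Fin d → OneL2 𝕜) (M : ℕ) :
    FiniteDimensional 𝕜 (fciSpace φ M) :=
  FiniteDimensional.span_of_finite 𝕜 (Set.finite_range _)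

theorem isSymmetric_of_isGalerkinHamiltonian {M : ℕ} {T : fciSpace φ M →ₗ[𝕜] fciSpace φ M}
    (hT : IsGalerkinHamiltonian Z R φ M T) : T.IsSymmetric := by
  intro Φ Ψ
  rw [← inner_conj_symm, hT, hT, energyForm_conj_symm]

theorem exists_isRitzGroundState {M : ℕ} {T : fciSpace φ M →ₗ[𝕜] fciSpace φ M}
    (hT : IsGalerkinHamiltonian Z R φ M T) (hφ : Orthonormal 𝕜 φ) (hM : M ≤ d) :
    ∃ Ψ, IsRitzGroundState Z R φ M Ψ := by
  have h : ⟪slaterFCI φ (Fin.castLEOrderEmb hM), slaterFCI φ (Fin.castLEOrderEmb hM)⟫_𝕜 = 1 := by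
    rw [inner_slaterFCI hφ, if_pos rfl]
  obtain ⟨Ψ, h1, h2⟩ := exists_unit_minimizer T h
  simp only [hT _ _] at h2
  exact ⟨Ψ, h1, h2⟩

theorem solvesSchroedinger_iff {M : ℕ} {T : fciSpace φ M →ₗ[𝕜] fciSpace φ M}
    (hT : IsGalerkinHamiltonian Z R φ M T) {E : ℝ} {Ψ : fciSpace φ M} :
    SolvesSchroedinger Z R φ M E Ψ ↔ Ψ ≠ 0 ∧ T Ψ = (E : 𝕜) • Ψ := by
  refine and_congr_right fun _ => ⟨fun h => ext_inner_left 𝕜 fun Φ => ?_, fun h Φ => ?_⟩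
  · rw [hT, h]
    exact (inner_smul_right Φ Ψ (E : 𝕜)).symm
  · rw [← hT, h]
    exact inner_smul_right Φ Ψ (E : 𝕜)

theorem re_energyForm_of_solvesSchroedinger {M : ℕ} {E : ℝ} {Ψ : fciSpace φ M}
    (h : SolvesSchroedinger Z R φ M E Ψ) (h1 : ⟪Ψ, Ψ⟫_𝕜 = 1) :
    RCLike.re (energyForm Z R (Ψ : L2 𝕜 M) (Ψ : L2 𝕜 M)) = E := by
  rw [h.2, h1, mul_one, RCLike.ofReal_re]

theorem ne_zero_of_inner_self_eq_one {M : ℕ} {Ψ : fciSpace φ M} (h : ⟪Ψ, Ψ⟫_𝕜 = 1) : Ψ ≠ 0 := by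
  rintro rfl
  simp at h

/-- A minimiser of the energy is an eigenfunction, and its energy
bounds every eigenvalue from below because normalised eigenfunctions compete. -/
theorem exists_isLeast_of_isRitzGroundState {M : ℕ} {T : fciSpace φ M →ₗ[𝕜] fciSpace φ M}
    (hT : IsGalerkinHamiltonian Z R φ M T) {Ψ : fciSpace φ M}
    (h : IsRitzGroundState Z R φ M Ψ) :
    ∃ E : ℝ, IsLeast {E' : ℝ | ∃ Φ, SolvesSchroedinger Z R φ M E' Φ} E ∧
      SolvesSchroedinger Z R φ M E Ψ := by
  obtain ⟨h1, hmin⟩ := h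
  obtain ⟨E, hE⟩ := exists_eigenvalue_of_unit_minimizer
    (isSymmetric_of_isGalerkinHamiltonian Z R hT) h1 (by simpa only [hT _ _] using hmin)
  have hΨ : SolvesSchroedinger Z R φ M E Ψ :=
    (solvesSchroedinger_iff Z R hT).2 ⟨ne_zero_of_inner_self_eq_one h1, hE⟩
  refine ⟨E, ⟨⟨Ψ, hΨ⟩, ?_⟩, hΨ⟩
  rintro E' ⟨Φ, hΦ⟩
  obtain ⟨h0, hΦT⟩ := (solvesSchroedinger_iff Z R hT).1 hΦ
  have hn : ⟪((‖Φ‖⁻¹ : ℝ) : 𝕜) • Φ, ((‖Φ‖⁻¹ : ℝ) : 𝕜) • Φ⟫_𝕜 = 1 := by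
    rw [inner_self_eq_one_iff_norm, RCLike.ofReal_inv]
    exact norm_smul_inv_norm h0
  have hs : SolvesSchroedinger Z R φ M E' (((‖Φ‖⁻¹ : ℝ) : 𝕜) • Φ) :=
    (solvesSchroedinger_iff Z R hT).2
      ⟨ne_zero_of_inner_self_eq_one hn, by rw [map_smul, hΦT, smul_comm]⟩
  have := hmin _ hn
  rwa [re_energyForm_of_solvesSchroedinger Z R hΨ h1,
    re_energyForm_of_solvesSchroedinger Z R hs hn] at this

theorem isFCIGroundState_iff_isRitzGroundState {M : ℕ} {T : fciSpace φ M →ₗ[𝕜] fciSpace φ M}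
    (hT : IsGalerkinHamiltonian Z R φ M T) (hφ : Orthonormal 𝕜 φ) (hM : M ≤ d)
    (Ψ : fciSpace φ M) : IsFCIGroundState Z R φ M Ψ ↔ IsRitzGroundState Z R φ M Ψ := by
  constructor
  · rintro ⟨h1, E, hE, hΨ⟩
    -- the lowest eigenvalue is the energy of a minimiser, hence the minimum of the energy
    obtain ⟨Ψ₀, h₀⟩ := exists_isRitzGroundState Z R hT hφ hM
    obtain ⟨E₀, hE₀, hΨ₀⟩ := exists_isLeast_of_isRitzGroundState Z R hT h₀
    refine ⟨h1, fun Φ hΦ => ?_⟩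
    rw [re_energyForm_of_solvesSchroedinger Z R hΨ h1, hE.unique hE₀,
      ← re_energyForm_of_solvesSchroedinger Z R hΨ₀ h₀.1]
    exact h₀.2 Φ hΦ
  · exact fun h => ⟨h.1, exists_isLeast_of_isRitzGroundState Z R hT h⟩

theorem isRitzGroundState_iff_isBinaryGroundState (hφ : Orthonormal 𝕜 φ)
    (hH1 : ∀ p, OneMemH1 (φ p)) (N : Fin (d + 1)) (Ψ : fciSpace φ (N : ℕ)) :
    IsRitzGroundState Z R φ (N : ℕ) Ψ ↔
      IsBinaryGroundState (binaryHamiltonian Z R φ) (binaryNumber 𝕜 d) (N : ℕ)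
        (fockIso hφ (Fock.incl φ N Ψ)) := by
  have hinner : ∀ Φ : fciSpace φ (N : ℕ),
      ⟪fockIso hφ (Fock.incl φ N Φ), fockIso hφ (Fock.incl φ N Φ)⟫_𝕜 = ⟪Φ, Φ⟫_𝕜 := fun Φ => by
    rw [← inner_fockIso_symm_apply, (fockIso hφ).symm_apply_apply, Fock.incl_apply_self]
  have henergy : ∀ Φ : fciSpace φ (N : ℕ),
      RCLike.re ⟪binaryHamiltonian Z R φ (fockIso hφ (Fock.incl φ N Φ)),
        fockIso hφ (Fock.incl φ N Φ)⟫_𝕜 =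
          RCLike.re (energyForm Z R (Φ : L2 𝕜 N) (Φ : L2 𝕜 N)) := fun Φ => by
    rw [energyForm_eq_inner_fockIso Z R hφ hH1, inner_re_symm]
  constructor
  · rintro ⟨h1, hmin⟩
    refine ⟨⟨(hinner Ψ).trans h1, (binaryNumber_eq_smul_iff hφ N _).2 ⟨Ψ, rfl⟩⟩, fun V hV hP => ?_⟩
    obtain ⟨Φ, rfl⟩ := (binaryNumber_eq_smul_iff hφ N V).1 hP
    rw [henergy, henergy]
    exact hmin Φ ((hinner Φ).symm.trans hV)
  · rintro ⟨⟨h1, _⟩, hmin⟩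
    refine ⟨(hinner Ψ).symm.trans h1, fun Φ hΦ => ?_⟩
    rw [← henergy, ← henergy]
    exact hmin _ ((hinner Φ).trans hΦ) ((binaryNumber_eq_smul_iff hφ N _).2 ⟨Φ, rfl⟩)

end GroundState

end FullCI

end

theorem mainTheorem1 {𝕜 : Type*} [RCLike 𝕜] {K d : ℕ}
    (Z : Fin K → ℕ) (R : Fin K → FullCI.Space)
    (φ : Fin d → FullCI.OneL2 𝕜) (hφ : Orthonormal 𝕜 φ) (hH1 : ∀ p, FullCI.OneMemH1 (φ p)) :
    -- the Full CI spaces consist of wave functions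
    (∀ M : ℕ, (FullCI.fciSpace φ M : Set (FullCI.L2 𝕜 M)) ⊆ FullCI.energySpace 𝕜 M) ∧
    -- all Coulomb integrals converge absolutely
    (∀ (M : ℕ) (Φ Ψ : FullCI.fciSpace φ M) (ξ : Fin M),
      Integrable (FullCI.nuclearIntegrand Z R ξ (Φ : FullCI.L2 𝕜 M) (Ψ : FullCI.L2 𝕜 M))
        (FullCI.configMeasure M) ∧
      ∀ ζ, ζ ≠ ξ →
        Integrable (FullCI.repulsionIntegrand ξ ζ (Φ : FullCI.L2 𝕜 M) (Ψ : FullCI.L2 𝕜 M))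
          (FullCI.configMeasure M)) ∧
    (∀ p q s, Integrable (FullCI.oneElectronIntegrand Z R (φ q) (φ p) s) volume) ∧
    (∀ a b p q s s', Integrable (fun r : FullCI.Space × FullCI.Space =>
      FullCI.twoElectronIntegrand φ a b p q s s' r.1 r.2) volume) ∧
    -- the isometry `ι` and the Galerkin-projected Hamiltonians `Π^d_M H`
    ∃ (ι : FullCI.Fock φ ≃ₗᵢ[𝕜] FullCI.Binary 𝕜 d)
      (T : ∀ M : Fin (d + 1), FullCI.fciSpace φ (M : ℕ) →ₗ[𝕜] FullCI.fciSpace φ (M : ℕ)),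
      (∀ (M : Fin (d + 1)) (p : Fin (M : ℕ) ↪o Fin d),
        ι (FullCI.Fock.incl φ M (FullCI.slaterFCI φ p)) =
          FullCI.tensorVec fun i => FullCI.e (FullCI.occupation p i)) ∧
      (∀ M : Fin (d + 1), FullCI.IsGalerkinHamiltonian Z R φ (M : ℕ) (T M)) ∧
      -- `𝐇 = ι ∘ Π H ∘ ι†` and `𝐏 = ι ∘ P ∘ ι†`; for the unitary map `ι`, `ι† = ι⁻¹`
      ι.toLinearMap ∘ₗ FullCI.Fock.blockDiag φ T ∘ₗ ι.symm.toLinearMap =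
        FullCI.binaryHamiltonian Z R φ ∧
      ι.toLinearMap ∘ₗ FullCI.Fock.number φ ∘ₗ ι.symm.toLinearMap =
        FullCI.binaryNumber 𝕜 d ∧
      -- the binary variational form of the `N`-electron problem
      ∀ N : Fin (d + 1),
        (∀ V : FullCI.Binary 𝕜 d, FullCI.binaryNumber 𝕜 d V = ((N : ℕ) : 𝕜) • V ↔
          ∃ Ψ : FullCI.fciSpace φ (N : ℕ), ι (FullCI.Fock.incl φ N Ψ) = V) ∧
        (∃ U, FullCI.IsBinaryGroundState (FullCI.binaryHamiltonian Z R φ)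
          (FullCI.binaryNumber 𝕜 d) (N : ℕ) U) ∧
        ∀ Ψ : FullCI.fciSpace φ (N : ℕ), List.TFAE [
          FullCI.IsFCIGroundState Z R φ (N : ℕ) Ψ,
          FullCI.IsRitzGroundState Z R φ (N : ℕ) Ψ,
          FullCI.IsBinaryGroundState (FullCI.binaryHamiltonian Z R φ)
            (FullCI.binaryNumber 𝕜 d) (N : ℕ) (ι (FullCI.Fock.incl φ N Ψ))] := by
  refine ⟨FullCI.fciSpace_subset_energySpace hH1, ?_,
    fun p q s => FullCI.integrable_oneElectronIntegrand Z R (hH1 q) (hH1 p) s,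
    FullCI.integrable_twoElectronIntegrand hH1,
    FullCI.fockIso hφ, FullCI.galerkin Z R hφ, FullCI.fockIso_incl_slaterFCI hφ,
    FullCI.isGalerkinHamiltonian_galerkin Z R hφ hH1,
    FullCI.fockIso_conj_eq hφ (FullCI.blockDiag_galerkin_incl Z R hφ),
    FullCI.fockIso_conj_number hφ, ?_⟩
  · rintro M ⟨Φ, hΦ⟩ ⟨Ψ, hΨ⟩ ξ
    obtain ⟨c, rfl⟩ := FullCI.exists_orbitalSum_eq hΦ
    obtain ⟨c', rfl⟩ := FullCI.exists_orbitalSum_eq hΨ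
    exact ⟨(FullCI.nuclear_orbitalSum Z R hφ hH1 c c' ξ).1,
      fun ζ hne => (FullCI.repulsion_orbitalSum hφ hH1 c c' hne).1⟩
  · intro N
    have hT := FullCI.isGalerkinHamiltonian_galerkin Z R hφ hH1 N
    have hN : (N : ℕ) ≤ d := Nat.lt_succ_iff.1 N.2
    have hbinary := FullCI.isRitzGroundState_iff_isBinaryGroundState Z R hφ hH1 N
    refine ⟨FullCI.binaryNumber_eq_smul_iff hφ N, ?_, fun Ψ => ?_⟩
    · obtain ⟨Ψ, hΨ⟩ := FullCI.exists_isRitzGroundState Z R hT hφ hN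
      exact ⟨_, (hbinary Ψ).1 hΨ⟩
    · tfae_have 1 ↔ 2 := FullCI.isFCIGroundState_iff_isRitzGroundState Z R hT hφ hN Ψ
      tfae_have 2 ↔ 3 := hbinary Ψ
      tfae_finish
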